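/- Let $\gamma>1$ and $A\neq 0$ be constants. Consider the system of magnetohydrodynamics for one-dimensional flows with cylindrical symmetry in mass Lagrangian coordinates $(t,s)$, for the unknowns $r,\theta,z,u,v,w,\rho,p,E^\theta,E^z,H^\theta,H^z$ with $r,\rho,p>0$ and with $H^r=A/r$: $$\rho_t=-\rho^2(ru)_s,\qquad u_t-\frac{v^2}{r}=-rp_s-\frac1{2r}\bigl(r^2(H^\theta)^2\bigr)_s-\frac r2\bigl((H^z)^2\bigr)_s,\qquad r_t=u,$$ $$v_t+\frac{uv}{r}=H^r(rH^\theta)_s,\qquad \theta_t=\frac vr,\qquad w_t=rH^rH^z_s,\qquad z_t=w,$$ $$p_t=-\gamma\rho p(ru)_s+(\gamma-1)\sigma\bigl((E^\theta)^2+(E^z)^2\bigr),$$ $$H^\theta_t=r\rho\bigl((vH^r+E^z)_s-H^\theta u_s\bigr),\qquad H^z_t=\rho\bigl((rwH^r-rE^\theta)_s-H^z(ru)_s\bigr),$$ $$\sigma E^\theta=-r\rho H^z_s,\qquad \sigma E^z=\rho(rH^\theta)_s,$$ where the conductivity $\sigma=\sigma(\rho,p)$ is a smooth nowhere vanishing function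 of $\rho,p>0$. Let $L(\sigma)$ be the space of generators of Lie point symmetries of the system, i.e. of the smooth vector fields $X$ in the $14$ independent and dependent variables, defined where $r,\rho,p>0$, whose first prolongation annihilates all equations of the system at all points of the first-order jet space that satisfy the system. Let $K$ be the linear span of $$\partial_t,\qquad \partial_s,\qquad t\partial_z+\partial_w,\qquad h_1(s)\partial_\theta,\qquad h_2(s)\partial_z,$$ where $h_1,h_2$ run over all smooth functions, and put $$Y_3=t\partial_t+2s\partial_s-u\partial_u-v\partial_v-w\partial_w+2\rho\partial_\rho-E^\theta\partial_{E^\theta}-E^z\partial_{E^z},$$ $$Y_4=-2s\partial_s+r\partial_r+z\partial_z+u\partial_u+v\partial_v+w\partial_w-4\rho\partial_\rho-2p\partial_p-H^\theta\partial_{H^\theta}-H^z\partial_{H^z}.$$ Then the kernel of the admitted Lie algebras, $\bigcap_\sigma L(\sigma)$, is equal to $K$. The fields $Y_3,Y_4$ are linearly independent modulo $K$, and for every $\sigma$: 1. if $\sigma=F(\rho)$ for some function $F$, and $\sigma$ is not of the form $C\sqrt\rho$ with a constant $C$, then $L(\sigma)=K\oplus\mathbb R\,(2Y_3+Y_4)$;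 2. if $\sigma=\sqrt\rho\,F(p\rho^\alpha)$ for some function $F$ and some $\alpha\in\mathbb R$, and $\sigma$ is not of the form $C\sqrt\rho$, then $L(\sigma)=K\oplus\mathbb R\,\bigl((1+2\alpha)Y_3+\alpha Y_4\bigr)$; 3. if $\sigma=C\sqrt\rho$ (which is of both preceding forms, for every $\alpha$), then $L(\sigma)=K\oplus\mathbb R Y_3\oplus\mathbb R Y_4$, the sum of all the extensions in 1 and 2; 4. if $\sigma$ is of none of these forms, then $L(\sigma)=K$. -/

import Mathlib

open scoped ContDiff

namespace CylMHD

/-- The independent variables: time and the mass Lagrangian coordinate. -/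
inductive Indep
  | t | s
  deriving DecidableEq

instance : Fintype Indep := ⟨{.t, .s}, by intro x; cases x <;> decide⟩

/-- The dependent variables. -/
inductive Dep
  | r | θ | z | u | v | w | ρ | p | Eθ | Ez | Hθ | Hz
  deriving DecidableEq

instance : Fintype Dep :=
  ⟨{.r, .θ, .z, .u, .v, .w, .ρ, .p, .Eθ, .Ez, .Hθ, .Hz}, by intro x; cases x <;> decide⟩

noncomputable section

/-- The space of all independent and dependent variables. -/
abbrev Pt : Type := (Indep → ℝ) × (Dep → ℝ)

/-- The first-order jet space: a point together with the values of the first-order derivatives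
(`q k j` stands for the derivative of the dependent variable `k` with respect to `j`). -/
abbrev Jet : Type := Pt × (Dep → Indep → ℝ)

/-- The physical domain: radius, density and pressure are positive. -/
def domain : Set Pt := {x | 0 < x.2 .r ∧ 0 < x.2 .ρ ∧ 0 < x.2 .p}

/-- The MHD system for cylindrical flows in mass Lagrangian coordinates, written as
`residual A γ σ k J = 0` for all `k` (each of the twelve equations is labelled by a dependent
variable). Here `H^r = A / r`, and derivatives of products are expanded by the Leibniz rule. -/
def residual (A γ : ℝ) (σ : ℝ → ℝ → ℝ) (k : Dep) (J : Jet) : ℝ :=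
  let r := J.1.2 .r
  let u := J.1.2 .u
  let v := J.1.2 .v
  let w := J.1.2 .w
  let ρ := J.1.2 .ρ
  let p := J.1.2 .p
  let Eθ := J.1.2 .Eθ
  let Ez := J.1.2 .Ez
  let Hθ := J.1.2 .Hθ
  let Hz := J.1.2 .Hz
  let dt : Dep → ℝ := fun i => J.2 i .t
  let ds : Dep → ℝ := fun i => J.2 i .s
  -- the radial magnetic field and its `s`-derivative
  let Hr := A / r
  let Hr_s := -(A * ds .r) / r ^ 2
  -- `(r u)_s`, `(r H^θ)_s`, `(r E^θ)_s`, `(r² (H^θ)²)_s`, `((H^z)²)_s`, `(v H^r)_s`, `(r w H^r)_s`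
  let ru_s := ds .r * u + r * ds .u
  let rHθ_s := ds .r * Hθ + r * ds .Hθ
  let rEθ_s := ds .r * Eθ + r * ds .Eθ
  let r2Hθ2_s := 2 * r * ds .r * Hθ ^ 2 + r ^ 2 * (2 * Hθ * ds .Hθ)
  let Hz2_s := 2 * Hz * ds .Hz
  let vHr_s := ds .v * Hr + v * Hr_s
  let rwHr_s := ds .r * w * Hr + r * ds .w * Hr + r * w * Hr_s
  match k with
  | .ρ => dt .ρ + ρ ^ 2 * ru_s
  | .u => dt .u - v ^ 2 / r + r * ds .p + 1 / (2 * r) * r2Hθ2_s + r / 2 * Hz2_s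
  | .r => dt .r - u
  | .v => dt .v + u * v / r - Hr * rHθ_s
  | .θ => dt .θ - v / r
  | .w => dt .w - r * Hr * ds .Hz
  | .z => dt .z - w
  | .p => dt .p + γ * ρ * p * ru_s - (γ - 1) * σ ρ p * (Eθ ^ 2 + Ez ^ 2)
  | .Hθ => dt .Hθ - r * ρ * (vHr_s + ds .Ez - Hθ * ds .u)
  | .Hz => dt .Hz - ρ * (rwHr_s - rEθ_s - Hz * ru_s)
  | .Eθ => σ ρ p * Eθ + r * ρ * ds .Hz
  | .Ez => σ ρ p * Ez - ρ * rHθ_s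

/-- The total derivative `D_j f` of a function of the independent and dependent variables. -/
def totalDeriv (j : Indep) (f : Pt → ℝ) (J : Jet) : ℝ :=
  fderiv ℝ f J.1 (Pi.single j 1, fun k => J.2 k j)

/-- The first prolongation of a vector field `X`, with components `(X x).1 i = ξ^i` and
`(X x).2 k = η^k`: the coefficient at the derivative of `k` with respect to `j` is
`D_j η^k - ∑ i, u^k_i D_j ξ^i`. -/
def prolong (X : Pt → Pt) (J : Jet) : Jet :=
  (X J.1, fun k j => totalDeriv j (fun x => (X x).2 k) J
    - ∑ i, J.2 k i * totalDeriv j (fun x => (X x).1 i) J)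

/-- The infinitesimal criterion of invariance: the prolonged vector field annihilates every
equation at every point of the jet space (over the domain) that satisfies the system. -/
def IsAdmitted (A γ : ℝ) (σ : ℝ → ℝ → ℝ) (X : Pt → Pt) : Prop :=
  ∀ J : Jet, J.1 ∈ domain → (∀ k, residual A γ σ k J = 0) →
    ∀ k, fderiv ℝ (residual A γ σ k) J (prolong X J) = 0

lemma isOpen_domain : IsOpen domain := by
  have h : ∀ k : Dep, IsOpen {x : Pt | 0 < x.2 k} := fun k =>
    isOpen_lt continuous_const ((continuous_apply k).comp continuous_snd)
  exact (h .r).inter ((h .ρ).inter (h .p))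

lemma prolong_add {X Y : Pt → Pt} {J : Jet} (hX : DifferentiableAt ℝ X J.1)
    (hY : DifferentiableAt ℝ Y J.1) : prolong (X + Y) J = prolong X J + prolong Y J := by
  refine Prod.ext rfl (funext fun k => funext fun j => ?_)
  have h1 : ∀ i, totalDeriv j (fun x => ((X + Y) x).1 i) J
      = totalDeriv j (fun x => (X x).1 i) J + totalDeriv j (fun x => (Y x).1 i) J := fun i => by
    simp only [totalDeriv, Pi.add_apply, Prod.fst_add]
    rw [fderiv_fun_add (by fun_prop) (by fun_prop)]; rfl
  have h2 : totalDeriv j (fun x => ((X + Y) x).2 k) J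
      = totalDeriv j (fun x => (X x).2 k) J + totalDeriv j (fun x => (Y x).2 k) J := by
    simp only [totalDeriv, Pi.add_apply, Prod.snd_add]
    rw [fderiv_fun_add (by fun_prop) (by fun_prop)]; rfl
  unfold prolong
  simp only [h1, h2]
  simp only [Prod.snd_add, Pi.add_apply, mul_add, Finset.sum_add_distrib]
  ring

lemma prolong_smul (c : ℝ) {X : Pt → Pt} {J : Jet} (hX : DifferentiableAt ℝ X J.1) :
    prolong (c • X) J = c • prolong X J := by
  refine Prod.ext rfl (funext fun k => funext fun j => ?_)
  have h1 : ∀ i, totalDeriv j (fun x => ((c • X) x).1 i) J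
      = c * totalDeriv j (fun x => (X x).1 i) J := fun i => by
    simp only [totalDeriv, Pi.smul_apply, Prod.smul_fst]
    rw [fderiv_fun_const_smul (by fun_prop)]; rfl
  have h2 : totalDeriv j (fun x => ((c • X) x).2 k) J
      = c * totalDeriv j (fun x => (X x).2 k) J := by
    simp only [totalDeriv, Pi.smul_apply, Prod.smul_snd]
    rw [fderiv_fun_const_smul (by fun_prop)]; rfl
  unfold prolong
  simp only [h1, h2]
  simp only [Prod.smul_snd, Pi.smul_apply, smul_eq_mul, mul_sub, Finset.mul_sum]
  congr 1
  exact Finset.sum_congr rfl fun i _ => by ring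

/-- The space of generators of Lie point symmetries of the system: vector fields, smooth on the
domain, that satisfy the infinitesimal criterion. Vector fields on the domain are represented by
total functions, whose values off the domain are irrelevant. -/
def admittedAlgebra (A γ : ℝ) (σ : ℝ → ℝ → ℝ) : Submodule ℝ (Pt → Pt) where
  carrier := {X | ContDiffOn ℝ ∞ X domain ∧ IsAdmitted A γ σ X}
  zero_mem' := by
    refine ⟨contDiffOn_const, fun J _ _ k => ?_⟩
    have h : prolong 0 J = 0 := by
      simpa using prolong_smul (0 : ℝ) (X := 0) (J := J) (differentiableAt_const _)
    rw [h, map_zero]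
  add_mem' := by
    rintro X Y ⟨hX, hX'⟩ ⟨hY, hY'⟩
    refine ⟨hX.add hY, fun J hJ hs k => ?_⟩
    have hn := isOpen_domain.mem_nhds hJ
    rw [prolong_add ((hX.contDiffAt hn).differentiableAt (by simp))
      ((hY.contDiffAt hn).differentiableAt (by simp)), map_add, hX' J hJ hs k, hY' J hJ hs k,
      add_zero]
  smul_mem' := by
    rintro c X ⟨hX, hX'⟩
    refine ⟨hX.const_smul c, fun J hJ hs k => ?_⟩
    have hn := isOpen_domain.mem_nhds hJ
    rw [prolong_smul c ((hX.contDiffAt hn).differentiableAt (by simp)), map_smul, hX' J hJ hs k,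
      smul_zero]

/-- The functions that vanish on the domain, i.e. the representatives of the zero field. -/
def zeroFields : Submodule ℝ (Pt → Pt) where
  carrier := {X | ∀ x ∈ domain, X x = 0}
  zero_mem' := fun _ _ => rfl
  add_mem' := fun hX hY x hx => by simp [hX x hx, hY x hx]
  smul_mem' := fun c X hX x hx => by simp [hX x hx]

/-- `∂_t` -/
def dT : Pt → Pt := fun _ => (Pi.single .t 1, 0)

/-- `∂_s` -/
def dS : Pt → Pt := fun _ => (Pi.single .s 1, 0)

/-- `t ∂_z + ∂_w` -/
def galilei : Pt → Pt := fun x => (0, Pi.single .z (x.1 .t) + Pi.single .w 1)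

/-- `h(s) ∂_θ` -/
def rotation (h : ℝ → ℝ) : Pt → Pt := fun x => (0, Pi.single .θ (h (x.1 .s)))

/-- `h(s) ∂_z` -/
def translation (h : ℝ → ℝ) : Pt → Pt := fun x => (0, Pi.single .z (h (x.1 .s)))

/-- The linear span of `∂_t`, `∂_s`, `t ∂_z + ∂_w` and of all `h₁(s) ∂_θ`, `h₂(s) ∂_z` with smooth
`h₁`, `h₂` (as vector fields on the domain). -/
def kernelAlgebra : Submodule ℝ (Pt → Pt) :=
  Submodule.span ℝ ({dT, dS, galilei} ∪ rotation '' {h | ContDiff ℝ ∞ h}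
    ∪ translation '' {h | ContDiff ℝ ∞ h}) ⊔ zeroFields

/-- `t ∂_t + 2s ∂_s - u ∂_u - v ∂_v - w ∂_w + 2ρ ∂_ρ - E^θ ∂_{E^θ} - E^z ∂_{E^z}` -/
def Y₃ : Pt → Pt := fun x =>
  (fun
    | .t => x.1 .t
    | .s => 2 * x.1 .s,
   fun
    | .u => -x.2 .u
    | .v => -x.2 .v
    | .w => -x.2 .w
    | .ρ => 2 * x.2 .ρ
    | .Eθ => -x.2 .Eθ
    | .Ez => -x.2 .Ez
    | _ => 0)

/-- `-2s ∂_s + r ∂_r + z ∂_z + u ∂_u + v ∂_v + w ∂_w - 4ρ ∂_ρ - 2p ∂_p - H^θ ∂_{H^θ} - H^z ∂_{H^z}` -/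
def Y₄ : Pt → Pt := fun x =>
  (fun
    | .t => 0
    | .s => -2 * x.1 .s,
   fun
    | .r => x.2 .r
    | .z => x.2 .z
    | .u => x.2 .u
    | .v => x.2 .v
    | .w => x.2 .w
    | .ρ => -4 * x.2 .ρ
    | .p => -2 * x.2 .p
    | .Hθ => -x.2 .Hθ
    | .Hz => -x.2 .Hz
    | _ => 0)

/-- The admissible conductivities `σ(ρ, p)`: smooth and nowhere zero for positive arguments. -/
def IsConductivity (σ : ℝ → ℝ → ℝ) : Prop :=
  ContDiffOn ℝ ∞ (fun x : ℝ × ℝ => σ x.1 x.2) (Set.Ioi 0 ×ˢ Set.Ioi 0) ∧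
    ∀ ρ p : ℝ, 0 < ρ → 0 < p → σ ρ p ≠ 0

/-- `σ = F(ρ)` -/
def IsDensityForm (σ : ℝ → ℝ → ℝ) : Prop :=
  ∃ F : ℝ → ℝ, ∀ ρ p : ℝ, 0 < ρ → 0 < p → σ ρ p = F ρ

/-- `σ = √ρ F(p ρ^α)` -/
def IsPowerForm (α : ℝ) (σ : ℝ → ℝ → ℝ) : Prop :=
  ∃ F : ℝ → ℝ, ∀ ρ p : ℝ, 0 < ρ → 0 < p → σ ρ p = √ρ * F (p * ρ ^ α)

/-- `σ = C √ρ` -/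
def IsSqrtForm (σ : ℝ → ℝ → ℝ) : Prop :=
  ∃ C : ℝ, ∀ ρ p : ℝ, 0 < ρ → 0 < p → σ ρ p = C * √ρ

end

end CylMHD

/-! On the solution manifold the twelve derivatives collected in `FreeJet` are free, and all other
first derivatives are functions of them and of the point. A linearised equation, evaluated on the
prolongation of a symmetry, is therefore a polynomial in the free derivatives that vanishes
identically, and each of its coefficients is a determining equation. The coefficients are extracted
by differences between jets in which a few free derivatives are set to `1` or `-1`. Once a
coefficient function is known not to depend on a dependent variable, an equation can be split in
that variable as well, by changing its value with `upd`.

The splitting is triangular. The equation for `θ` gives `D_t ξ^s = 0`. Products of two free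
derivatives then show that `ξ^t` depends on `t` only and `ξ^s` on `s` only. The equations for `r`,
`θ`, `z` express `η^u`, `η^v`, `η^w` through `η^r`, `η^θ`, `η^z`. The pressure and momentum
equations force `η^r = b r`, `η^θ = h₁(s)`, and constant `a = ξ^t_t`, `c = ξ^s_s`. Axial momentum,
Joule heating and induction determine everything else, together with `c = 2a - 2b`. The result is
`IsSymmetry.exists_normalForm`: a symmetry is an element of `K` plus `a Y₃ + b Y₄`, and Joule
heating leaves one condition on the conductivity, `(2a - 4b) ρ σ_ρ - 2b p σ_p = (a - 2b) σ`
(`IsScaled`). Conversely, `normalForm_mem` shows that this condition suffices.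

The classification is thereby reduced to a linear first-order equation for `σ`, integrated along its
characteristics in `isScaled_iff`. If `a = 2b ≠ 0`, then `σ` does not depend on `p`. If `a ≠ 2b`,
then `σ = √ρ F(p ρ^α)` with `α = b / (a - 2b)`. Within each of these forms, a pair `(a, b)` off the
corresponding line forces `σ = C √ρ`, for which every pair is allowed. The kernel is found from the
single conductivity `1 + p`, which has none of the special forms. -/

namespace CylMHD

/-! ### Calculus of partial derivatives on the convex domain -/

noncomputable section

/-- All independent and dependent variables. -/
abbrev Var : Type := Indep ⊕ Dep

/-- The coordinate directions of `Pt`. -/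
def dir : Var → Pt
  | .inl i => (Pi.single i 1, 0)
  | .inr k => (0, Pi.single k 1)

/-- The coordinate functions of `Pt`. -/
def coord : Var → Pt → ℝ
  | .inl i => fun x => x.1 i
  | .inr k => fun x => x.2 k

/-- The partial derivative of a function of the independent and dependent variables. -/
def pd (a : Var) (f : Pt → ℝ) (x : Pt) : ℝ := fderiv ℝ f x (dir a)

lemma sum_indep {M : Type*} [AddCommMonoid M] (f : Indep → M) : ∑ i, f i = f .t + f .s := by
  have h : (Finset.univ : Finset Indep) = {.t, .s} := rfl
  rw [h, Finset.sum_pair (by decide)]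

lemma sum_dep {M : Type*} [AddCommMonoid M] (f : Dep → M) :
    ∑ k, f k = f .r + (f .θ + (f .z + (f .u + (f .v + (f .w + (f .ρ + (f .p + (f .Eθ + (f .Ez
      + (f .Hθ + f .Hz)))))))))) := by
  have h : (Finset.univ : Finset Dep)
      = {.r, .θ, .z, .u, .v, .w, .ρ, .p, .Eθ, .Ez, .Hθ, .Hz} := rfl
  rw [h]
  repeat rw [Finset.sum_insert (by decide)]
  rw [Finset.sum_singleton]

lemma eq_sum_coord (v : Pt) : v = ∑ a, coord a v • dir a := by
  rw [Fintype.sum_sum_type]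
  refine Prod.ext ?_ ?_
  · funext i
    simp [coord, dir, Prod.fst_sum, Finset.sum_apply, Pi.single_apply]
  · funext k
    simp [coord, dir, Prod.snd_sum, Finset.sum_apply, Pi.single_apply]

lemma fderiv_apply_eq_sum (f : Pt → ℝ) (x v : Pt) :
    fderiv ℝ f x v = ∑ a, coord a v * pd a f x := by
  conv_lhs => rw [eq_sum_coord v]
  simp [map_sum, pd]

lemma totalDeriv_eq (j : Indep) (f : Pt → ℝ) (J : Jet) :
    totalDeriv j f J = pd (.inl j) f J.1 + ∑ k, J.2 k j * pd (.inr k) f J.1 := by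
  rw [totalDeriv, fderiv_apply_eq_sum, Fintype.sum_sum_type]
  simp [coord, Pi.single_apply]

lemma convex_domain : Convex ℝ domain := by
  have h : ∀ k : Dep, Convex ℝ {x : Pt | 0 < x.2 k} := fun k => by
    have := (convex_Ioi (0 : ℝ)).linear_preimage
      ((LinearMap.proj k : (Dep → ℝ) →ₗ[ℝ] ℝ) ∘ₗ LinearMap.snd ℝ (Indep → ℝ) (Dep → ℝ))
    exact this
  exact (h .r).inter ((h .ρ).inter (h .p))

/-- A function on the domain does not depend on the variables along which its partial derivatives
vanish. -/
lemma eq_of_pd_eq_zero {f : Pt → ℝ} (hf : ContDiffOn ℝ ∞ f domain) {x y : Pt} (hx : x ∈ domain)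
    (hy : y ∈ domain) (h : ∀ a, coord a x ≠ coord a y → ∀ z ∈ domain, pd a f z = 0) :
    f x = f y := by
  have hseg : ∀ c ∈ Set.Icc (0 : ℝ) 1, x + c • (y - x) ∈ domain := fun c hc =>
    convex_domain.add_smul_sub_mem hx hy hc
  have hder : ∀ c ∈ Set.Icc (0 : ℝ) 1,
      HasDerivAt (fun c : ℝ => f (x + c • (y - x))) 0 c := fun c hc => by
    have h1 : HasDerivAt (fun c : ℝ => x + c • (y - x)) (y - x) c := by
      simpa using ((hasDerivAt_id c).smul_const (y - x)).const_add x
    have hd := ((hf.contDiffAt (isOpen_domain.mem_nhds (hseg c hc))).differentiableAt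
      (by simp)).hasFDerivAt
    have h2 := hd.comp_hasDerivAt c h1
    have h3 : fderiv ℝ f (x + c • (y - x)) (y - x) = 0 := by
      rw [fderiv_apply_eq_sum]
      refine Finset.sum_eq_zero fun a _ => ?_
      by_cases ha : coord a x = coord a y
      · have : coord a (y - x) = 0 := by
          cases a <;> simp_all [coord]
        rw [this, zero_mul]
      · rw [h a ha _ (hseg c hc), mul_zero]
    rw [h3] at h2
    exact h2
  have := constant_of_has_deriv_right_zero (f := fun c : ℝ => f (x + c • (y - x))) (a := 0) (b := 1)
    (fun c hc => (hder c hc).continuousAt.continuousWithinAt)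
    (fun c hc => (hder c ⟨hc.1, hc.2.le⟩).hasDerivWithinAt) 1 (by simp)
  simpa using this.symm

lemma contDiffOn_pd {f : Pt → ℝ} (hf : ContDiffOn ℝ ∞ f domain) (a : Var) :
    ContDiffOn ℝ ∞ (pd a f) domain :=
  (hf.fderiv_of_isOpen isOpen_domain (m := ∞) (by simp)).clm_apply contDiffOn_const

lemma pd_congr {f g : Pt → ℝ} (h : ∀ x ∈ domain, f x = g x) (a : Var) {x : Pt}
    (hx : x ∈ domain) : pd a f x = pd a g x := by
  have : f =ᶠ[nhds x] g := Filter.eventuallyEq_of_mem (isOpen_domain.mem_nhds hx) h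
  rw [pd, pd, this.fderiv_eq]

lemma pd_comm {f : Pt → ℝ} (hf : ContDiffOn ℝ ∞ f domain) (a b : Var) {x : Pt}
    (hx : x ∈ domain) : pd a (pd b f) x = pd b (pd a f) x := by
  have hc := hf.contDiffAt (isOpen_domain.mem_nhds hx)
  have hd : DifferentiableAt ℝ (fderiv ℝ f) x :=
    (hc.fderiv_right (m := 1) (by norm_cast)).differentiableAt (by simp)
  have key : ∀ v w : Pt, fderiv ℝ (fun y => fderiv ℝ f y v) x w
      = fderiv ℝ (fderiv ℝ f) x w v := fun v w => by
    rw [fderiv_clm_apply hd (by fun_prop)]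
    simp
  have hs : IsSymmSndFDerivAt ℝ f x := hc.isSymmSndFDerivAt 
    (by rw [minSmoothness_of_isRCLikeNormedField]; exact WithTop.coe_le_coe.2 le_top)
  exact (key _ _).trans ((hs _ _).trans (key _ _).symm)

/-- If `f` does not depend on `a`, neither do its partial derivatives. -/
lemma pd_pd_eq_zero {f : Pt → ℝ} (hf : ContDiffOn ℝ ∞ f domain) {a : Var}
    (h : ∀ x ∈ domain, pd a f x = 0) (b : Var) : ∀ x ∈ domain, pd a (pd b f) x = 0 := by
  intro x hx
  rw [pd_comm hf a b hx, pd_congr (g := fun _ => 0) h b hx]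
  simp [pd]

lemma pd_const (a : Var) (c : ℝ) (x : Pt) : pd a (fun _ => c) x = 0 := by simp [pd]

lemma pd_coord (a b : Var) (x : Pt) : pd a (coord b) x = if a = b then 1 else 0 := by
  have h : ∀ (L : Pt →L[ℝ] ℝ), fderiv ℝ (fun x => L x) x = L := fun L => L.fderiv
  rcases b with i | k
  · have := h ((ContinuousLinearMap.proj i : (Indep → ℝ) →L[ℝ] ℝ).comp
      (ContinuousLinearMap.fst ℝ (Indep → ℝ) (Dep → ℝ)))
    change fderiv ℝ (fun x : Pt => x.1 i) x (dir a) = _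
    change fderiv ℝ (fun x : Pt => x.1 i) x = _ at this
    rw [this]
    rcases a with j | l <;> simp [dir, Pi.single_apply, eq_comm]
  · have := h ((ContinuousLinearMap.proj k : (Dep → ℝ) →L[ℝ] ℝ).comp
      (ContinuousLinearMap.snd ℝ (Indep → ℝ) (Dep → ℝ)))
    change fderiv ℝ (fun x : Pt => x.2 k) x (dir a) = _
    change fderiv ℝ (fun x : Pt => x.2 k) x = _ at this
    rw [this]
    rcases a with j | l <;> simp [dir, Pi.single_apply, eq_comm]

lemma contDiffOn_coord (a : Var) : ContDiffOn ℝ ∞ (coord a) domain := by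
  rcases a with i | k <;> simp only [coord] <;> fun_prop

lemma pd_add {f g : Pt → ℝ} (hf : ContDiffOn ℝ ∞ f domain) (hg : ContDiffOn ℝ ∞ g domain)
    (a : Var) {x : Pt} (hx : x ∈ domain) :
    pd a (fun x => f x + g x) x = pd a f x + pd a g x := by
  have hn := isOpen_domain.mem_nhds hx
  rw [pd, fderiv_fun_add ((hf.contDiffAt hn).differentiableAt (by simp))
    ((hg.contDiffAt hn).differentiableAt (by simp))]
  rfl

lemma pd_mul {f g : Pt → ℝ} (hf : ContDiffOn ℝ ∞ f domain) (hg : ContDiffOn ℝ ∞ g domain)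
    (a : Var) {x : Pt} (hx : x ∈ domain) :
    pd a (fun x => f x * g x) x = f x * pd a g x + g x * pd a f x := by
  have hn := isOpen_domain.mem_nhds hx
  rw [pd, fderiv_fun_mul ((hf.contDiffAt hn).differentiableAt (by simp))
    ((hg.contDiffAt hn).differentiableAt (by simp))]
  simp [pd]

end

/-! ### Linearisation of the equations -/

noncomputable section

/-- The partial derivative of the conductivity with respect to the density. -/
def dρ (σ : ℝ → ℝ → ℝ) (ρ p : ℝ) : ℝ := fderiv ℝ (fun x : ℝ × ℝ => σ x.1 x.2) (ρ, p) (1, 0)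

/-- The partial derivative of the conductivity with respect to the pressure. -/
def dp (σ : ℝ → ℝ → ℝ) (ρ p : ℝ) : ℝ := fderiv ℝ (fun x : ℝ × ℝ => σ x.1 x.2) (ρ, p) (0, 1)

lemma IsConductivity.hasFDerivAt {σ : ℝ → ℝ → ℝ} (hσ : IsConductivity σ) {ρ p : ℝ} (hρ : 0 < ρ)
    (hp : 0 < p) : HasFDerivAt (fun x : ℝ × ℝ => σ x.1 x.2)
      (fderiv ℝ (fun x : ℝ × ℝ => σ x.1 x.2) (ρ, p)) (ρ, p) :=
  ((hσ.1.contDiffAt ((isOpen_Ioi.prod isOpen_Ioi).mem_nhds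
    (Set.mk_mem_prod hρ hp))).differentiableAt (by simp)).hasFDerivAt

lemma fderiv_conductivity_apply (σ : ℝ → ℝ → ℝ) (ρ p : ℝ) (v : ℝ × ℝ) :
    fderiv ℝ (fun x : ℝ × ℝ => σ x.1 x.2) (ρ, p) v = dρ σ ρ p * v.1 + dp σ ρ p * v.2 := by
  have : v = v.1 • (1, 0) + v.2 • ((0 : ℝ), (1 : ℝ)) := by ext <;> simp
  conv_lhs => rw [this, map_add, map_smul, map_smul]
  simp only [dρ, dp, smul_eq_mul]
  ring

lemma IsConductivity.hasDerivAt_comp {σ : ℝ → ℝ → ℝ} (hσ : IsConductivity σ) {f g : ℝ → ℝ}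
    {f' g' c : ℝ} (hf : HasDerivAt f f' c) (hg : HasDerivAt g g' c) (hf0 : 0 < f c)
    (hg0 : 0 < g c) :
    HasDerivAt (fun c => σ (f c) (g c)) (dρ σ (f c) (g c) * f' + dp σ (f c) (g c) * g') c := by
  have := (hσ.hasFDerivAt hf0 hg0).comp_hasDerivAt c (hf.prodMk hg)
  rwa [fderiv_conductivity_apply] at this

/-- The differential of `residual A γ σ k` at the jet `J` in the direction `δ`. -/
def linResidual (A γ : ℝ) (σ : ℝ → ℝ → ℝ) (k : Dep) (J δ : Jet) : ℝ :=
  let r := J.1.2 .r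
  let u := J.1.2 .u
  let v := J.1.2 .v
  let ρ := J.1.2 .ρ
  let p := J.1.2 .p
  let Eθ := J.1.2 .Eθ
  let Ez := J.1.2 .Ez
  let Hθ := J.1.2 .Hθ
  let Hz := J.1.2 .Hz
  let ds : Dep → ℝ := fun i => J.2 i .s
  let η : Dep → ℝ := δ.1.2
  let ζt : Dep → ℝ := fun i => δ.2 i .t
  let ζs : Dep → ℝ := fun i => δ.2 i .s
  let σ' := dρ σ ρ p * η .ρ + dp σ ρ p * η .p
  -- `(r u)_s`, `(r H^θ)_s` and the variations of `(r u)_s`, `(r H^θ)_s`, `(r E^θ)_s`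
  let ru_s := ds .r * u + r * ds .u
  let rHθ_s := ds .r * Hθ + r * ds .Hθ
  let ru_s' := ζs .r * u + ds .r * η .u + η .r * ds .u + r * ζs .u
  let rHθ_s' := ζs .r * Hθ + ds .r * η .Hθ + η .r * ds .Hθ + r * ζs .Hθ
  let rEθ_s' := ζs .r * Eθ + ds .r * η .Eθ + η .r * ds .Eθ + r * ζs .Eθ
  match k with
  | .ρ => ζt .ρ + 2 * ρ * η .ρ * ru_s + ρ ^ 2 * ru_s'
  | .u => ζt .u - 2 * v * η .v / r + v ^ 2 * η .r / r ^ 2 + η .r * ds .p + r * ζs .p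
      + η .Hθ * rHθ_s + Hθ * rHθ_s' + (η .r * Hz + r * η .Hz) * ds .Hz + r * Hz * ζs .Hz
  | .r => ζt .r - η .u
  | .v => ζt .v + (η .u * v + u * η .v) / r - u * v * η .r / r ^ 2
      + A * η .r / r ^ 2 * rHθ_s - A / r * rHθ_s'
  | .θ => ζt .θ - η .v / r + v * η .r / r ^ 2
  | .w => ζt .w - A * ζs .Hz
  | .z => ζt .z - η .w
  | .p => ζt .p + γ * (η .ρ * p + ρ * η .p) * ru_s + γ * ρ * p * ru_s'
      - (γ - 1) * (σ' * (Eθ ^ 2 + Ez ^ 2) + 2 * σ ρ p * (Eθ * η .Eθ + Ez * η .Ez))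
  | .Hθ => ζt .Hθ - η .ρ * (A * ds .v - A * v / r * ds .r + r * (ds .Ez - Hθ * ds .u))
      - ρ * (A * ζs .v - A * v / r * ζs .r - (A * η .v / r - A * v * η .r / r ^ 2) * ds .r
        + η .r * (ds .Ez - Hθ * ds .u) + r * (ζs .Ez - η .Hθ * ds .u - Hθ * ζs .u))
  | .Hz => ζt .Hz - η .ρ * (A * ds .w - (ds .r * Eθ + r * ds .Eθ) - Hz * ru_s)
      - ρ * (A * ζs .w - rEθ_s' - η .Hz * ru_s - Hz * ru_s')
  | .Eθ => σ' * Eθ + σ ρ p * η .Eθ + (η .r * ρ + r * η .ρ) * ds .Hz + r * ρ * ζs .Hz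
  | .Ez => σ' * Ez + σ ρ p * η .Ez - η .ρ * rHθ_s - ρ * rHθ_s'

lemma differentiableAt_residual {A γ : ℝ} {σ : ℝ → ℝ → ℝ} (hσ : IsConductivity σ) (k : Dep)
    {J : Jet} (hJ : J.1 ∈ domain) : DifferentiableAt ℝ (residual A γ σ k) J := by
  obtain ⟨hr, hρ, hp⟩ := hJ
  have hr2 : J.1.2 .r ^ 2 ≠ 0 := by positivity
  have hr1 : 2 * J.1.2 .r ≠ 0 := by positivity
  have hr0 := hr.ne'
  have hσ' : DifferentiableAt ℝ (fun J : Jet => σ (J.1.2 .ρ) (J.1.2 .p)) J := by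
    have h : DifferentiableAt ℝ (fun J : Jet => (J.1.2 .ρ, J.1.2 .p)) J := by fun_prop
    exact DifferentiableAt.comp (g := fun x : ℝ × ℝ => σ x.1 x.2) J
      (hσ.hasFDerivAt hρ hp).differentiableAt h
  -- The composite with `σ` becomes an opaque function `S`, so that `fun_prop` takes its
  -- differentiability from the context.
  obtain ⟨S, hS⟩ : ∃ S : Jet → ℝ, S = fun J => σ (J.1.2 .ρ) (J.1.2 .p) := ⟨_, rfl⟩
  rw [← hS] at hσ'
  have hS' : ∀ J : Jet, σ (J.1.2 .ρ) (J.1.2 .p) = S J := fun J => by rw [hS]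
  change DifferentiableAt ℝ (fun J => residual A γ σ k J) J
  cases k <;> simp only [residual, hS'] <;> fun_prop (disch := assumption)

/-- Differentiability being known, the value of the differential on `δ` is the ordinary derivative
along the line `J + c • δ` at `c = 0`, which the one-variable rules compute. -/
lemma fderiv_residual {A γ : ℝ} {σ : ℝ → ℝ → ℝ} (hσ : IsConductivity σ) (k : Dep)
    {J : Jet} (hJ : J.1 ∈ domain) (δ : Jet) :
    fderiv ℝ (residual A γ σ k) J δ = linResidual A γ σ k J δ := by
  obtain ⟨hr, hρ, hp⟩ := id hJ
  have hr0 := hr.ne'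
  have h1 : HasDerivAt (fun c : ℝ => J + c • δ) δ 0 := by
    simpa using ((hasDerivAt_id (0 : ℝ)).smul_const δ).const_add J
  have h2 : HasDerivAt (fun c : ℝ => residual A γ σ k (J + c • δ))
      (fderiv ℝ (residual A γ σ k) J δ) 0 := by
    refine HasFDerivAt.comp_hasDerivAt (l := residual A γ σ k) (0 : ℝ) ?_ h1
    simpa using (differentiableAt_residual hσ k hJ).hasFDerivAt
  refine h2.unique ?_
  have line : ∀ a b : ℝ, HasDerivAt (fun c : ℝ => a + c * b) b 0 := fun a b => by
    simpa using ((hasDerivAt_id (0 : ℝ)).mul_const b).const_add a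
  have q : ∀ k j, HasDerivAt (fun c : ℝ => J.2 k j + c * δ.2 k j) (δ.2 k j) 0 :=
    fun k j => line _ _
  have x : ∀ k, HasDerivAt (fun c : ℝ => J.1.2 k + c * δ.1.2 k) (δ.1.2 k) 0 := fun k => line _ _
  have hs : HasDerivAt (fun c : ℝ => σ (J.1.2 .ρ + c * δ.1.2 .ρ) (J.1.2 .p + c * δ.1.2 .p))
      (dρ σ (J.1.2 .ρ) (J.1.2 .p) * δ.1.2 .ρ + dp σ (J.1.2 .ρ) (J.1.2 .p) * δ.1.2 .p) 0 := by
    simpa using hσ.hasDerivAt_comp (x .ρ) (x .p) (by simpa using hρ) (by simpa using hp)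
  have hrc : J.1.2 .r + 0 * δ.1.2 .r ≠ 0 := by simpa using hr0
  have hr2 : (J.1.2 .r + 0 * δ.1.2 .r) ^ 2 ≠ 0 := pow_ne_zero 2 hrc
  have hr3 : 2 * (J.1.2 .r + 0 * δ.1.2 .r) ≠ 0 := mul_ne_zero two_ne_zero hrc
  have ru := ((q .r .s).mul (x .u)).add ((x .r).mul (q .u .s))
  have rH := ((q .r .s).mul (x .Hθ)).add ((x .r).mul (q .Hθ .s))
  have rE := ((q .r .s).mul (x .Eθ)).add ((x .r).mul (q .Eθ .s))
  have Hr := (hasDerivAt_const (0 : ℝ) A).div (x .r) hrc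
  have Hrs := (((q .r .s).const_mul A).neg).div ((x .r).pow 2) hr2
  simp only [residual, Prod.fst_add, Prod.snd_add, Prod.smul_fst, Prod.smul_snd, Pi.add_apply,
    Pi.smul_apply, smul_eq_mul]
  cases k
  case r => exact (q .r .t).sub (x .u)
  case z => exact (q .z .t).sub (x .w)
  case θ =>
    refine ((q .θ .t).sub ((x .v).div (x .r) hrc)).congr_deriv ?_
    simp [linResidual]; field_simp; ring
  case ρ =>
    refine ((q .ρ .t).add (((x .ρ).pow 2).mul ru)).congr_deriv ?_
    simp [linResidual]; ring
  case u =>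
    refine (((((q .u .t).sub (((x .v).pow 2).div (x .r) hrc)).add ((x .r).mul (q .p .s))).add
      (((hasDerivAt_const (0 : ℝ) (1 : ℝ)).div ((x .r).const_mul 2) hr3).mul
        (((((x .r).const_mul 2).mul (q .r .s)).mul ((x .Hθ).pow 2)).add
          (((x .r).pow 2).mul (((x .Hθ).const_mul 2).mul (q .Hθ .s)))))).add
      (((x .r).div_const 2).mul (((x .Hz).const_mul 2).mul (q .Hz .s)))).congr_deriv ?_
    simp [linResidual]; field_simp; ring
  case v =>
    refine (((q .v .t).add (((x .u).mul (x .v)).div (x .r) hrc)).sub (Hr.mul rH)).congr_deriv ?_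
    simp [linResidual]; field_simp; ring
  case w =>
    refine ((q .w .t).sub (((x .r).mul Hr).mul (q .Hz .s))).congr_deriv ?_
    simp [linResidual]; field_simp; ring
  case p =>
    refine (((q .p .t).add ((((x .ρ).const_mul γ).mul (x .p)).mul ru)).sub
      ((hs.const_mul (γ - 1)).mul (((x .Eθ).pow 2).add ((x .Ez).pow 2)))).congr_deriv ?_
    simp [linResidual]; ring
  case Hθ =>
    refine ((q .Hθ .t).sub (((x .r).mul (x .ρ)).mul (((((q .v .s).mul Hr).add
      ((x .v).mul Hrs)).add (q .Ez .s)).sub ((x .Hθ).mul (q .u .s))))).congr_deriv ?_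
    simp [linResidual]; field_simp; ring
  case Hz =>
    refine ((q .Hz .t).sub ((x .ρ).mul ((((((q .r .s).mul (x .w)).mul Hr).add
      (((x .r).mul (q .w .s)).mul Hr)).add (((x .r).mul (x .w)).mul Hrs)).sub rE |>.sub
      ((x .Hz).mul ru)))).congr_deriv ?_
    simp [linResidual]; field_simp; ring
  case Eθ =>
    refine ((hs.mul (x .Eθ)).add (((x .r).mul (x .ρ)).mul (q .Hz .s))).congr_deriv ?_
    simp [linResidual]; ring
  case Ez =>
    refine ((hs.mul (x .Ez)).sub ((x .ρ).mul rH)).congr_deriv ?_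
    simp [linResidual]; ring

end

/-! ### Parametrisation of the solution manifold by the free derivatives -/

noncomputable section

/-- The independent component `ξ^i` of a vector field. -/
def ξ (X : Pt → Pt) (i : Indep) : Pt → ℝ := fun x => (X x).1 i

/-- The dependent component `η^k` of a vector field. -/
def η (X : Pt → Pt) (k : Dep) : Pt → ℝ := fun x => (X x).2 k

/-- The derivatives that remain free on the solution manifold of the system. -/
structure FreeJet where
  -- With zero as default, `{}` is the origin of the space of free derivatives and `{ us := 1 }` a
  -- unit vector, so coefficients of polynomials are differences of values at such records.
  rs : ℝ := 0
  θs : ℝ := 0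
  zs : ℝ := 0
  us : ℝ := 0
  vs : ℝ := 0
  ws : ℝ := 0
  ρs : ℝ := 0
  ps : ℝ := 0
  Eθs : ℝ := 0
  Ezs : ℝ := 0
  Eθt : ℝ := 0
  Ezt : ℝ := 0

/-- The jet over `x` that satisfies the system and has the given free derivatives. -/
def FreeJet.toJet (A γ : ℝ) (σ : ℝ → ℝ → ℝ) (x : Pt) (y : FreeJet) : Jet :=
  let r := x.2 .r
  let u := x.2 .u
  let v := x.2 .v
  let ρ := x.2 .ρ
  let p := x.2 .p
  let Eθ := x.2 .Eθ
  let Ez := x.2 .Ez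
  let Hθ := x.2 .Hθ
  let Hz := x.2 .Hz
  let S := σ ρ p
  (x, fun
    | .r => fun | .t => u | .s => y.rs
    | .θ => fun | .t => v / r | .s => y.θs
    | .z => fun | .t => x.2 .w | .s => y.zs
    -- The `s`-derivatives of the magnetic field are eliminated by Ohm's law; its contribution to
    -- the momentum equations becomes an algebraic force `σE × H`, free of derivatives.
    | .u => fun | .t => v ^ 2 / r - r * y.ps - S / ρ * (Hθ * Ez - Hz * Eθ) | .s => y.us
    | .v => fun | .t => -(u * v / r) + A * S * Ez / (r * ρ) | .s => y.vs
    | .w => fun | .t => -(A * S * Eθ / (r * ρ)) | .s => y.ws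
    | .ρ => fun | .t => -(ρ ^ 2 * (y.rs * u + r * y.us)) | .s => y.ρs
    | .p => fun
        | .t => -(γ * ρ * p * (y.rs * u + r * y.us)) + (γ - 1) * S * (Eθ ^ 2 + Ez ^ 2)
        | .s => y.ps
    | .Eθ => fun | .t => y.Eθt | .s => y.Eθs
    | .Ez => fun | .t => y.Ezt | .s => y.Ezs
    | .Hθ => fun
        | .t => ρ * (A * y.vs - A * v / r * y.rs + r * (y.Ezs - Hθ * y.us))
        | .s => (S * Ez / ρ - y.rs * Hθ) / r
    | .Hz => fun
        | .t => ρ * (A * y.ws - (y.rs * Eθ + r * y.Eθs) - Hz * (y.rs * u + r * y.us))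
        | .s => -(S * Eθ / (r * ρ)))

lemma FreeJet.residual_toJet (A γ : ℝ) (σ : ℝ → ℝ → ℝ) {x : Pt} (hx : x ∈ domain) (y : FreeJet)
    (k : Dep) : residual A γ σ k (y.toJet A γ σ x) = 0 := by
  have hr : x.2 .r ≠ 0 := hx.1.ne'
  have hρ : x.2 .ρ ≠ 0 := hx.2.1.ne'
  cases k <;> simp only [residual, FreeJet.toJet] <;> field_simp <;> ring

/-- The total `t`-derivative on the solution manifold. -/
def Dt (A γ : ℝ) (σ : ℝ → ℝ → ℝ) (f : Pt → ℝ) (x : Pt) (y : FreeJet) : ℝ :=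
  totalDeriv .t f (y.toJet A γ σ x)

/-- The total `s`-derivative on the solution manifold. -/
def Ds (A γ : ℝ) (σ : ℝ → ℝ → ℝ) (f : Pt → ℝ) (x : Pt) (y : FreeJet) : ℝ :=
  totalDeriv .s f (y.toJet A γ σ x)

lemma Dt_eq (A γ : ℝ) (σ : ℝ → ℝ → ℝ) (f : Pt → ℝ) (x : Pt) (y : FreeJet) :
    Dt A γ σ f x y = pd (.inl .t) f x
      + (x.2 .u * pd (.inr .r) f x + (x.2 .v / x.2 .r * pd (.inr .θ) f x
      + (x.2 .w * pd (.inr .z) f x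
      + ((x.2 .v ^ 2 / x.2 .r - x.2 .r * y.ps
          - σ (x.2 .ρ) (x.2 .p) / x.2 .ρ * (x.2 .Hθ * x.2 .Ez - x.2 .Hz * x.2 .Eθ))
            * pd (.inr .u) f x
      + ((-(x.2 .u * x.2 .v / x.2 .r)
          + A * σ (x.2 .ρ) (x.2 .p) * x.2 .Ez / (x.2 .r * x.2 .ρ)) * pd (.inr .v) f x
      + (-(A * σ (x.2 .ρ) (x.2 .p) * x.2 .Eθ / (x.2 .r * x.2 .ρ)) * pd (.inr .w) f x
      + (-(x.2 .ρ ^ 2 * (y.rs * x.2 .u + x.2 .r * y.us)) * pd (.inr .ρ) f x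
      + ((-(γ * x.2 .ρ * x.2 .p * (y.rs * x.2 .u + x.2 .r * y.us))
          + (γ - 1) * σ (x.2 .ρ) (x.2 .p) * (x.2 .Eθ ^ 2 + x.2 .Ez ^ 2)) * pd (.inr .p) f x
      + (y.Eθt * pd (.inr .Eθ) f x + (y.Ezt * pd (.inr .Ez) f x
      + (x.2 .ρ * (A * y.vs - A * x.2 .v / x.2 .r * y.rs
          + x.2 .r * (y.Ezs - x.2 .Hθ * y.us)) * pd (.inr .Hθ) f x
      + x.2 .ρ * (A * y.ws - (y.rs * x.2 .Eθ + x.2 .r * y.Eθs)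
          - x.2 .Hz * (y.rs * x.2 .u + x.2 .r * y.us)) * pd (.inr .Hz) f x))))))))))) := by
  rw [Dt, totalDeriv_eq, sum_dep]
  rfl

lemma Ds_eq (A γ : ℝ) (σ : ℝ → ℝ → ℝ) (f : Pt → ℝ) (x : Pt) (y : FreeJet) :
    Ds A γ σ f x y = pd (.inl .s) f x
      + (y.rs * pd (.inr .r) f x + (y.θs * pd (.inr .θ) f x + (y.zs * pd (.inr .z) f x
      + (y.us * pd (.inr .u) f x + (y.vs * pd (.inr .v) f x + (y.ws * pd (.inr .w) f x
      + (y.ρs * pd (.inr .ρ) f x + (y.ps * pd (.inr .p) f x + (y.Eθs * pd (.inr .Eθ) f x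
      + (y.Ezs * pd (.inr .Ez) f x
      + ((σ (x.2 .ρ) (x.2 .p) * x.2 .Ez / x.2 .ρ - y.rs * x.2 .Hθ) / x.2 .r * pd (.inr .Hθ) f x
      + -(σ (x.2 .ρ) (x.2 .p) * x.2 .Eθ / (x.2 .r * x.2 .ρ))
          * pd (.inr .Hz) f x))))))))))) := by
  rw [Ds, totalDeriv_eq, sum_dep]
  rfl

lemma prolong_snd (X : Pt → Pt) (J : Jet) (k : Dep) (j : Indep) :
    (prolong X J).2 k j = totalDeriv j (η X k) J
      - (J.2 k .t * totalDeriv j (ξ X .t) J + J.2 k .s * totalDeriv j (ξ X .s) J) := by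
  simp only [prolong, sum_indep]
  rfl

/-- The first prolongation of `X` on the solution manifold. -/
def prolongSol (A γ : ℝ) (σ : ℝ → ℝ → ℝ) (X : Pt → Pt) (x : Pt) (y : FreeJet) : Jet :=
  (((X x).1, fun k => η X k x), fun k => fun
    | .t => Dt A γ σ (η X k) x y - ((y.toJet A γ σ x).2 k .t * Dt A γ σ (ξ X .t) x y
        + (y.toJet A γ σ x).2 k .s * Dt A γ σ (ξ X .s) x y)
    | .s => Ds A γ σ (η X k) x y - ((y.toJet A γ σ x).2 k .t * Ds A γ σ (ξ X .t) x y
        + (y.toJet A γ σ x).2 k .s * Ds A γ σ (ξ X .s) x y))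

lemma prolong_toJet (A γ : ℝ) (σ : ℝ → ℝ → ℝ) (X : Pt → Pt) (x : Pt) (y : FreeJet) :
    prolong X (y.toJet A γ σ x) = prolongSol A γ σ X x y := by
  refine Prod.ext rfl (funext fun k => funext fun j => ?_)
  rw [prolong_snd]
  cases j <;> rfl

end

/-! ### Determining equations, and the dependence of `ξ^t`, `ξ^s` -/

noncomputable section

/-- The point `x` with the dependent variable `k` replaced by `c`. -/
def upd (x : Pt) (k : Dep) (c : ℝ) : Pt := (x.1, Function.update x.2 k c)

lemma upd_mem {x : Pt} (hx : x ∈ domain) (k : Dep) {c : ℝ} (hc : 0 < c) : upd x k c ∈ domain := by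
  obtain ⟨h1, h2, h3⟩ := hx
  refine ⟨?_, ?_, ?_⟩ <;> simp only [upd, Function.update_apply] <;> split <;> assumption

lemma upd_mem' {x : Pt} (hx : x ∈ domain) {k : Dep} (hr : k ≠ .r) (hρ : k ≠ .ρ) (hp : k ≠ .p)
    (c : ℝ) : upd x k c ∈ domain := by
  obtain ⟨h1, h2, h3⟩ := hx
  refine ⟨?_, ?_, ?_⟩ <;> simp [upd, *, Ne.symm]

/-- Used to split a determining equation in the variable `k`: coefficients that do not depend on `k`
keep their values while `k` is varied explicitly. -/
lemma apply_upd {f : Pt → ℝ} (hf : ContDiffOn ℝ ∞ f domain) {k : Dep}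
    (h : ∀ x ∈ domain, pd (.inr k) f x = 0) {x : Pt} (hx : x ∈ domain) {c : ℝ}
    (hc : upd x k c ∈ domain) : f (upd x k c) = f x := by
  refine eq_of_pd_eq_zero hf hc hx fun a ha => ?_
  rcases a with i | l
  · exact absurd rfl ha
  · by_cases hl : l = k
    · rwa [hl]
    · exact absurd (by simp [coord, upd, hl]) ha

lemma pd_upd {f : Pt → ℝ} (hf : ContDiffOn ℝ ∞ f domain) {k : Dep}
    (h : ∀ x ∈ domain, pd (.inr k) f x = 0) (a : Var) {x : Pt} (hx : x ∈ domain) {c : ℝ}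
    (hc : upd x k c ∈ domain) : pd a f (upd x k c) = pd a f x :=
  apply_upd (contDiffOn_pd hf a) (pd_pd_eq_zero hf h a) hx hc

/-- The vector field `X` is a symmetry of the system, with the parameters in the physical range. -/
structure IsSymmetry (A γ : ℝ) (σ : ℝ → ℝ → ℝ) (X : Pt → Pt) : Prop where
  A_ne_zero : A ≠ 0
  one_lt_γ : 1 < γ
  conductivity : IsConductivity σ
  contDiffOn : ContDiffOn ℝ ∞ X domain
  admitted : IsAdmitted A γ σ X

namespace IsSymmetry

variable {A γ : ℝ} {σ : ℝ → ℝ → ℝ} {X : Pt → Pt} (h : IsSymmetry A γ σ X)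
include h

lemma contDiffOn_ξ (i : Indep) : ContDiffOn ℝ ∞ (ξ X i) domain := by
  have := h.contDiffOn
  unfold ξ
  fun_prop

lemma contDiffOn_η (k : Dep) : ContDiffOn ℝ ∞ (η X k) domain := by
  have := h.contDiffOn
  unfold η
  fun_prop

/-- The determining equations of the admitted algebra. -/
lemma eqn {x : Pt} (hx : x ∈ domain) (y : FreeJet) (k : Dep) :
    linResidual A γ σ k (y.toJet A γ σ x) (prolongSol A γ σ X x y) = 0 := by
  rw [← prolong_toJet, ← fderiv_residual h.conductivity k hx]
  exact h.admitted _ hx (y.residual_toJet A γ σ hx) k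

/-- The derivative `θ_s` is absent from the system; in the linearised equation for `θ` it occurs
only in the term `-θ_s D_t ξ^s` of the prolongation. -/
lemma Dt_ξs {x : Pt} (hx : x ∈ domain) (y : FreeJet) : Dt A γ σ (ξ X .s) x y = 0 := by
  have h0 := h.eqn hx y .θ
  have h1 := h.eqn hx { y with θs := y.θs + 1 } .θ
  simp only [linResidual, prolongSol, FreeJet.toJet, Dt_eq] at h0 h1 ⊢
  linear_combination h0 - h1

lemma ne_zero {x : Pt} (hx : x ∈ domain) :
    x.2 .r ≠ 0 ∧ x.2 .ρ ≠ 0 ∧ x.2 .p ≠ 0 ∧ σ (x.2 .ρ) (x.2 .p) ≠ 0 :=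
  ⟨hx.1.ne', hx.2.1.ne', hx.2.2.ne', h.conductivity.2 _ _ hx.2.1 hx.2.2⟩

/-- Consequences of an expression `D_t f` not depending on the free derivatives. -/
lemma pd_of_Dt_const {f : Pt → ℝ} {x : Pt} (hx : x ∈ domain)
    (hf : ∀ y, Dt A γ σ f x y = Dt A γ σ f x {}) :
    pd (.inr .u) f x = 0 ∧ pd (.inr .Eθ) f x = 0 ∧ pd (.inr .Ez) f x = 0 ∧
      pd (.inr .Hθ) f x = 0 ∧ pd (.inr .Hz) f x = 0 ∧
      x.2 .ρ * pd (.inr .ρ) f x + γ * x.2 .p * pd (.inr .p) f x = 0 := by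
  obtain ⟨hr, hρ, hp, hs⟩ := h.ne_zero hx
  have h1 := hf { ps := 1 }
  have h2 := hf { Eθt := 1 }
  have h3 := hf { Ezt := 1 }
  have h4 := hf { Ezs := 1 }
  have h5 := hf { Eθs := 1 }
  have h6 := hf { us := 1 }
  simp only [Dt_eq] at h1 h2 h3 h4 h5 h6
  have e1 : pd (.inr .u) f x = 0 :=
    mul_left_cancel₀ hr (by linear_combination -h1)
  have e4 : pd (.inr .Hθ) f x = 0 :=
    mul_left_cancel₀ (mul_ne_zero hρ hr) (by linear_combination h4)
  have e5 : pd (.inr .Hz) f x = 0 :=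
    mul_left_cancel₀ (mul_ne_zero hρ hr) (by linear_combination -h5)
  refine ⟨e1, by linear_combination h2, by linear_combination h3, e4, e5, ?_⟩
  rw [e4, e5] at h6
  exact mul_left_cancel₀ (mul_ne_zero hρ hr) (by linear_combination -h6)

/-- In the equation for `w` the only products of free derivatives come from `H^z_t D_s ξ^t`, where
`H^z_t` contains `A ρ w_s`. The second differences involving `w_s` isolate `A² ρ` times the
derivatives of `ξ^t`. The last relation retains `H^θ` because `H^θ_s` contains `r_s` on the solution
manifold. -/
lemma pd_ξt_aux {x : Pt} (hx : x ∈ domain) :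
    pd (.inr .θ) (ξ X .t) x = 0 ∧ pd (.inr .z) (ξ X .t) x = 0 ∧ pd (.inr .u) (ξ X .t) x = 0 ∧
    pd (.inr .v) (ξ X .t) x = 0 ∧ pd (.inr .w) (ξ X .t) x = 0 ∧ pd (.inr .ρ) (ξ X .t) x = 0 ∧
    pd (.inr .p) (ξ X .t) x = 0 ∧ pd (.inr .Eθ) (ξ X .t) x = 0 ∧ pd (.inr .Ez) (ξ X .t) x = 0 ∧
    pd (.inr .r) (ξ X .t) x = x.2 .Hθ / x.2 .r * pd (.inr .Hθ) (ξ X .t) x := by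
  obtain ⟨hr, hρ, hp, hs⟩ := h.ne_zero hx
  have hA := h.A_ne_zero
  have hc : A ^ 2 * x.2 .ρ ≠ 0 := mul_ne_zero (pow_ne_zero 2 hA) hρ
  have e0 := h.eqn hx {} .w
  have w1 := h.eqn hx { ws := 1 } .w
  have w2 := h.eqn hx { ws := -1 } .w
  have θ1 := h.eqn hx { θs := 1 } .w
  have θ2 := h.eqn hx { θs := 1, ws := 1 } .w
  have z1 := h.eqn hx { zs := 1 } .w
  have z2 := h.eqn hx { zs := 1, ws := 1 } .w
  have u1 := h.eqn hx { us := 1 } .w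
  have u2 := h.eqn hx { us := 1, ws := 1 } .w
  have v1 := h.eqn hx { vs := 1 } .w
  have v2 := h.eqn hx { vs := 1, ws := 1 } .w
  have ρ1 := h.eqn hx { ρs := 1 } .w
  have ρ2 := h.eqn hx { ρs := 1, ws := 1 } .w
  have p1 := h.eqn hx { ps := 1 } .w
  have p2 := h.eqn hx { ps := 1, ws := 1 } .w
  have a1 := h.eqn hx { Eθs := 1 } .w
  have a2 := h.eqn hx { Eθs := 1, ws := 1 } .w
  have b1 := h.eqn hx { Ezs := 1 } .w
  have b2 := h.eqn hx { Ezs := 1, ws := 1 } .w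
  have r1 := h.eqn hx { rs := 1 } .w
  have r2 := h.eqn hx { rs := 1, ws := 1 } .w
  simp only [linResidual, prolongSol, FreeJet.toJet, h.Dt_ξs hx, Ds_eq, Dt_eq, mul_zero, add_zero, zero_mul,
    zero_add, one_mul] at e0 w1 w2 θ1 θ2 z1 z2 u1 u2 v1 v2 ρ1 ρ2 p1 p2 a1 a2 b1 b2 r1 r2
  have ew : pd (.inr .w) (ξ X .t) x = 0 :=
    mul_left_cancel₀ hc (by linear_combination (w1 + w2 - 2 * e0) / 2)
  refine ⟨mul_left_cancel₀ hc ?_, mul_left_cancel₀ hc ?_, mul_left_cancel₀ hc ?_,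
    mul_left_cancel₀ hc ?_, ew, mul_left_cancel₀ hc ?_, mul_left_cancel₀ hc ?_,
    mul_left_cancel₀ hc ?_, mul_left_cancel₀ hc ?_, mul_left_cancel₀ hc ?_⟩
  · linear_combination θ2 - θ1 - w1 + e0
  · linear_combination z2 - z1 - w1 + e0
  · linear_combination u2 - u1 - w1 + e0 + A * x.2 .ρ * x.2 .Hz * x.2 .r * ew
  · linear_combination v2 - v1 - w1 + e0
  · linear_combination ρ2 - ρ1 - w1 + e0
  · linear_combination p2 - p1 - w1 + e0
  · linear_combination a2 - a1 - w1 + e0 + A * x.2 .ρ * x.2 .r * ew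
  · linear_combination b2 - b1 - w1 + e0
  · linear_combination r2 - r1 - w1 + e0 + A * x.2 .ρ * (x.2 .Eθ + x.2 .Hz * x.2 .u) * ew

lemma pd_ξs_aux {x : Pt} (hx : x ∈ domain) :
    pd (.inr .u) (ξ X .s) x = 0 ∧ pd (.inr .Eθ) (ξ X .s) x = 0 ∧ pd (.inr .Ez) (ξ X .s) x = 0 ∧
      pd (.inr .Hθ) (ξ X .s) x = 0 ∧ pd (.inr .Hz) (ξ X .s) x = 0 := by
  obtain ⟨h1, h2, h3, h4, h5, -⟩ := h.pd_of_Dt_const hx (f := ξ X .s) fun y => by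
    rw [h.Dt_ξs hx, h.Dt_ξs hx]
  exact ⟨h1, h2, h3, h4, h5⟩

/-- The products `u_s E^z_s` and `u_s E^θ_s` in the mass equation arise from `ρ_t D_t ξ^t`, since
`H^θ_t` contains `E^z_s` and `H^z_t` contains `E^θ_s`. -/
lemma pd_ξt_H {x : Pt} (hx : x ∈ domain) :
    pd (.inr .Hθ) (ξ X .t) x = 0 ∧ pd (.inr .Hz) (ξ X .t) x = 0 := by
  obtain ⟨hr, hρ, hp, hs⟩ := h.ne_zero hx
  obtain ⟨xu, xa, xb, xc, xd⟩ := h.pd_ξs_aux hx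
  obtain ⟨tθ, tz, tu, tv, tw, tρ, tp, ta, tb, tr⟩ := h.pd_ξt_aux hx
  have hc : x.2 .ρ ^ 3 * x.2 .r ^ 2 ≠ 0 := by positivity
  have e0 := h.eqn hx {} .ρ
  have u1 := h.eqn hx { us := 1 } .ρ
  have a1 := h.eqn hx { Eθs := 1 } .ρ
  have a2 := h.eqn hx { Eθs := 1, us := 1 } .ρ
  have b1 := h.eqn hx { Ezs := 1 } .ρ
  have b2 := h.eqn hx { Ezs := 1, us := 1 } .ρ
  simp only [linResidual, prolongSol, FreeJet.toJet, h.Dt_ξs hx, Ds_eq, Dt_eq, mul_zero, add_zero, zero_mul,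
    zero_add, one_mul, xu, xa, xb, xc, xd, tθ, tz, tu, tv, tw, tρ, tp, ta, tb]
    at e0 u1 a1 a2 b1 b2
  exact ⟨mul_left_cancel₀ hc (by linear_combination b2 - b1 - u1 + e0),
    mul_left_cancel₀ hc (by linear_combination -(a2 - a1 - u1 + e0))⟩

lemma pd_dep_ξt (k : Dep) {x : Pt} (hx : x ∈ domain) : pd (.inr k) (ξ X .t) x = 0 := by
  obtain ⟨tθ, tz, tu, tv, tw, tρ, tp, ta, tb, tr⟩ := h.pd_ξt_aux hx
  obtain ⟨tc, td⟩ := h.pd_ξt_H hx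
  rw [tc, mul_zero] at tr
  cases k <;> assumption

lemma Dt_ξt {x : Pt} (hx : x ∈ domain) (y : FreeJet) :
    Dt A γ σ (ξ X .t) x y = pd (.inl .t) (ξ X .t) x := by
  simp only [Dt_eq, h.pd_dep_ξt _ hx, mul_zero, add_zero]

lemma Ds_ξt {x : Pt} (hx : x ∈ domain) (y : FreeJet) :
    Ds A γ σ (ξ X .t) x y = pd (.inl .s) (ξ X .t) x := by
  simp only [Ds_eq, h.pd_dep_ξt _ hx, mul_zero, add_zero]

/-- With `D_t ξ^t` and `D_s ξ^t` now free of the free derivatives, the term `-ρ² r u_s D_s ξ^s` is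
the only source of products with `u_s` in the mass equation. -/
lemma pd_dep_ξs (k : Dep) {x : Pt} (hx : x ∈ domain) : pd (.inr k) (ξ X .s) x = 0 := by
  obtain ⟨hr, hρ, hp, hs⟩ := h.ne_zero hx
  obtain ⟨xu, xa, xb, xc, xd⟩ := h.pd_ξs_aux hx
  have hc : x.2 .ρ ^ 2 * x.2 .r ≠ 0 := by positivity
  have e0 := h.eqn hx {} .ρ
  have u1 := h.eqn hx { us := 1 } .ρ
  have θ1 := h.eqn hx { θs := 1 } .ρ
  have θ2 := h.eqn hx { θs := 1, us := 1 } .ρ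
  have z1 := h.eqn hx { zs := 1 } .ρ
  have z2 := h.eqn hx { zs := 1, us := 1 } .ρ
  have v1 := h.eqn hx { vs := 1 } .ρ
  have v2 := h.eqn hx { vs := 1, us := 1 } .ρ
  have w1 := h.eqn hx { ws := 1 } .ρ
  have w2 := h.eqn hx { ws := 1, us := 1 } .ρ
  have ρ1 := h.eqn hx { ρs := 1 } .ρ
  have ρ2 := h.eqn hx { ρs := 1, us := 1 } .ρ
  have p1 := h.eqn hx { ps := 1 } .ρ
  have p2 := h.eqn hx { ps := 1, us := 1 } .ρ
  have r1 := h.eqn hx { rs := 1 } .ρ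
  have r2 := h.eqn hx { rs := 1, us := 1 } .ρ
  simp only [linResidual, prolongSol, FreeJet.toJet, h.Dt_ξs hx, h.Dt_ξt hx, h.Ds_ξt hx, Ds_eq, Dt_eq,
    mul_zero, add_zero, zero_mul, zero_add, one_mul, xu, xa, xb, xc, xd]
    at e0 u1 θ1 θ2 z1 z2 v1 v2 w1 w2 ρ1 ρ2 p1 p2 r1 r2
  cases k
  case u => exact xu
  case Eθ => exact xa
  case Ez => exact xb
  case Hθ => exact xc
  case Hz => exact xd
  all_goals refine mul_left_cancel₀ hc ?_
  case θ => linear_combination -(θ2 - θ1 - u1 + e0)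
  case z => linear_combination -(z2 - z1 - u1 + e0)
  case v => linear_combination -(v2 - v1 - u1 + e0)
  case w => linear_combination -(w2 - w1 - u1 + e0)
  case ρ => linear_combination -(ρ2 - ρ1 - u1 + e0)
  case p => linear_combination -(p2 - p1 - u1 + e0)
  case r => linear_combination -(r2 - r1 - u1 + e0)

lemma pd_t_ξs {x : Pt} (hx : x ∈ domain) : pd (.inl .t) (ξ X .s) x = 0 := by
  have := h.Dt_ξs hx {}
  simpa only [Dt_eq, h.pd_dep_ξs _ hx, mul_zero, add_zero] using this

lemma Ds_ξs {x : Pt} (hx : x ∈ domain) (y : FreeJet) :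
    Ds A γ σ (ξ X .s) x y = pd (.inl .s) (ξ X .s) x := by
  simp only [Ds_eq, h.pd_dep_ξs _ hx, mul_zero, add_zero]

lemma pd_ηHz_aux {x : Pt} (hx : x ∈ domain) :
    pd (.inr .ρ) (η X .Hz) x = 0 ∧
      pd (.inr .Eθ) (η X .Hz) x = -(x.2 .r * x.2 .ρ * pd (.inl .s) (ξ X .t) x) := by
  obtain ⟨hr, hρ, hp, hs⟩ := h.ne_zero hx
  have hc : x.2 .r * x.2 .ρ ≠ 0 := mul_ne_zero hr hρ
  have e0 := h.eqn hx {} .Eθ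
  have ρ1 := h.eqn hx { ρs := 1 } .Eθ
  have a1 := h.eqn hx { Eθs := 1 } .Eθ
  simp only [linResidual, prolongSol, FreeJet.toJet, h.Ds_ξt hx, h.Ds_ξs hx, Ds_eq] at e0 ρ1 a1
  exact ⟨mul_left_cancel₀ hc (by linear_combination ρ1 - e0),
    mul_left_cancel₀ hc (by linear_combination a1 - e0)⟩

/-- In `η^{H^z}_{E^θ} = -r ρ ξ^t_s` neither `η^{H^z}` nor `ξ^t` depends on `ρ`; comparing the values
at `ρ` and `2ρ` leaves only zero. -/
lemma pd_s_ξt {x : Pt} (hx : x ∈ domain) : pd (.inl .s) (ξ X .t) x = 0 := by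
  have hx' := upd_mem hx .ρ (c := 2 * x.2 .ρ) (mul_pos two_pos hx.2.1)
  have e1 := (h.pd_ηHz_aux hx).2
  have e2 := (h.pd_ηHz_aux hx').2
  rw [pd_upd (h.contDiffOn_η _) (fun x hx => (h.pd_ηHz_aux hx).1) _ hx hx',
    pd_upd (h.contDiffOn_ξ _) (fun x hx => h.pd_dep_ξt .ρ hx) _ hx hx', e1] at e2
  simp only [upd, Function.update_self, Function.update_of_ne (show Dep.r ≠ .ρ by decide)] at e2
  exact mul_left_cancel₀ (mul_ne_zero hx.1.ne' hx.2.1.ne') (by linear_combination e2)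

lemma prolongSol_eq {x : Pt} (hx : x ∈ domain) (y : FreeJet) :
    prolongSol A γ σ X x y = (((X x).1, fun k => η X k x), fun k => fun
      | .t => Dt A γ σ (η X k) x y - (y.toJet A γ σ x).2 k .t * pd (.inl .t) (ξ X .t) x
      | .s => Ds A γ σ (η X k) x y - (y.toJet A γ σ x).2 k .s * pd (.inl .s) (ξ X .s) x) := by
  simp only [prolongSol, h.Dt_ξs hx, h.Dt_ξt hx, h.Ds_ξt hx, h.pd_s_ξt hx, h.Ds_ξs hx, mul_zero,
    add_zero, zero_add]

end IsSymmetry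

end

/-! ### Kinematic equations: the dependence of `η^r`, `η^θ`, `η^z` -/

noncomputable section

namespace IsSymmetry

variable {A γ : ℝ} {σ : ℝ → ℝ → ℝ} {X : Pt → Pt} (h : IsSymmetry A γ σ X)
include h

lemma Dt_ηr {x : Pt} (hx : x ∈ domain) (y : FreeJet) :
    Dt A γ σ (η X .r) x y = x.2 .u * pd (.inl .t) (ξ X .t) x + η X .u x := by
  have h0 := h.eqn hx y .r
  simp only [linResidual, h.prolongSol_eq hx, FreeJet.toJet] at h0
  linear_combination h0

lemma Dt_ηθ {x : Pt} (hx : x ∈ domain) (y : FreeJet) :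
    Dt A γ σ (η X .θ) x y = x.2 .v / x.2 .r * pd (.inl .t) (ξ X .t) x + η X .v x / x.2 .r
      - x.2 .v * η X .r x / x.2 .r ^ 2 := by
  have h0 := h.eqn hx y .θ
  simp only [linResidual, h.prolongSol_eq hx, FreeJet.toJet] at h0
  linear_combination h0

lemma Dt_ηz {x : Pt} (hx : x ∈ domain) (y : FreeJet) :
    Dt A γ σ (η X .z) x y = x.2 .w * pd (.inl .t) (ξ X .t) x + η X .w x := by
  have h0 := h.eqn hx y .z
  simp only [linResidual, h.prolongSol_eq hx, FreeJet.toJet] at h0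
  linear_combination h0

/-- Free derivatives enter Ohm's law for `E^θ` only through `D_s η^{H^z}`. The relation for `r` says
that `r` and `H^θ` can occur only through the product `r H^θ`. -/
lemma pd_ηHz {x : Pt} (hx : x ∈ domain) :
    pd (.inr .θ) (η X .Hz) x = 0 ∧ pd (.inr .z) (η X .Hz) x = 0 ∧
    pd (.inr .u) (η X .Hz) x = 0 ∧ pd (.inr .v) (η X .Hz) x = 0 ∧
    pd (.inr .w) (η X .Hz) x = 0 ∧ pd (.inr .ρ) (η X .Hz) x = 0 ∧
    pd (.inr .p) (η X .Hz) x = 0 ∧ pd (.inr .Eθ) (η X .Hz) x = 0 ∧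
    pd (.inr .Ez) (η X .Hz) x = 0 ∧
    pd (.inr .r) (η X .Hz) x = x.2 .Hθ / x.2 .r * pd (.inr .Hθ) (η X .Hz) x := by
  obtain ⟨hr, hρ, hp, hs⟩ := h.ne_zero hx
  have hc : x.2 .r * x.2 .ρ ≠ 0 := mul_ne_zero hr hρ
  have e0 := h.eqn hx {} .Eθ
  have θ1 := h.eqn hx { θs := 1 } .Eθ
  have z1 := h.eqn hx { zs := 1 } .Eθ
  have u1 := h.eqn hx { us := 1 } .Eθ
  have v1 := h.eqn hx { vs := 1 } .Eθ
  have w1 := h.eqn hx { ws := 1 } .Eθ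
  have ρ1 := h.eqn hx { ρs := 1 } .Eθ
  have p1 := h.eqn hx { ps := 1 } .Eθ
  have a1 := h.eqn hx { Eθs := 1 } .Eθ
  have b1 := h.eqn hx { Ezs := 1 } .Eθ
  have r1 := h.eqn hx { rs := 1 } .Eθ
  simp only [linResidual, h.prolongSol_eq hx, FreeJet.toJet, Ds_eq, zero_mul, one_mul,
    zero_add] at e0 θ1 z1 u1 v1 w1 ρ1 p1 a1 b1 r1
  refine ⟨?_, ?_, ?_, ?_, ?_, ?_, ?_, ?_, ?_, ?_⟩ <;> refine mul_left_cancel₀ hc ?_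
  · linear_combination θ1 - e0
  · linear_combination z1 - e0
  · linear_combination u1 - e0
  · linear_combination v1 - e0
  · linear_combination w1 - e0
  · linear_combination ρ1 - e0
  · linear_combination p1 - e0
  · linear_combination a1 - e0
  · linear_combination b1 - e0
  · linear_combination r1 - e0

lemma Ds_ηHz {x : Pt} (hx : x ∈ domain) (y : FreeJet) :
    Ds A γ σ (η X .Hz) x y = pd (.inl .s) (η X .Hz) x
      + σ (x.2 .ρ) (x.2 .p) / (x.2 .r * x.2 .ρ)
        * (x.2 .Ez * pd (.inr .Hθ) (η X .Hz) x - x.2 .Eθ * pd (.inr .Hz) (η X .Hz) x) := by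
  obtain ⟨hr, hρ, hp, hs⟩ := h.ne_zero hx
  obtain ⟨e1, e2, e3, e4, e5, e6, e7, e8, e9, e10⟩ := h.pd_ηHz hx
  simp only [Ds_eq, e1, e2, e3, e4, e5, e6, e7, e8, e9, e10]
  field_simp
  ring

lemma Dt_ηw {x : Pt} (hx : x ∈ domain) (y : FreeJet) :
    Dt A γ σ (η X .w) x y
      = A * pd (.inl .s) (η X .Hz) x + A * σ (x.2 .ρ) (x.2 .p) / (x.2 .r * x.2 .ρ)
        * (x.2 .Ez * pd (.inr .Hθ) (η X .Hz) x - x.2 .Eθ * pd (.inr .Hz) (η X .Hz) x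
          + x.2 .Eθ * (pd (.inl .s) (ξ X .s) x - pd (.inl .t) (ξ X .t) x)) := by
  have h0 := h.eqn hx y .w
  simp only [linResidual, h.prolongSol_eq hx, FreeJet.toJet, h.Ds_ηHz hx] at h0
  linear_combination h0

lemma rHθ_s {x : Pt} (hx : x ∈ domain) (a : ℝ) :
    a * x.2 .Hθ + x.2 .r * ((σ (x.2 .ρ) (x.2 .p) * x.2 .Ez / x.2 .ρ - a * x.2 .Hθ) / x.2 .r)
      = σ (x.2 .ρ) (x.2 .p) * x.2 .Ez / x.2 .ρ := by
  obtain ⟨hr, hρ, hp, hs⟩ := h.ne_zero hx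
  field_simp
  ring

/-- The azimuthal momentum equation and Ohm's law for `E^z` both contain the variation of `(r
H^θ)_s`. Eliminating it leaves no free derivative besides those in `D_t η^v`. -/
lemma Dt_ηv {x : Pt} (hx : x ∈ domain) (y : FreeJet) :
    Dt A γ σ (η X .v) x y = Dt A γ σ (η X .v) x {} := by
  obtain ⟨hr, hρ, hp, hs⟩ := h.ne_zero hx
  have e1 := h.eqn hx y .v
  have e2 := h.eqn hx y .Ez
  have f1 := h.eqn hx {} .v
  have f2 := h.eqn hx {} .Ez
  simp only [linResidual, h.prolongSol_eq hx, FreeJet.toJet, h.rHθ_s hx] at e1 e2 f1 f2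
  generalize Dt A γ σ (η X .v) x y = D1 at *
  generalize Dt A γ σ (η X .v) x {} = D0 at *
  linear_combination (norm := skip) e1 - f1 - A / (x.2 .r * x.2 .ρ) * (e2 - f2)
  field_simp
  ring

end IsSymmetry

/-- The consequences of `D_t f` not depending on the free derivatives. -/
structure IsDtConst (γ : ℝ) (f : Pt → ℝ) : Prop where
  contDiffOn : ContDiffOn ℝ ∞ f domain
  u : ∀ x ∈ domain, pd (.inr .u) f x = 0
  Eθ : ∀ x ∈ domain, pd (.inr .Eθ) f x = 0
  Ez : ∀ x ∈ domain, pd (.inr .Ez) f x = 0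
  Hθ : ∀ x ∈ domain, pd (.inr .Hθ) f x = 0
  Hz : ∀ x ∈ domain, pd (.inr .Hz) f x = 0
  -- The coefficient of `u_s`: density and pressure occur only through the entropy variable `p
  -- ρ^(-γ)`.
  ρp : ∀ x ∈ domain, x.2 .ρ * pd (.inr .ρ) f x + γ * x.2 .p * pd (.inr .p) f x = 0

lemma IsDtConst.Dt_eq {γ : ℝ} {f : Pt → ℝ} (hf : IsDtConst γ f) (A : ℝ) (σ : ℝ → ℝ → ℝ) {x : Pt}
    (hx : x ∈ domain) : Dt A γ σ f x {} = pd (.inl .t) f x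
      + x.2 .u * pd (.inr .r) f x + x.2 .v / x.2 .r * pd (.inr .θ) f x
      + x.2 .w * pd (.inr .z) f x
      + (-(x.2 .u * x.2 .v / x.2 .r)
          + A * σ (x.2 .ρ) (x.2 .p) * x.2 .Ez / (x.2 .r * x.2 .ρ)) * pd (.inr .v) f x
      - A * σ (x.2 .ρ) (x.2 .p) * x.2 .Eθ / (x.2 .r * x.2 .ρ) * pd (.inr .w) f x
      + (γ - 1) * σ (x.2 .ρ) (x.2 .p) * (x.2 .Eθ ^ 2 + x.2 .Ez ^ 2) * pd (.inr .p) f x := by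
  rw [CylMHD.Dt_eq, hf.u x hx, hf.Eθ x hx, hf.Ez x hx, hf.Hθ x hx, hf.Hz x hx]
  ring

lemma upd_apply_ne (x : Pt) {k l : Dep} (hl : l ≠ k) (c : ℝ) : (upd x k c).2 l = x.2 l := by
  simp [upd, hl]

lemma upd_apply_self (x : Pt) (k : Dep) (c : ℝ) : (upd x k c).2 k = c := by
  simp [upd]

namespace IsSymmetry

variable {A γ : ℝ} {σ : ℝ → ℝ → ℝ} {X : Pt → Pt} (h : IsSymmetry A γ σ X)
include h

lemma isDtConst {f : Pt → ℝ} (hf : ContDiffOn ℝ ∞ f domain)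
    (hD : ∀ x ∈ domain, ∀ y, Dt A γ σ f x y = Dt A γ σ f x {}) : IsDtConst γ f where
  contDiffOn := hf
  u x hx := (h.pd_of_Dt_const hx (hD x hx)).1
  Eθ x hx := (h.pd_of_Dt_const hx (hD x hx)).2.1
  Ez x hx := (h.pd_of_Dt_const hx (hD x hx)).2.2.1
  Hθ x hx := (h.pd_of_Dt_const hx (hD x hx)).2.2.2.1
  Hz x hx := (h.pd_of_Dt_const hx (hD x hx)).2.2.2.2.1
  ρp x hx := (h.pd_of_Dt_const hx (hD x hx)).2.2.2.2.2

lemma isDtConst_ηr : IsDtConst γ (η X .r) :=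
  h.isDtConst (h.contDiffOn_η _) fun x hx y => by rw [h.Dt_ηr hx, h.Dt_ηr hx]

lemma isDtConst_ηθ : IsDtConst γ (η X .θ) :=
  h.isDtConst (h.contDiffOn_η _) fun x hx y => by rw [h.Dt_ηθ hx, h.Dt_ηθ hx]

lemma isDtConst_ηz : IsDtConst γ (η X .z) :=
  h.isDtConst (h.contDiffOn_η _) fun x hx y => by rw [h.Dt_ηz hx, h.Dt_ηz hx]

lemma isDtConst_ηv : IsDtConst γ (η X .v) :=
  h.isDtConst (h.contDiffOn_η _) fun x hx y => by rw [h.Dt_ηv hx]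

lemma isDtConst_ηw : IsDtConst γ (η X .w) :=
  h.isDtConst (h.contDiffOn_η _) fun x hx y => by rw [h.Dt_ηw hx, h.Dt_ηw hx]

lemma pd_ηu_E {x : Pt} (hx : x ∈ domain) :
    pd (.inr .Eθ) (η X .u) x = 0 ∧ pd (.inr .Ez) (η X .u) x = 0 := by
  have e0 := h.eqn hx {} .u
  have e1 := h.eqn hx { Eθt := 1 } .u
  have e2 := h.eqn hx { Ezt := 1 } .u
  simp only [linResidual, h.prolongSol_eq hx, FreeJet.toJet, Dt_eq, Ds_eq] at e0 e1 e2
  exact ⟨by linear_combination e1 - e0, by linear_combination e2 - e0⟩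

/-- If moreover `D_t f` does not depend on the electric field, then `f` depends on the independent
variables and on `r`, `θ`, `z` only. -/
lemma pd_eq_zero_of_Dt {f F : Pt → ℝ} (hf : IsDtConst γ f)
    (hF : ∀ x ∈ domain, Dt A γ σ f x {} = F x)
    (h1 : ∀ x ∈ domain, ∀ c, F (upd x .Eθ c) = F x)
    (h2 : ∀ x ∈ domain, ∀ c, F (upd x .Ez c) = F x) {x : Pt} (hx : x ∈ domain) :
    pd (.inr .v) f x = 0 ∧ pd (.inr .w) f x = 0 ∧ pd (.inr .ρ) f x = 0 ∧ pd (.inr .p) f x = 0 := by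
  obtain ⟨hr, hρ, hp, hs⟩ := h.ne_zero hx
  have hA := h.A_ne_zero
  have hγ : γ - 1 ≠ 0 := sub_ne_zero.2 h.one_lt_γ.ne'
  have a : ∀ c, upd x .Eθ c ∈ domain := upd_mem' hx (by decide) (by decide) (by decide)
  have b : ∀ c, upd x .Ez c ∈ domain := upd_mem' hx (by decide) (by decide) (by decide)
  have ea : ∀ c, Dt A γ σ f (upd x .Eθ c) {} = F x := fun c => (hF _ (a c)).trans (h1 x hx c)
  have eb : ∀ c, Dt A γ σ f (upd x .Ez c) {} = F x := fun c => (hF _ (b c)).trans (h2 x hx c)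
  simp only [hf.Dt_eq A σ (a _), hf.Dt_eq A σ (b _), pd_upd hf.contDiffOn hf.Eθ _ hx (a _),
    pd_upd hf.contDiffOn hf.Ez _ hx (b _), upd_apply_self, upd_apply_ne, ne_eq, reduceCtorEq,
    not_false_eq_true] at ea eb
  -- The term of degree two in `E^θ` is Joule heating times `f_p`; the linear terms below are the
  -- forces `±A σ E / (r ρ)` times `f_v` and `f_w`.
  have hpp : pd (.inr .p) f x = 0 := mul_left_cancel₀ (mul_ne_zero hγ hs)
    (by linear_combination (ea 1 + ea (-1) - 2 * ea 0) / 2)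
  refine ⟨?_, ?_, ?_, hpp⟩
  · refine mul_left_cancel₀ (mul_ne_zero hA hs) ?_
    have := eb 1
    have h0 := eb (-1)
    field_simp at this h0
    linear_combination (this - h0) / 2
  · refine mul_left_cancel₀ (mul_ne_zero hA hs) ?_
    have := ea 1
    have h0 := ea (-1)
    field_simp at this h0
    linear_combination -(this - h0) / 2
  · have := hf.ρp x hx
    rw [hpp, mul_zero, add_zero] at this
    exact (mul_eq_zero.1 this).resolve_left hρ

lemma ξt_upd (k : Dep) {x : Pt} (hx : x ∈ domain) {c : ℝ} (hc : upd x k c ∈ domain) (a : Var) :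
    pd a (ξ X .t) (upd x k c) = pd a (ξ X .t) x :=
  pd_upd (h.contDiffOn_ξ _) (fun _ hx => h.pd_dep_ξt k hx) a hx hc

lemma pd_ηr_vwρp {x : Pt} (hx : x ∈ domain) : pd (.inr .v) (η X .r) x = 0 ∧
    pd (.inr .w) (η X .r) x = 0 ∧ pd (.inr .ρ) (η X .r) x = 0 ∧ pd (.inr .p) (η X .r) x = 0 := by
  refine h.pd_eq_zero_of_Dt h.isDtConst_ηr (fun x hx => h.Dt_ηr hx {}) ?_ ?_ hx <;>
    intro x hx c
  · have hc := upd_mem' hx (k := .Eθ) (by decide) (by decide) (by decide) c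
    rw [h.ξt_upd _ hx hc, apply_upd (h.contDiffOn_η _) (fun x hx => (h.pd_ηu_E hx).1) hx hc,
      upd_apply_ne _ (by decide)]
  · have hc := upd_mem' hx (k := .Ez) (by decide) (by decide) (by decide) c
    rw [h.ξt_upd _ hx hc, apply_upd (h.contDiffOn_η _) (fun x hx => (h.pd_ηu_E hx).2) hx hc,
      upd_apply_ne _ (by decide)]

lemma Dt_ηθ_upd (k : Dep) (hr : k ≠ .r) (hρ : k ≠ .ρ) (hp : k ≠ .p) (hv : k ≠ .v)
    (h1 : ∀ x ∈ domain, pd (.inr k) (η X .r) x = 0)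
    (h2 : ∀ x ∈ domain, pd (.inr k) (η X .v) x = 0) {x : Pt} (hx : x ∈ domain) (c : ℝ) :
    Dt A γ σ (η X .θ) (upd x k c) {} = Dt A γ σ (η X .θ) x {} := by
  have hc := upd_mem' hx hr hρ hp c
  rw [h.Dt_ηθ hx, h.Dt_ηθ hc, h.ξt_upd _ hx hc, apply_upd (h.contDiffOn_η _) h1 hx hc,
      apply_upd (h.contDiffOn_η _) h2 hx hc, upd_apply_ne _ hv.symm, upd_apply_ne _ hr.symm]

lemma Dt_ηz_upd (k : Dep) (hr : k ≠ .r) (hρ : k ≠ .ρ) (hp : k ≠ .p) (hw : k ≠ .w)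
    (h2 : ∀ x ∈ domain, pd (.inr k) (η X .w) x = 0) {x : Pt} (hx : x ∈ domain) (c : ℝ) :
    Dt A γ σ (η X .z) (upd x k c) {} = Dt A γ σ (η X .z) x {} := by
  have hc := upd_mem' hx hr hρ hp c
  rw [h.Dt_ηz hx, h.Dt_ηz hc, h.ξt_upd _ hx hc, apply_upd (h.contDiffOn_η _) h2 hx hc,
    upd_apply_ne _ hw.symm]

lemma pd_ηθ_vwρp {x : Pt} (hx : x ∈ domain) : pd (.inr .v) (η X .θ) x = 0 ∧
    pd (.inr .w) (η X .θ) x = 0 ∧ pd (.inr .ρ) (η X .θ) x = 0 ∧ pd (.inr .p) (η X .θ) x = 0 :=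
  h.pd_eq_zero_of_Dt h.isDtConst_ηθ (fun _ _ => rfl)
    (fun _ hx c => h.Dt_ηθ_upd .Eθ (by decide) (by decide) (by decide) (by decide)
      h.isDtConst_ηr.Eθ h.isDtConst_ηv.Eθ hx c)
    (fun _ hx c => h.Dt_ηθ_upd .Ez (by decide) (by decide) (by decide) (by decide)
      h.isDtConst_ηr.Ez h.isDtConst_ηv.Ez hx c) hx

lemma pd_ηz_vwρp {x : Pt} (hx : x ∈ domain) : pd (.inr .v) (η X .z) x = 0 ∧
    pd (.inr .w) (η X .z) x = 0 ∧ pd (.inr .ρ) (η X .z) x = 0 ∧ pd (.inr .p) (η X .z) x = 0 :=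
  h.pd_eq_zero_of_Dt h.isDtConst_ηz (fun _ _ => rfl)
    (fun _ hx c => h.Dt_ηz_upd .Eθ (by decide) (by decide) (by decide) (by decide)
      h.isDtConst_ηw.Eθ hx c)
    (fun _ hx c => h.Dt_ηz_upd .Ez (by decide) (by decide) (by decide) (by decide)
      h.isDtConst_ηw.Ez hx c) hx

/-- Since `η^r` and `η^v` do not depend on `u`, neither does `D_t η^θ`, in which `u` multiplies
`η^θ_r`. -/
lemma pd_ηθ_r {x : Pt} (hx : x ∈ domain) : pd (.inr .r) (η X .θ) x = 0 := by
  have hc := fun c => upd_mem' hx (k := .u) (by decide) (by decide) (by decide) c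
  have e := fun c => h.Dt_ηθ_upd .u (by decide) (by decide) (by decide) (by decide)
      h.isDtConst_ηr.u h.isDtConst_ηv.u hx c
  simp only [h.isDtConst_ηθ.Dt_eq A σ (hc _), h.isDtConst_ηθ.Dt_eq A σ hx,
    pd_upd (h.contDiffOn_η _) h.isDtConst_ηθ.u _ hx (hc _), upd_apply_self, upd_apply_ne, ne_eq,
    reduceCtorEq, not_false_eq_true, (h.pd_ηθ_vwρp hx).1] at e
  linear_combination e 1 - e 0

lemma pd_ηz_r {x : Pt} (hx : x ∈ domain) : pd (.inr .r) (η X .z) x = 0 := by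
  have hc := fun c => upd_mem' hx (k := .u) (by decide) (by decide) (by decide) c
  have e := fun c => h.Dt_ηz_upd .u (by decide) (by decide) (by decide) (by decide)
      h.isDtConst_ηw.u hx c
  simp only [h.isDtConst_ηz.Dt_eq A σ (hc _), h.isDtConst_ηz.Dt_eq A σ hx,
    pd_upd (h.contDiffOn_η _) h.isDtConst_ηz.u _ hx (hc _), upd_apply_self, upd_apply_ne, ne_eq,
    reduceCtorEq, not_false_eq_true, (h.pd_ηz_vwρp hx).1] at e
  linear_combination e 1 - e 0

lemma ηu_eq {x : Pt} (hx : x ∈ domain) : η X .u x = pd (.inl .t) (η X .r) x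
    + x.2 .u * pd (.inr .r) (η X .r) x + x.2 .v / x.2 .r * pd (.inr .θ) (η X .r) x
    + x.2 .w * pd (.inr .z) (η X .r) x - x.2 .u * pd (.inl .t) (ξ X .t) x := by
  obtain ⟨e1, e2, e3, e4⟩ := h.pd_ηr_vwρp hx
  have := h.Dt_ηr hx {}
  rw [h.isDtConst_ηr.Dt_eq A σ hx, e1, e2, e4] at this
  linear_combination -this

lemma ηv_eq {x : Pt} (hx : x ∈ domain) : η X .v x = x.2 .r * pd (.inl .t) (η X .θ) x
    + x.2 .v * pd (.inr .θ) (η X .θ) x + x.2 .r * x.2 .w * pd (.inr .z) (η X .θ) x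
    + x.2 .v / x.2 .r * η X .r x - x.2 .v * pd (.inl .t) (ξ X .t) x := by
  obtain ⟨hr, hρ, hp, hs⟩ := h.ne_zero hx
  obtain ⟨e1, e2, e3, e4⟩ := h.pd_ηθ_vwρp hx
  have := h.Dt_ηθ hx {}
  rw [h.isDtConst_ηθ.Dt_eq A σ hx, e1, e2, e4, h.pd_ηθ_r hx] at this
  simp only [mul_zero, add_zero, sub_zero] at this
  field_simp at this ⊢
  linear_combination -this

lemma ηw_eq {x : Pt} (hx : x ∈ domain) : η X .w x = pd (.inl .t) (η X .z) x
    + x.2 .v / x.2 .r * pd (.inr .θ) (η X .z) x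
    + x.2 .w * pd (.inr .z) (η X .z) x - x.2 .w * pd (.inl .t) (ξ X .t) x := by
  obtain ⟨e1, e2, e3, e4⟩ := h.pd_ηz_vwρp hx
  have := h.Dt_ηz hx {}
  rw [h.isDtConst_ηz.Dt_eq A σ hx, e1, e2, e4, h.pd_ηz_r hx] at this
  linear_combination -this

end IsSymmetry

end

/-! ### Radial momentum and pressure: `η^u`, `η^p` -/

noncomputable section

namespace IsSymmetry

variable {A γ : ℝ} {σ : ℝ → ℝ → ℝ} {X : Pt → Pt} (h : IsSymmetry A γ σ X)
include h

/-- Ohm's law for `E^z` again removes the variation of `(r H^θ)_s`, and `D_s η^{H^z}` contains no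
free derivative. What remains of the momentum equation is this relation between `η^u` and `η^p`. -/
lemma Dt_ηu_add_Ds_ηp {x : Pt} (hx : x ∈ domain) (y : FreeJet) :
    Dt A γ σ (η X .u) x y + x.2 .r * Ds A γ σ (η X .p) x y
      + (x.2 .r * (pd (.inl .t) (ξ X .t) x - pd (.inl .s) (ξ X .s) x) + η X .r x) * y.ps
      = Dt A γ σ (η X .u) x {} + x.2 .r * Ds A γ σ (η X .p) x {} := by
  obtain ⟨hr, hρ, hp, hs⟩ := h.ne_zero hx
  have e1 := h.eqn hx y .u
  have e2 := h.eqn hx y .Ez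
  have f1 := h.eqn hx {} .u
  have f2 := h.eqn hx {} .Ez
  simp only [linResidual, h.prolongSol_eq hx, FreeJet.toJet, h.rHθ_s hx, h.Ds_ηHz hx]
    at e1 e2 f1 f2
  linear_combination (norm := skip) e1 - f1 + x.2 .Hθ / x.2 .ρ * (e2 - f2)
  field_simp
  ring

/-- In the pressure equation `E_t` occurs only in `D_t η^p`, and `E_s` only through `H_t`; this
removes the field variables from `η^p`. The coefficients of `v_s` and `w_s` there then concern `η^u`
alone, and the momentum relation gives the rest. -/
lemma pd_ηp_aux {x : Pt} (hx : x ∈ domain) :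
    (pd (.inr .θ) (η X .p) x = 0 ∧ pd (.inr .z) (η X .p) x = 0 ∧
    pd (.inr .v) (η X .p) x = 0 ∧ pd (.inr .w) (η X .p) x = 0 ∧
    pd (.inr .ρ) (η X .p) x = 0 ∧ pd (.inr .Eθ) (η X .p) x = 0 ∧
    pd (.inr .Ez) (η X .p) x = 0 ∧ pd (.inr .Hθ) (η X .p) x = 0 ∧ pd (.inr .Hz) (η X .p) x = 0) ∧
    pd (.inr .v) (η X .u) x = 0 ∧ pd (.inr .w) (η X .u) x = 0 := by
  obtain ⟨hr, hρ, hp, hs⟩ := h.ne_zero hx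
  have hγ : γ ≠ 0 := (one_pos.trans h.one_lt_γ).ne'
  obtain ⟨ra, rb, rc, rd⟩ := h.pd_ηr_vwρp hx
  obtain ⟨ua, ub⟩ := h.pd_ηu_E hx
  have sr := h.isDtConst_ηr
  have e0 := h.eqn hx {} .p
  have a1 := h.eqn hx { Eθt := 1 } .p
  have a2 := h.eqn hx { Ezt := 1 } .p
  have v1 := h.eqn hx { vs := 1 } .p
  have w1 := h.eqn hx { ws := 1 } .p
  have b1 := h.eqn hx { Eθs := 1 } .p
  have b2 := h.eqn hx { Ezs := 1 } .p
  simp only [linResidual, h.prolongSol_eq hx, FreeJet.toJet, Dt_eq, Ds_eq, ra, rb, rc, rd, ua, ub,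
    sr.Eθ x hx, sr.Ez x hx, sr.Hθ x hx, sr.Hz x hx, sr.u x hx] at e0 a1 a2 v1 w1 b1 b2
  have pa : pd (.inr .Eθ) (η X .p) x = 0 := by linear_combination a1 - e0
  have pb : pd (.inr .Ez) (η X .p) x = 0 := by linear_combination a2 - e0
  have pc : pd (.inr .Hθ) (η X .p) x = 0 :=
    mul_left_cancel₀ (mul_ne_zero hρ hr) (by linear_combination b2 - e0)
  have pd' : pd (.inr .Hz) (η X .p) x = 0 :=
    mul_left_cancel₀ (mul_ne_zero hρ hr) (by linear_combination -(b1 - e0))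
  have hc : γ * x.2 .ρ * x.2 .p * x.2 .r ≠ 0 := by simp [*]
  have uv : pd (.inr .v) (η X .u) x = 0 :=
    mul_left_cancel₀ hc (by linear_combination v1 - e0 - A * x.2 .ρ * pc)
  have uw : pd (.inr .w) (η X .u) x = 0 :=
    mul_left_cancel₀ hc (by linear_combination w1 - e0 - A * x.2 .ρ * pd')
  have θ1 := h.Dt_ηu_add_Ds_ηp hx { θs := 1 }
  have z1 := h.Dt_ηu_add_Ds_ηp hx { zs := 1 }
  have ρ1 := h.Dt_ηu_add_Ds_ηp hx { ρs := 1 }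
  have v1 := h.Dt_ηu_add_Ds_ηp hx { vs := 1 }
  have w1 := h.Dt_ηu_add_Ds_ηp hx { ws := 1 }
  have b1 := h.Dt_ηu_add_Ds_ηp hx { Eθs := 1 }
  have b2 := h.Dt_ηu_add_Ds_ηp hx { Ezs := 1 }
  simp only [Dt_eq, Ds_eq, pa, pb, pc, pd'] at θ1 z1 ρ1 v1 w1 b1 b2
  have uc : pd (.inr .Hθ) (η X .u) x = 0 :=
    mul_left_cancel₀ (mul_ne_zero hρ hr) (by linear_combination b2)
  have ud : pd (.inr .Hz) (η X .u) x = 0 :=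
    mul_left_cancel₀ (mul_ne_zero hρ hr) (by linear_combination -b1)
  refine ⟨⟨mul_left_cancel₀ hr (by linear_combination θ1),
    mul_left_cancel₀ hr (by linear_combination z1),
    mul_left_cancel₀ hr (by linear_combination v1 - A * x.2 .ρ * uc),
    mul_left_cancel₀ hr (by linear_combination w1 - A * x.2 .ρ * ud),
    mul_left_cancel₀ hr (by linear_combination ρ1), pa, pb, pc, pd'⟩, uv, uw⟩

/-- `η^r` depends on `t`, `s` and `r` only. -/
lemma pd_ηr {k : Dep} (hk : k ≠ .r) {x : Pt} (hx : x ∈ domain) : pd (.inr k) (η X .r) x = 0 := by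
  obtain ⟨ra, rb, rc, rd⟩ := h.pd_ηr_vwρp hx
  have sr := h.isDtConst_ηr
  cases k
  case r => exact absurd rfl hk
  case u => exact sr.u x hx
  case v => exact ra
  case w => exact rb
  case ρ => exact rc
  case p => exact rd
  case Eθ => exact sr.Eθ x hx
  case Ez => exact sr.Ez x hx
  case Hθ => exact sr.Hθ x hx
  case Hz => exact sr.Hz x hx
  case θ =>
    -- `η^u` does not depend on `v`, whereas `ηu_eq` contains the term `(v / r) η^r_θ`; the case of
    -- `z` is the same with `w η^r_z`.
    have hc := fun c => upd_mem' hx (k := .v) (by decide) (by decide) (by decide) c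
    have e := fun c => apply_upd (h.contDiffOn_η .u) (fun x hx => (h.pd_ηp_aux hx).2.1) hx (hc c)
    simp only [h.ηu_eq (hc _), h.ηu_eq hx, h.ξt_upd _ hx (hc _),
      pd_upd (h.contDiffOn_η _) (fun x hx => (h.pd_ηr_vwρp hx).1) _ hx (hc _), upd_apply_self,
      upd_apply_ne, ne_eq, reduceCtorEq, not_false_eq_true] at e
    have h1 := e 1
    have h0 := e 0
    have hr := hx.1.ne'
    field_simp at h1 h0
    linear_combination h1 - h0
  case z =>
    have hc := fun c => upd_mem' hx (k := .w) (by decide) (by decide) (by decide) c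
    have e := fun c => apply_upd (h.contDiffOn_η .u) (fun x hx => (h.pd_ηp_aux hx).2.2) hx (hc c)
    simp only [h.ηu_eq (hc _), h.ηu_eq hx, h.ξt_upd _ hx (hc _),
      pd_upd (h.contDiffOn_η _) (fun x hx => (h.pd_ηr_vwρp hx).2.1) _ hx (hc _), upd_apply_self,
      upd_apply_ne, ne_eq, reduceCtorEq, not_false_eq_true] at e
    linear_combination e 1 - e 0

lemma ηu_eq' {x : Pt} (hx : x ∈ domain) : η X .u x = pd (.inl .t) (η X .r) x
    + coord (.inr .u) x * (pd (.inr .r) (η X .r) x + (-1) * pd (.inl .t) (ξ X .t) x) := by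
  rw [h.ηu_eq hx, h.pd_ηr (k := .θ) (by decide) hx, h.pd_ηr (k := .z) (by decide) hx]
  simp only [coord]
  ring

lemma pd_ηu (a : Var) {x : Pt} (hx : x ∈ domain) : pd a (η X .u) x
    = pd a (pd (.inl .t) (η X .r)) x
      + (x.2 .u * (pd a (pd (.inr .r) (η X .r)) x - pd a (pd (.inl .t) (ξ X .t)) x)
      + (pd (.inr .r) (η X .r) x - pd (.inl .t) (ξ X .t) x) * if a = .inr .u then 1 else 0) := by
  have s1 := contDiffOn_pd (h.contDiffOn_η .r) (.inl .t)
  have s2 := contDiffOn_pd (h.contDiffOn_η .r) (.inr .r)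
  have s3 := contDiffOn_pd (h.contDiffOn_ξ .t) (.inl .t)
  have s4 : ContDiffOn ℝ ∞ (fun x => (-1) * pd (.inl .t) (ξ X .t) x) domain :=
    contDiffOn_const.mul s3
  rw [pd_congr (fun x hx => h.ηu_eq' hx) a hx,
    pd_add s1 ((contDiffOn_coord _).mul (s2.add s4)) a hx,
    pd_mul (contDiffOn_coord _) (s2.add s4) a hx, pd_add s2 s4 a hx,
    pd_mul contDiffOn_const s3 a hx, pd_const, pd_coord]
  simp only [coord]
  ring

lemma pd_dep_pd_ξt (k : Dep) {x : Pt} (hx : x ∈ domain) (a : Var) :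
    pd (.inr k) (pd a (ξ X .t)) x = 0 :=
  pd_pd_eq_zero (h.contDiffOn_ξ _) (fun _ hx => h.pd_dep_ξt k hx) _ x hx

lemma pd_dep_pd_ξs (k : Dep) {x : Pt} (hx : x ∈ domain) (a : Var) :
    pd (.inr k) (pd a (ξ X .s)) x = 0 :=
  pd_pd_eq_zero (h.contDiffOn_ξ _) (fun _ hx => h.pd_dep_ξs k hx) _ x hx

lemma pd_dep_pd_ηr {k : Dep} (hk : k ≠ .r) {x : Pt} (hx : x ∈ domain) (a : Var) :
    pd (.inr k) (pd a (η X .r)) x = 0 :=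
  pd_pd_eq_zero (h.contDiffOn_η _) (fun _ hx => h.pd_ηr hk hx) _ x hx

lemma pd_dep_ηu {k : Dep} (hr : k ≠ .r) (hu : k ≠ .u) {x : Pt} (hx : x ∈ domain) :
    pd (.inr k) (η X .u) x = 0 := by
  rw [h.pd_ηu _ hx, h.pd_dep_pd_ηr hr hx, h.pd_dep_pd_ηr hr hx, h.pd_dep_pd_ξt _ hx]
  simp [hu]

lemma pd_u_ηu {x : Pt} (hx : x ∈ domain) :
    pd (.inr .u) (η X .u) x = pd (.inr .r) (η X .r) x - pd (.inl .t) (ξ X .t) x := by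
  rw [h.pd_ηu _ hx, h.pd_dep_pd_ηr (by decide) hx, h.pd_dep_pd_ηr (by decide) hx,
    h.pd_dep_pd_ξt _ hx]
  simp

lemma pd_r_ηu {x : Pt} (hx : x ∈ domain) :
    pd (.inr .r) (η X .u) x = pd (.inr .r) (pd (.inl .t) (η X .r)) x
      + x.2 .u * pd (.inr .r) (pd (.inr .r) (η X .r)) x := by
  rw [h.pd_ηu _ hx, h.pd_dep_pd_ξt _ hx]
  simp

/-- `η^p` depends on `t`, `s` and `p` only. -/
lemma pd_ηp {k : Dep} (hk : k ≠ .p) {x : Pt} (hx : x ∈ domain) : pd (.inr k) (η X .p) x = 0 := by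
  obtain ⟨hr, hρ, hp, hs⟩ := h.ne_zero hx
  obtain ⟨⟨pθ, pz, pv, pw, pρ, pa, pb, pc, pd'⟩, -, -⟩ := h.pd_ηp_aux hx
  have u1 := h.Dt_ηu_add_Ds_ηp hx { us := 1 }
  have r1 := h.Dt_ηu_add_Ds_ηp hx { rs := 1 }
  simp only [Dt_eq, Ds_eq, pa, pb, pc, pd',
    h.pd_dep_ηu (k := .ρ) (by decide) (by decide) hx,
    h.pd_dep_ηu (k := .p) (by decide) (by decide) hx,
    h.pd_dep_ηu (k := .Hθ) (by decide) (by decide) hx,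
    h.pd_dep_ηu (k := .Hz) (by decide) (by decide) hx] at u1 r1
  cases k
  case p => exact absurd rfl hk
  case u => exact mul_left_cancel₀ hr (by linear_combination u1)
  case r => exact mul_left_cancel₀ hr (by linear_combination r1)
  all_goals assumption

lemma pd_p_ηp {x : Pt} (hx : x ∈ domain) : x.2 .r * pd (.inr .p) (η X .p) x
    = x.2 .r * pd (.inr .r) (η X .r) x - η X .r x
      + x.2 .r * (pd (.inl .s) (ξ X .s) x - 2 * pd (.inl .t) (ξ X .t) x) := by
  have p1 := h.Dt_ηu_add_Ds_ηp hx { ps := 1 }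
  simp only [Dt_eq, Ds_eq, h.pd_u_ηu hx] at p1
  linear_combination p1

/-- The coefficients of the determining equation for the pressure. -/
lemma eqn_p {x : Pt} (hx : x ∈ domain) :
    (x.2 .r * (η X .ρ x * x.2 .p + x.2 .ρ * η X .p x)
      = x.2 .ρ * x.2 .p * (2 * x.2 .r * (pd (.inl .s) (ξ X .s) x - pd (.inl .t) (ξ X .t) x)
        - 2 * η X .r x)) ∧
    (pd (.inl .t) (η X .r) x + x.2 .r * pd (.inr .r) (pd (.inl .t) (η X .r)) x
      + x.2 .u * (pd (.inr .r) (η X .r) x - η X .r x / x.2 .r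
        + x.2 .r * pd (.inr .r) (pd (.inr .r) (η X .r)) x) = 0) ∧
    pd (.inl .t) (η X .p) x
      + γ * x.2 .ρ * x.2 .p * (x.2 .u * pd (.inl .s) (η X .r) x
        + x.2 .r * pd (.inl .s) (η X .u) x)
      + (γ - 1) * ((σ (x.2 .ρ) (x.2 .p) * (pd (.inr .p) (η X .p) x - pd (.inl .t) (ξ X .t) x)
        - dρ σ (x.2 .ρ) (x.2 .p) * η X .ρ x - dp σ (x.2 .ρ) (x.2 .p) * η X .p x)
          * (x.2 .Eθ ^ 2 + x.2 .Ez ^ 2)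
        - 2 * σ (x.2 .ρ) (x.2 .p) * (x.2 .Eθ * η X .Eθ x + x.2 .Ez * η X .Ez x)) = 0 := by
  obtain ⟨hr, hρ, hp, hs⟩ := h.ne_zero hx
  have hγ : γ ≠ 0 := (one_pos.trans h.one_lt_γ).ne'
  have e0 := h.eqn hx {} .p
  have u1 := h.eqn hx { us := 1 } .p
  have r1 := h.eqn hx { rs := 1 } .p
  have pP := h.pd_p_ηp hx
  have pr := fun {k : Dep} (hk : k ≠ .r) => h.pd_ηr hk hx
  have pp := fun {k : Dep} (hk : k ≠ .p) => h.pd_ηp hk hx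
  have pu := fun {k : Dep} (h1 : k ≠ .r) (h2 : k ≠ .u) => h.pd_dep_ηu h1 h2 hx
  simp only [linResidual, h.prolongSol_eq hx, FreeJet.toJet, Dt_eq, Ds_eq, pr, pp, pu, ne_eq,
    reduceCtorEq, not_false_eq_true, h.pd_u_ηu hx, h.pd_r_ηu hx, zero_mul, one_mul, mul_zero,
    zero_add, add_zero, h.ηu_eq' hx, coord] at e0 u1 r1
  have q1 : x.2 .r * (η X .ρ x * x.2 .p + x.2 .ρ * η X .p x)
      = x.2 .ρ * x.2 .p * (2 * x.2 .r * (pd (.inl .s) (ξ X .s) x - pd (.inl .t) (ξ X .t) x)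
        - 2 * η X .r x) :=
    mul_left_cancel₀ hγ (by linear_combination u1 - e0 + γ * x.2 .ρ * x.2 .p * pP)
  refine ⟨q1, ?_, by linear_combination e0⟩
  -- The coefficient of `r_s` still contains `u` times the `u_s` coefficient; `q1` and `pP` remove
  -- it.
  refine mul_left_cancel₀ (mul_ne_zero (mul_ne_zero (mul_ne_zero hγ hρ) hp) hr) ?_
  linear_combination (norm := skip) x.2 .r * (r1 - e0) - γ * x.2 .u * q1
    + γ * x.2 .ρ * x.2 .p * x.2 .u * pP
  field_simp
  ring

end IsSymmetry

end

/-! ### The radial coefficient is `b r` -/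

noncomputable section

lemma exists_eq_const {f : Pt → ℝ} (hf : ContDiffOn ℝ ∞ f domain)
    (h : ∀ a, ∀ x ∈ domain, pd a f x = 0) : ∃ c, ∀ x ∈ domain, f x = c := by
  have h0 : ((0, fun _ => 1) : Pt) ∈ domain := ⟨one_pos, one_pos, one_pos⟩
  exact ⟨_, fun x hx => eq_of_pd_eq_zero hf hx h0 fun a _ => h a⟩

namespace IsSymmetry

variable {A γ : ℝ} {σ : ℝ → ℝ → ℝ} {X : Pt → Pt} (h : IsSymmetry A γ σ X)
include h

/-- By `pd_p_ηp` the difference `η^r_r - η^r / r` equals an expression independent of `r`; the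
identity is its `r`-derivative multiplied by `r²`. -/
lemma pd_r_pd_r_ηr {x : Pt} (hx : x ∈ domain) :
    x.2 .r * (x.2 .r * pd (.inr .r) (pd (.inr .r) (η X .r)) x)
      = x.2 .r * pd (.inr .r) (η X .r) x - η X .r x := by
  have s1 := contDiffOn_pd (h.contDiffOn_η .r) (.inr .r)
  have s2 := contDiffOn_pd (h.contDiffOn_η .p) (.inr .p)
  have s3 := contDiffOn_pd (h.contDiffOn_ξ .t) (.inl .t)
  have s4 := contDiffOn_pd (h.contDiffOn_ξ .s) (.inl .s)
  have s5 : ContDiffOn ℝ ∞ (fun x => (-1) * pd (.inl .s) (ξ X .s) x) domain :=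
    contDiffOn_const.mul s4
  have s6 : ContDiffOn ℝ ∞ (fun x => 2 * pd (.inl .t) (ξ X .t) x) domain :=
    contDiffOn_const.mul s3
  have key := pd_congr (f := fun x => η X .r x + coord (.inr .r) x * (pd (.inr .p) (η X .p) x
      + ((-1) * pd (.inl .s) (ξ X .s) x + 2 * pd (.inl .t) (ξ X .t) x)))
    (g := fun x => coord (.inr .r) x * pd (.inr .r) (η X .r) x)
    (fun x hx => by
      have := h.pd_p_ηp hx
      simp only [coord]
      linear_combination this) (.inr .r) hx
  rw [pd_add (h.contDiffOn_η _) ((contDiffOn_coord _).mul (s2.add (s5.add s6))) _ hx,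
    pd_mul (contDiffOn_coord _) (s2.add (s5.add s6)) _ hx, pd_add s2 (s5.add s6) _ hx,
    pd_add s5 s6 _ hx, pd_mul contDiffOn_const s4 _ hx, pd_mul contDiffOn_const s3 _ hx,
    pd_mul (contDiffOn_coord _) s1 _ hx, pd_const, pd_const, pd_coord, h.pd_dep_pd_ξs _ hx,
    h.pd_dep_pd_ξt _ hx, pd_pd_eq_zero (h.contDiffOn_η _)
      (fun x hx => h.pd_ηp (k := .r) (by decide) hx) _ x hx] at key
  simp only [coord, if_true] at key
  linear_combination -x.2 .r * key + h.pd_p_ηp hx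

/-- The part of `eqn_p` linear in `u` gives `r² η^r_rr = -(r η^r_r - η^r)`, the opposite sign to
`pd_r_pd_r_ηr`, so both sides vanish. -/
lemma ηr_aux {x : Pt} (hx : x ∈ domain) :
    η X .r x = x.2 .r * pd (.inr .r) (η X .r) x ∧
      pd (.inl .t) (η X .r) x + x.2 .r * pd (.inr .r) (pd (.inl .t) (η X .r)) x = 0 := by
  have hc := fun c => upd_mem' hx (k := .u) (by decide) (by decide) (by decide) c
  have e := fun c => (h.eqn_p (hc c)).2.1
  have hu : ∀ x ∈ domain, pd (.inr .u) (η X .r) x = 0 := fun x hx => h.pd_ηr (by decide) hx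
  have hu' := fun a => pd_pd_eq_zero (h.contDiffOn_η .r) hu a
  simp only [apply_upd (h.contDiffOn_η .r) hu hx (hc _),
    pd_upd (h.contDiffOn_η .r) hu _ hx (hc _),
    pd_upd (contDiffOn_pd (h.contDiffOn_η .r) _) (hu' _) _ hx (hc _), upd_apply_self,
    upd_apply_ne, ne_eq, reduceCtorEq, not_false_eq_true] at e
  have h1 := h.pd_r_pd_r_ηr hx
  have e0 := e 0
  have e1 := e 1
  have hr := hx.1.ne'
  refine ⟨?_, by linear_combination e0⟩
  field_simp at e0 e1
  linear_combination (-1 / 2) * (e1 - e0 - h1)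

lemma pd_eq_of_ηr_eq (a : Var) {x : Pt} (hx : x ∈ domain) : pd a (η X .r) x
    = x.2 .r * pd a (pd (.inr .r) (η X .r)) x
      + pd (.inr .r) (η X .r) x * if a = .inr .r then 1 else 0 := by
  rw [pd_congr (f := η X .r) (g := fun x => coord (.inr .r) x * pd (.inr .r) (η X .r) x)
    (fun x hx => (h.ηr_aux hx).1) a hx,
    pd_mul (contDiffOn_coord _) (contDiffOn_pd (h.contDiffOn_η _) _) a hx, pd_coord]
  rfl

/-- Differentiating `η^r = r η^r_r` in `t` gives `η^r_t = r η^r_rt`, while `ηr_aux` has the opposite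
sign. -/
lemma pd_t_ηr {x : Pt} (hx : x ∈ domain) : pd (.inl .t) (η X .r) x = 0 := by
  have h1 := h.pd_eq_of_ηr_eq (.inl .t) hx
  rw [pd_comm (h.contDiffOn_η _) _ _ hx] at h1
  simp only [reduceCtorEq, if_false, mul_zero, add_zero] at h1
  linear_combination (1 / 2) * (h.ηr_aux hx).2 + (1 / 2) * h1

lemma pd_s_aux {x : Pt} (hx : x ∈ domain) :
    pd (.inl .s) (η X .r) x = 0 ∧ pd (.inl .t) (η X .p) x = 0 := by
  -- At zero electric field the still unknown `η^{E^θ}`, `η^{E^z}` and the derivatives of `σ` drop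
  -- out. The result extends to every point because `η^r` and `η^p` do not depend on the electric
  -- field.
  have key : ∀ x ∈ domain, x.2 .Eθ = 0 → x.2 .Ez = 0 → pd (.inl .t) (η X .p) x
      + 2 * γ * x.2 .ρ * x.2 .p * x.2 .u * pd (.inl .s) (η X .r) x = 0 := by
    intro x hx ha hb
    have h1 := (h.eqn_p hx).2.2
    have h2 := h.pd_eq_of_ηr_eq (.inl .s) hx
    have h3 : pd (.inl .s) (pd (.inl .t) (η X .r)) x = 0 := by
      rw [pd_congr (g := fun _ => 0) (fun x hx => h.pd_t_ηr hx) _ hx, pd_const]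
    have h4 : pd (.inl .s) (pd (.inl .t) (ξ X .t)) x = 0 :=
      pd_pd_eq_zero (h.contDiffOn_ξ _) (fun x hx => h.pd_s_ξt hx) _ x hx
    rw [ha, hb, h.pd_ηu _ hx, h3, h4] at h1
    simp only [reduceCtorEq, if_false, mul_zero, add_zero] at h1 h2
    linear_combination h1 + γ * x.2 .ρ * x.2 .p * x.2 .u * h2
  have step : ∀ x ∈ domain, x.2 .Eθ = 0 → x.2 .Ez = 0 → pd (.inl .s) (η X .r) x = 0 ∧
      pd (.inl .t) (η X .p) x = 0 := by
    intro x hx ha hb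
    have hc := fun c => upd_mem' hx (k := .u) (by decide) (by decide) (by decide) c
    have e := fun c => key _ (hc c) (by rwa [upd_apply_ne _ (by decide)])
      (by rwa [upd_apply_ne _ (by decide)])
    simp only [pd_upd (h.contDiffOn_η .r) (fun x hx => h.pd_ηr (k := .u) (by decide) hx) _ hx
        (hc _), pd_upd (h.contDiffOn_η .p) (fun x hx => h.pd_ηp (k := .u) (by decide) hx) _ hx
        (hc _), upd_apply_self, upd_apply_ne, ne_eq, reduceCtorEq, not_false_eq_true] at e
    obtain ⟨hr, hρ, hp, hs⟩ := h.ne_zero hx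
    have hγ : γ ≠ 0 := (one_pos.trans h.one_lt_γ).ne'
    exact ⟨mul_left_cancel₀ (mul_ne_zero (mul_ne_zero hγ hρ) hp)
      (by linear_combination (e 1 - e 0) / 2), by linear_combination e 0⟩
  have ha := upd_mem' hx (k := .Eθ) (by decide) (by decide) (by decide) 0
  have hb := upd_mem' ha (k := .Ez) (by decide) (by decide) (by decide) 0
  have := step _ hb (by simp [upd]) (by simp [upd])
  rwa [pd_upd (h.contDiffOn_η .r) (fun x hx => h.pd_ηr (by decide) hx) _ ha hb,
    pd_upd (h.contDiffOn_η .r) (fun x hx => h.pd_ηr (by decide) hx) _ hx ha,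
    pd_upd (h.contDiffOn_η .p) (fun x hx => h.pd_ηp (by decide) hx) _ ha hb,
    pd_upd (h.contDiffOn_η .p) (fun x hx => h.pd_ηp (by decide) hx) _ hx ha] at this

lemma exists_ηr : ∃ b, (∀ x ∈ domain, η X .r x = b * x.2 .r) ∧
    ∀ x ∈ domain, pd (.inr .r) (η X .r) x = b := by
  obtain ⟨b, hb⟩ := exists_eq_const (contDiffOn_pd (h.contDiffOn_η .r) (.inr .r)) <| by
    rintro (i | k) x hx
    · cases i
      · exact pd_pd_eq_zero (h.contDiffOn_η _) (fun x hx => h.pd_t_ηr hx) _ x hx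
      · exact pd_pd_eq_zero (h.contDiffOn_η _) (fun x hx => (h.pd_s_aux hx).1) _ x hx
    · by_cases hk : k = .r
      · subst hk
        have h1 := h.pd_eq_of_ηr_eq (.inr .r) hx
        simp only [if_true] at h1
        exact mul_left_cancel₀ hx.1.ne' (by linear_combination -h1)
      · exact h.pd_dep_pd_ηr hk hx _
  refine ⟨b, fun x hx => ?_, hb⟩
  rw [(h.ηr_aux hx).1, hb x hx, mul_comm]

end IsSymmetry

end

/-! ### Swirl terms: `η^θ = h₁(s)`, and constancy of `ξ^t_t`, `ξ^s_s` -/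

noncomputable section

namespace IsSymmetry

variable {A γ : ℝ} {σ : ℝ → ℝ → ℝ} {X : Pt → Pt} (h : IsSymmetry A γ σ X)
include h

lemma pd_ηθ {k : Dep} (h1 : k ≠ .θ) (h2 : k ≠ .z) {x : Pt} (hx : x ∈ domain) :
    pd (.inr k) (η X .θ) x = 0 := by
  obtain ⟨ra, rb, rc, rd⟩ := h.pd_ηθ_vwρp hx
  have rr := h.pd_ηθ_r hx
  obtain ⟨-, r1, r2, r3, r4, r5, -⟩ := h.isDtConst_ηθ
  replace r1 := r1 x hx
  replace r2 := r2 x hx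
  replace r3 := r3 x hx
  replace r4 := r4 x hx
  replace r5 := r5 x hx
  cases k <;> first | assumption | exact absurd rfl h1 | exact absurd rfl h2

lemma pd_ηz {k : Dep} (h1 : k ≠ .θ) (h2 : k ≠ .z) {x : Pt} (hx : x ∈ domain) :
    pd (.inr k) (η X .z) x = 0 := by
  obtain ⟨ra, rb, rc, rd⟩ := h.pd_ηz_vwρp hx
  have rr := h.pd_ηz_r hx
  obtain ⟨-, r1, r2, r3, r4, r5, -⟩ := h.isDtConst_ηz
  replace r1 := r1 x hx
  replace r2 := r2 x hx
  replace r3 := r3 x hx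
  replace r4 := r4 x hx
  replace r5 := r5 x hx
  cases k <;> first | assumption | exact absurd rfl h1 | exact absurd rfl h2

lemma ηr_div {x : Pt} (hx : x ∈ domain) :
    η X .r x / x.2 .r = pd (.inr .r) (η X .r) x := by
  rw [(h.ηr_aux hx).1, mul_div_cancel_left₀ _ hx.1.ne']

lemma pd_ηHθ_aux {x : Pt} (hx : x ∈ domain) :
    (pd (.inr .θ) (η X .Hθ) x = 0 ∧ pd (.inr .z) (η X .Hθ) x = 0 ∧
    pd (.inr .u) (η X .Hθ) x = 0 ∧ pd (.inr .v) (η X .Hθ) x = 0 ∧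
    pd (.inr .w) (η X .Hθ) x = 0 ∧ pd (.inr .ρ) (η X .Hθ) x = 0 ∧
    pd (.inr .p) (η X .Hθ) x = 0 ∧ pd (.inr .Eθ) (η X .Hθ) x = 0 ∧
    pd (.inr .Ez) (η X .Hθ) x = 0) ∧
    η X .Hθ x + x.2 .r * pd (.inr .r) (η X .Hθ) x = x.2 .Hθ * pd (.inr .Hθ) (η X .Hθ) x := by
  obtain ⟨hr, hρ, hp, hs⟩ := h.ne_zero hx
  have hc : x.2 .r * x.2 .ρ ≠ 0 := mul_ne_zero hr hρ
  have pr := fun {k : Dep} (hk : k ≠ .r) => h.pd_ηr hk hx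
  have e0 := h.eqn hx {} .Ez
  have θ1 := h.eqn hx { θs := 1 } .Ez
  have z1 := h.eqn hx { zs := 1 } .Ez
  have u1 := h.eqn hx { us := 1 } .Ez
  have v1 := h.eqn hx { vs := 1 } .Ez
  have w1 := h.eqn hx { ws := 1 } .Ez
  have ρ1 := h.eqn hx { ρs := 1 } .Ez
  have p1 := h.eqn hx { ps := 1 } .Ez
  have a1 := h.eqn hx { Eθs := 1 } .Ez
  have b1 := h.eqn hx { Ezs := 1 } .Ez
  have r1 := h.eqn hx { rs := 1 } .Ez
  simp only [linResidual, h.prolongSol_eq hx, FreeJet.toJet, Ds_eq, zero_mul, one_mul,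
    zero_add, pr, ne_eq, reduceCtorEq, not_false_eq_true]
    at e0 θ1 z1 u1 v1 w1 ρ1 p1 a1 b1 r1
  refine ⟨⟨?_, ?_, ?_, ?_, ?_, ?_, ?_, ?_, ?_⟩, ?_⟩
  on_goal 10 =>
    refine mul_left_cancel₀ hρ ?_
    linear_combination (norm := skip) -(r1 - e0) + x.2 .Hθ * x.2 .ρ * h.ηr_div hx
    field_simp
    ring
  all_goals refine mul_left_cancel₀ hc ?_
  · linear_combination -(θ1 - e0)
  · linear_combination -(z1 - e0)
  · linear_combination -(u1 - e0)
  · linear_combination -(v1 - e0)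
  · linear_combination -(w1 - e0)
  · linear_combination -(ρ1 - e0)
  · linear_combination -(p1 - e0)
  · linear_combination -(a1 - e0)
  · linear_combination -(b1 - e0)

lemma pd_ηHθ {k : Dep} (hr : k ≠ .r) (h1 : k ≠ .Hθ) (h2 : k ≠ .Hz) {x : Pt} (hx : x ∈ domain) :
    pd (.inr k) (η X .Hθ) x = 0 := by
  obtain ⟨⟨e1, e2, e3, e4, e5, e6, e7, e8, e9⟩, -⟩ := h.pd_ηHθ_aux hx
  cases k <;> first
    | assumption | exact absurd rfl hr | exact absurd rfl h1 | exact absurd rfl h2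

lemma pd_ηHz' {k : Dep} (hr : k ≠ .r) (h1 : k ≠ .Hθ) (h2 : k ≠ .Hz) {x : Pt} (hx : x ∈ domain) :
    pd (.inr k) (η X .Hz) x = 0 := by
  obtain ⟨e1, e2, e3, e4, e5, e6, e7, e8, e9, -⟩ := h.pd_ηHz hx
  cases k <;> first
    | assumption | exact absurd rfl hr | exact absurd rfl h1 | exact absurd rfl h2

/-- The part of the momentum equation that contains no derivatives, without electric field. -/
lemma eqn_u_aux {x : Pt} (hx : x ∈ domain) (ha : x.2 .Eθ = 0) (hb : x.2 .Ez = 0) :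
    -(x.2 .u * pd (.inl .t) (pd (.inl .t) (ξ X .t)) x)
      - 2 * x.2 .v * (pd (.inl .t) (η X .θ) x + x.2 .v / x.2 .r * pd (.inr .θ) (η X .θ) x
        + x.2 .w * pd (.inr .z) (η X .θ) x)
      + x.2 .r * (pd (.inl .s) (η X .p) x + x.2 .Hθ * pd (.inl .s) (η X .Hθ) x
        + x.2 .Hz * pd (.inl .s) (η X .Hz) x) = 0 := by
  obtain ⟨hr, hρ, hp, hs⟩ := h.ne_zero hx
  obtain ⟨b, hR, hRr⟩ := h.exists_ηr
  have e1 := h.eqn hx {} .u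
  have pu := fun {k : Dep} (h1 : k ≠ .r) (h2 : k ≠ .u) => h.pd_dep_ηu h1 h2 hx
  have h3 : pd (.inr .r) (pd (.inl .t) (η X .r)) x = 0 := by
    rw [pd_congr (g := fun _ => 0) (fun x hx => h.pd_t_ηr hx) _ hx, pd_const]
  have h4 : pd (.inr .r) (pd (.inr .r) (η X .r)) x = 0 := by
    rw [pd_congr (g := fun _ => b) hRr _ hx, pd_const]
  have h5 : pd (.inl .t) (η X .u) x = -(x.2 .u * pd (.inl .t) (pd (.inl .t) (ξ X .t)) x) := by
    rw [h.pd_ηu _ hx, pd_congr (g := fun _ => 0) (fun x hx => h.pd_t_ηr hx) _ hx, pd_const,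
      pd_congr (g := fun _ => b) hRr _ hx, pd_const]
    simp
  simp only [linResidual, h.prolongSol_eq hx, FreeJet.toJet, Dt_eq, Ds_eq, zero_mul, zero_add,
    ne_eq, reduceCtorEq, not_false_eq_true, pu, ha, hb, h.pd_r_ηu hx, h.pd_u_ηu hx, hRr x hx, h3,
    h4, h5, hR x hx, (h.pd_s_aux hx).1, h.ηv_eq hx] at e1
  linear_combination (norm := skip) e1
  field_simp
  ring

lemma eqn_u {x : Pt} (hx : x ∈ domain) :
    -(x.2 .u * pd (.inl .t) (pd (.inl .t) (ξ X .t)) x)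
      - 2 * x.2 .v * (pd (.inl .t) (η X .θ) x + x.2 .v / x.2 .r * pd (.inr .θ) (η X .θ) x
        + x.2 .w * pd (.inr .z) (η X .θ) x)
      + x.2 .r * (pd (.inl .s) (η X .p) x + x.2 .Hθ * pd (.inl .s) (η X .Hθ) x
        + x.2 .Hz * pd (.inl .s) (η X .Hz) x) = 0 := by
  have ha := upd_mem' hx (k := .Eθ) (by decide) (by decide) (by decide) 0
  have hb := upd_mem' ha (k := .Ez) (by decide) (by decide) (by decide) 0
  have key := h.eqn_u_aux hb (by simp [upd]) (by simp [upd])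
  have sθ := h.contDiffOn_η .θ
  have sp := h.contDiffOn_η .p
  have sa := h.contDiffOn_η .Hθ
  have sb := h.contDiffOn_η .Hz
  have st := contDiffOn_pd (h.contDiffOn_ξ .t) (.inl .t)
  simp only [
    pd_upd st (fun _ hx => h.pd_dep_pd_ξt .Eθ hx _) _ hx ha,
    pd_upd st (fun _ hx => h.pd_dep_pd_ξt .Ez hx _) _ ha hb,
    pd_upd sθ (fun _ hx => h.pd_ηθ (k := .Eθ) (by decide) (by decide) hx) _ hx ha,
    pd_upd sθ (fun _ hx => h.pd_ηθ (k := .Ez) (by decide) (by decide) hx) _ ha hb,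
    pd_upd sp (fun _ hx => h.pd_ηp (k := .Eθ) (by decide) hx) _ hx ha,
    pd_upd sp (fun _ hx => h.pd_ηp (k := .Ez) (by decide) hx) _ ha hb,
    pd_upd sa (fun _ hx => h.pd_ηHθ (k := .Eθ) (by decide) (by decide) (by decide) hx) _ hx ha,
    pd_upd sa (fun _ hx => h.pd_ηHθ (k := .Ez) (by decide) (by decide) (by decide) hx) _ ha hb,
    pd_upd sb (fun _ hx => h.pd_ηHz' (k := .Eθ) (by decide) (by decide) (by decide) hx) _ hx ha,
    pd_upd sb (fun _ hx => h.pd_ηHz' (k := .Ez) (by decide) (by decide) (by decide) hx) _ ha hb,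
    upd_apply_ne, ne_eq, reduceCtorEq, not_false_eq_true] at key
  exact key

lemma pd_t_pd_t_ξt {x : Pt} (hx : x ∈ domain) : pd (.inl .t) (pd (.inl .t) (ξ X .t)) x = 0 := by
  have hc := fun c => upd_mem' hx (k := .u) (by decide) (by decide) (by decide) c
  have key := fun c => h.eqn_u (hc c)
  simp only [
    pd_upd (contDiffOn_pd (h.contDiffOn_ξ .t) _) (fun _ hx => h.pd_dep_pd_ξt .u hx _) _ hx (hc _),
    pd_upd (h.contDiffOn_η .θ) (fun _ hx => h.pd_ηθ (k := .u) (by decide) (by decide) hx) _ hx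
      (hc _),
    pd_upd (h.contDiffOn_η .p) (fun _ hx => h.pd_ηp (k := .u) (by decide) hx) _ hx (hc _),
    pd_upd (h.contDiffOn_η .Hθ)
      (fun _ hx => h.pd_ηHθ (k := .u) (by decide) (by decide) (by decide) hx) _ hx (hc _),
    pd_upd (h.contDiffOn_η .Hz)
      (fun _ hx => h.pd_ηHz' (k := .u) (by decide) (by decide) (by decide) hx) _ hx (hc _),
    upd_apply_self, upd_apply_ne, ne_eq, reduceCtorEq, not_false_eq_true] at key
  linear_combination key 0 - key 1

lemma eqn_u_v {x : Pt} (hx : x ∈ domain) :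
    pd (.inl .t) (η X .θ) x + x.2 .w * pd (.inr .z) (η X .θ) x = 0 ∧
    pd (.inr .θ) (η X .θ) x = 0 ∧
    pd (.inl .s) (η X .p) x + x.2 .Hθ * pd (.inl .s) (η X .Hθ) x
        + x.2 .Hz * pd (.inl .s) (η X .Hz) x = 0 := by
  have hc := fun c => upd_mem' hx (k := .v) (by decide) (by decide) (by decide) c
  have key := fun c => h.eqn_u (hc c)
  simp only [h.pd_t_pd_t_ξt (hc _),
    pd_upd (h.contDiffOn_η .θ) (fun _ hx => h.pd_ηθ (k := .v) (by decide) (by decide) hx) _ hx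
      (hc _),
    pd_upd (h.contDiffOn_η .p) (fun _ hx => h.pd_ηp (k := .v) (by decide) hx) _ hx (hc _),
    pd_upd (h.contDiffOn_η .Hθ)
      (fun _ hx => h.pd_ηHθ (k := .v) (by decide) (by decide) (by decide) hx) _ hx (hc _),
    pd_upd (h.contDiffOn_η .Hz)
      (fun _ hx => h.pd_ηHz' (k := .v) (by decide) (by decide) (by decide) hx) _ hx (hc _),
    upd_apply_self, upd_apply_ne, ne_eq, reduceCtorEq, not_false_eq_true] at key
  -- The identity is quadratic in `v`; three values separate its coefficients.
  have k0 := key 0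
  have k1 := key 1
  have k2 := key (-1)
  have hr := hx.1.ne'
  refine ⟨by linear_combination (-1 / 4) * (k1 - k2), ?_,
    mul_left_cancel₀ hr (by linear_combination k0)⟩
  have h3 : 1 / x.2 .r * pd (.inr .θ) (η X .θ) x = 0 := by
    linear_combination (-1 / 4) * (k1 + k2 - 2 * k0)
  simpa [hr] using h3

/-- `η^θ` depends on `s` only. -/
lemma pd_ηθ_eq_zero {a : Var} (ha : a ≠ .inl .s) {x : Pt} (hx : x ∈ domain) :
    pd a (η X .θ) x = 0 := by
  have hc := fun c => upd_mem' hx (k := .w) (by decide) (by decide) (by decide) c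
  have key := fun c => (h.eqn_u_v (hc c)).1
  simp only [
    pd_upd (h.contDiffOn_η .θ) (fun _ hx => h.pd_ηθ (k := .w) (by decide) (by decide) hx) _ hx
      (hc _), upd_apply_self] at key
  rcases a with i | k
  · cases i
    · linear_combination key 0
    · exact absurd rfl ha
  · by_cases h1 : k = .θ
    · subst h1
      exact (h.eqn_u_v hx).2.1
    by_cases h2 : k = .z
    · subst h2
      linear_combination key 1 - key 0
    · exact h.pd_ηθ h1 h2 hx

/-- The coefficients at `H^θ` and `H^z` in `eqn_u_v` may depend on the magnetic field, but `η^p`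
does not, so setting the field to zero isolates its derivative. -/
lemma pd_s_ηp {x : Pt} (hx : x ∈ domain) : pd (.inl .s) (η X .p) x = 0 := by
  have ha := upd_mem' hx (k := .Hθ) (by decide) (by decide) (by decide) 0
  have hb := upd_mem' ha (k := .Hz) (by decide) (by decide) (by decide) 0
  have key := (h.eqn_u_v hb).2.2
  simpa only [pd_upd (h.contDiffOn_η .p) (fun _ hx => h.pd_ηp (k := .Hθ) (by decide) hx) _ hx ha,
    pd_upd (h.contDiffOn_η .p) (fun _ hx => h.pd_ηp (k := .Hz) (by decide) hx) _ ha hb,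
    upd_apply_self, upd_apply_ne, ne_eq, reduceCtorEq, not_false_eq_true, zero_mul,
    add_zero] using key

lemma exists_ξt : ∃ a, ∀ x ∈ domain, pd (.inl .t) (ξ X .t) x = a := by
  refine exists_eq_const (contDiffOn_pd (h.contDiffOn_ξ .t) (.inl .t)) ?_
  rintro (i | k) x hx
  · cases i
    · exact h.pd_t_pd_t_ξt hx
    · exact pd_pd_eq_zero (h.contDiffOn_ξ _) (fun x hx => h.pd_s_ξt hx) _ x hx
  · exact h.pd_dep_pd_ξt k hx _

lemma pd_p_ηp' {x : Pt} (hx : x ∈ domain) :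
    pd (.inr .p) (η X .p) x = pd (.inl .s) (ξ X .s) x - 2 * pd (.inl .t) (ξ X .t) x := by
  refine mul_left_cancel₀ hx.1.ne' ?_
  linear_combination h.pd_p_ηp hx - (h.ηr_aux hx).1

/-- In `η^p_p = ξ^s_s - 2 ξ^t_t` the left side depends on neither `t` nor `s`, and the right side on
no dependent variable. -/
lemma exists_ξs : ∃ c, ∀ x ∈ domain, pd (.inl .s) (ξ X .s) x = c := by
  obtain ⟨a, ha⟩ := h.exists_ξt
  obtain ⟨e, he⟩ := exists_eq_const (contDiffOn_pd (h.contDiffOn_η .p) (.inr .p)) <| by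
    rintro (i | k) x hx
    · cases i
      · exact pd_pd_eq_zero (h.contDiffOn_η _) (fun x hx => (h.pd_s_aux hx).2) _ x hx
      · exact pd_pd_eq_zero (h.contDiffOn_η _) (fun x hx => h.pd_s_ηp hx) _ x hx
    · by_cases hk : k = .p
      · subst hk
        rw [pd_congr (g := fun x => pd (.inl .s) (ξ X .s) x + (-2) * pd (.inl .t) (ξ X .t) x)
          (fun x hx => by rw [h.pd_p_ηp' hx]; ring) _ hx,
          pd_add (contDiffOn_pd (h.contDiffOn_ξ _) _)
            (contDiffOn_const.mul (contDiffOn_pd (h.contDiffOn_ξ _) _)) _ hx,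
          pd_mul contDiffOn_const (contDiffOn_pd (h.contDiffOn_ξ _) _) _ hx, pd_const,
          h.pd_dep_pd_ξs _ hx, h.pd_dep_pd_ξt _ hx]
        ring
      · exact pd_pd_eq_zero (h.contDiffOn_η _) (fun x hx => h.pd_ηp hk hx) _ x hx
  refine ⟨e + 2 * a, fun x hx => ?_⟩
  linear_combination he x hx + 2 * ha x hx - h.pd_p_ηp' hx

end IsSymmetry

end

/-! ### Reduction to the three constants `a`, `b`, `c` -/

noncomputable section

lemma pd_eq_of_eq_mul {f : Pt → ℝ} {m : ℝ} {k : Dep} (hf : ∀ x ∈ domain, f x = m * x.2 k)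
    (a : Var) {x : Pt} (hx : x ∈ domain) : pd a f x = if a = .inr k then m else 0 := by
  rw [pd_congr (g := fun x => m * coord (.inr k) x) hf a hx,
    pd_mul contDiffOn_const (contDiffOn_coord _) a hx, pd_const, pd_coord]
  split <;> ring

/-- The part of the coefficients of a symmetry that is determined by three constants. -/
structure IsScaling (X : Pt → Pt) (a b c : ℝ) : Prop where
  ξt : ∀ x ∈ domain, pd (.inl .t) (ξ X .t) x = a
  ξs : ∀ x ∈ domain, pd (.inl .s) (ξ X .s) x = c
  r : ∀ x ∈ domain, η X .r x = b * x.2 .r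
  u : ∀ x ∈ domain, η X .u x = (b - a) * x.2 .u
  v : ∀ x ∈ domain, η X .v x = (b - a) * x.2 .v
  ρ : ∀ x ∈ domain, η X .ρ x = (c - 2 * b) * x.2 .ρ
  p : ∀ x ∈ domain, η X .p x = (c - 2 * a) * x.2 .p

namespace IsSymmetry

variable {A γ : ℝ} {σ : ℝ → ℝ → ℝ} {X : Pt → Pt} (h : IsSymmetry A γ σ X)
include h

lemma exists_isScaling : ∃ a b c, IsScaling X a b c := by
  obtain ⟨a, ha⟩ := h.exists_ξt
  obtain ⟨b, hb, hb'⟩ := h.exists_ηr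
  obtain ⟨c, hc⟩ := h.exists_ξs
  have hu : ∀ x ∈ domain, η X .u x = (b - a) * x.2 .u := fun x hx => by
    rw [h.ηu_eq' hx, h.pd_t_ηr hx, hb' x hx, ha x hx]
    simp only [coord]
    ring
  have hv : ∀ x ∈ domain, η X .v x = (b - a) * x.2 .v := fun x hx => by
    have hr := hx.1.ne'
    rw [h.ηv_eq hx, h.pd_ηθ_eq_zero (by simp) hx, h.pd_ηθ_eq_zero (by simp) hx,
      h.pd_ηθ_eq_zero (by simp) hx, hb x hx, ha x hx]
    field_simp
    ring
  have hP : ∀ x ∈ domain, pd (.inr .p) (η X .p) x = c - 2 * a := fun x hx => by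
    rw [h.pd_p_ηp' hx, hc x hx, ha x hx]
  have key : ∀ x ∈ domain, coord (.inr .p) x * η X .ρ x + coord (.inr .ρ) x * η X .p x
      = (2 * c - 2 * a - 2 * b) * (coord (.inr .ρ) x * coord (.inr .p) x) := fun x hx => by
    have := (h.eqn_p hx).1
    rw [hb x hx, hc x hx, ha x hx] at this
    refine mul_left_cancel₀ hx.1.ne' ?_
    simp only [coord]
    linear_combination this
  have hQ : ∀ x ∈ domain, η X .ρ x = (c - 2 * b) * x.2 .ρ := fun x hx => by
    obtain ⟨hr, hρ, hp, hs⟩ := h.ne_zero hx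
    have key' : ∀ k : Dep, _ := fun k => pd_congr key (.inr k) hx
    simp only [pd_add ((contDiffOn_coord (.inr .p)).mul (h.contDiffOn_η .ρ))
        ((contDiffOn_coord (.inr .ρ)).mul (h.contDiffOn_η .p)) _ hx,
      pd_mul (contDiffOn_coord (.inr .p)) (h.contDiffOn_η .ρ) _ hx,
      pd_mul (contDiffOn_coord (.inr .ρ)) (h.contDiffOn_η .p) _ hx,
      pd_mul contDiffOn_const ((contDiffOn_coord (.inr .ρ)).mul (contDiffOn_coord (.inr .p))) _ hx,
      pd_mul (contDiffOn_coord (.inr .ρ)) (contDiffOn_coord (.inr .p)) _ hx, pd_coord, pd_const,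
      Sum.inr.injEq] at key'
    have kρ := key' .ρ
    have kp := key' .p
    have ka := key' .Hθ
    have kb := key' .Hz
    have k0 := key x hx
    simp only [reduceCtorEq, if_true, if_false, h.pd_ηp (k := .ρ) (by decide) hx,
      h.pd_ηp (k := .Hθ) (by decide) hx, h.pd_ηp (k := .Hz) (by decide) hx, hP x hx, coord]
      at kρ kp ka kb k0
    have qa : pd (.inr .Hθ) (η X .ρ) x = 0 := mul_left_cancel₀ hp (by linear_combination ka)
    have qb : pd (.inr .Hz) (η X .ρ) x = 0 := mul_left_cancel₀ hp (by linear_combination kb)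
    have e0 := h.eqn hx {} .ρ
    have e1 := h.eqn hx { us := 1 } .ρ
    have pr := pd_eq_of_eq_mul hb (x := x) (hx := hx)
    have pu := pd_eq_of_eq_mul hu (x := x) (hx := hx)
    simp only [linResidual, h.prolongSol_eq hx, FreeJet.toJet, Dt_eq, Ds_eq, qa, qb, pr, pu,
      Sum.inr.injEq, reduceCtorEq, if_true, if_false, hb x hx, hu x hx, ha x hx, hc x hx]
      at e0 e1
    -- Up to here `η^p` could contain an additive constant `d`, with `-d ρ / p` in `η^ρ`. The
    -- coefficient of `u_s` in the mass equation multiplies `d` by `1 + γ`, up to a nonzero factor,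
    -- and so excludes it.
    have hγ : 1 + γ ≠ 0 := by
      have := h.one_lt_γ
      positivity
    refine mul_left_cancel₀ (mul_ne_zero (mul_ne_zero (mul_ne_zero hρ hr) hp) hγ) ?_
    linear_combination x.2 .p * (e1 - e0) + x.2 .ρ ^ 2 * x.2 .r * kρ
      + γ * x.2 .ρ * x.2 .r * x.2 .p * kp - x.2 .ρ * x.2 .r * k0
  refine ⟨a, b, c, ha, hc, hb, hu, hv, hQ, fun x hx => ?_⟩
  have := key x hx
  simp only [coord, hQ x hx] at this
  exact mul_left_cancel₀ hx.2.1.ne' (by linear_combination this)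

end IsSymmetry

end

/-! ### Axial momentum: `η^z`, `η^w`, `η^{H^z}` -/

noncomputable section

namespace IsSymmetry

variable {A γ : ℝ} {σ : ℝ → ℝ → ℝ} {X : Pt → Pt} (h : IsSymmetry A γ σ X) {a b c : ℝ}
  (hS : IsScaling X a b c)
include h hS

/-- `η^w` and `η^{H^z}` do not depend on the electric field, so the formula for `D_t η^w` splits
into its powers of `E^θ` and `E^z`. -/
lemma eqn_w_aux {x : Pt} (hx : x ∈ domain) :
    pd (.inr .v) (η X .w) x = pd (.inr .Hθ) (η X .Hz) x ∧
    pd (.inr .w) (η X .w) x = pd (.inr .Hz) (η X .Hz) x - c + a ∧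
    pd (.inl .t) (η X .w) x + x.2 .u * pd (.inr .r) (η X .w) x
      + x.2 .v / x.2 .r * pd (.inr .θ) (η X .w) x + x.2 .w * pd (.inr .z) (η X .w) x
      - x.2 .u * x.2 .v / x.2 .r * pd (.inr .v) (η X .w) x = A * pd (.inl .s) (η X .Hz) x := by
  obtain ⟨hr, hρ, hp, hs⟩ := h.ne_zero hx
  have hA := h.A_ne_zero
  have hγ : γ - 1 ≠ 0 := sub_ne_zero.2 h.one_lt_γ.ne'
  have sw := h.isDtConst_ηw
  have key : ∀ x ∈ domain, _ := fun x hx => h.Dt_ηw hx {}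
  have hE := fun c => upd_mem' hx (k := .Eθ) (by decide) (by decide) (by decide) c
  have hZ := fun c => upd_mem' hx (k := .Ez) (by decide) (by decide) (by decide) c
  have e := fun c => key _ (hE c)
  have f := fun c => key _ (hZ c)
  have e0 := key x hx
  simp only [sw.Dt_eq A σ (hE _), sw.Dt_eq A σ (hZ _), sw.Dt_eq A σ hx,
    pd_upd sw.contDiffOn sw.Eθ _ hx (hE _), pd_upd sw.contDiffOn sw.Ez _ hx (hZ _),
    pd_upd (h.contDiffOn_η .Hz)
      (fun _ hx => h.pd_ηHz' (k := .Eθ) (by decide) (by decide) (by decide) hx) _ hx (hE _),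
    pd_upd (h.contDiffOn_η .Hz)
      (fun _ hx => h.pd_ηHz' (k := .Ez) (by decide) (by decide) (by decide) hx) _ hx (hZ _),
    hS.ξt _ (hE _), hS.ξs _ (hE _), hS.ξt _ (hZ _), hS.ξs _ (hZ _), hS.ξt x hx, hS.ξs x hx,
    upd_apply_self, upd_apply_ne, ne_eq, reduceCtorEq, not_false_eq_true] at e f e0
  have wp : pd (.inr .p) (η X .w) x = 0 := mul_left_cancel₀ (mul_ne_zero hγ hs)
    (by linear_combination (e 1 + e (-1) - 2 * e 0) / 2)
  have hc : A * σ (x.2 .ρ) (x.2 .p) / (x.2 .r * x.2 .ρ) ≠ 0 := by simp [*]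
  have wv : pd (.inr .v) (η X .w) x = pd (.inr .Hθ) (η X .Hz) x :=
    mul_left_cancel₀ hc (by linear_combination (f 1 - f (-1)) / 2)
  have ww : pd (.inr .w) (η X .w) x = pd (.inr .Hz) (η X .Hz) x - c + a :=
    mul_left_cancel₀ hc (by linear_combination -(e 1 - e (-1)) / 2)
  refine ⟨wv, ww, ?_⟩
  rw [wp, ww, wv] at e0
  rw [wv]
  linear_combination e0

lemma eqn_w_u {x : Pt} (hx : x ∈ domain) :
    pd (.inr .r) (η X .w) x = x.2 .v / x.2 .r * pd (.inr .v) (η X .w) x ∧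
    pd (.inl .t) (η X .w) x + x.2 .v / x.2 .r * pd (.inr .θ) (η X .w) x
      + x.2 .w * pd (.inr .z) (η X .w) x = A * pd (.inl .s) (η X .Hz) x := by
  have sw := h.isDtConst_ηw
  have hc := fun c => upd_mem' hx (k := .u) (by decide) (by decide) (by decide) c
  have e := fun c => (h.eqn_w_aux hS (hc c)).2.2
  simp only [pd_upd sw.contDiffOn sw.u _ hx (hc _), pd_upd (h.contDiffOn_η .Hz)
      (fun _ hx => h.pd_ηHz' (k := .u) (by decide) (by decide) (by decide) hx) _ hx (hc _),
    upd_apply_self, upd_apply_ne, ne_eq, reduceCtorEq, not_false_eq_true] at e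
  exact ⟨by linear_combination e 1 - e 0, by linear_combination e 0⟩

/-- From `ηw_eq`, `η^w_r = -(v / r²) η^z_θ` and `η^w_v = η^z_θ / r`, whereas `eqn_w_u` requires
`η^w_r = (v / r) η^w_v`. Hence `2 v η^z_θ = 0`, and `v` may be taken to be `1`. -/
lemma pd_θ_ηz {x : Pt} (hx : x ∈ domain) : pd (.inr .θ) (η X .z) x = 0 := by
  have key : ∀ x ∈ domain, x.2 .v * pd (.inr .θ) (η X .z) x = 0 := fun x hx => by
    have hr := hx.1.ne'
    have hf : ∀ x ∈ domain, coord (.inr .r) x * η X .w x = coord (.inr .r) x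
        * (pd (.inl .t) (η X .z) x + coord (.inr .w) x * (pd (.inr .z) (η X .z) x + (-a)))
        + coord (.inr .v) x * pd (.inr .θ) (η X .z) x := fun x hx => by
      have hr := hx.1.ne'
      rw [h.ηw_eq hx, hS.ξt x hx]
      simp only [coord]
      field_simp
      ring
    have sz := fun i => contDiffOn_pd (h.contDiffOn_η .z) i
    have s1 : ContDiffOn ℝ ∞ (fun x => pd (.inr .z) (η X .z) x + (-a)) domain :=
      (sz _).add contDiffOn_const
    have s2 : ContDiffOn ℝ ∞ (fun x => coord (.inr .w) x * (pd (.inr .z) (η X .z) x + (-a)))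
        domain := (contDiffOn_coord _).mul s1
    have s3 : ContDiffOn ℝ ∞ (fun x => pd (.inl .t) (η X .z) x
        + coord (.inr .w) x * (pd (.inr .z) (η X .z) x + (-a))) domain := (sz _).add s2
    have key := fun i => pd_congr hf i hx
    have d1 := fun i => pd_pd_eq_zero (h.contDiffOn_η .z)
      (fun x hx => h.pd_ηz (k := .r) (by decide) (by decide) hx) i x hx
    have d2 := fun i => pd_pd_eq_zero (h.contDiffOn_η .z)
      (fun x hx => h.pd_ηz (k := .v) (by decide) (by decide) hx) i x hx
    have k1 := key (.inr .r)
    have k2 := key (.inr .v)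
    simp only [pd_add ((contDiffOn_coord (.inr .r)).mul s3)
        ((contDiffOn_coord (.inr .v)).mul (sz (.inr .θ))) _ hx,
      pd_mul (contDiffOn_coord (.inr .r)) s3 _ hx,
      pd_mul (contDiffOn_coord (.inr .r)) (h.contDiffOn_η .w) _ hx,
      pd_mul (contDiffOn_coord (.inr .v)) (sz (.inr .θ)) _ hx,
      pd_add (sz (.inl .t)) s2 _ hx, pd_mul (contDiffOn_coord (.inr .w)) s1 _ hx,
      pd_add (sz (.inr .z)) contDiffOn_const _ hx, pd_coord, pd_const, d1, d2, Sum.inr.injEq,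
      reduceCtorEq, if_true, if_false] at k1 k2
    have e1 := (h.eqn_w_u hS hx).1
    have e2 := hf x hx
    field_simp at e1
    simp only [coord] at k1 k2 e2
    linear_combination (-1 / 2) * (x.2 .r * e1 - x.2 .r * k1 + e2 + x.2 .v * k2)
  have hc := upd_mem' hx (k := .v) (by decide) (by decide) (by decide) 1
  simpa [upd_apply_self, pd_upd (h.contDiffOn_η .z)
    (fun x hx => h.pd_ηz (k := .v) (by decide) (by decide) hx) _ hx hc] using key _ hc

lemma ηw_eq' {x : Pt} (hx : x ∈ domain) : η X .w x = pd (.inl .t) (η X .z) x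
    + coord (.inr .w) x * (pd (.inr .z) (η X .z) x + (-a)) := by
  rw [h.ηw_eq hx, h.pd_θ_ηz hS hx, hS.ξt x hx]
  simp only [coord]
  ring

lemma pd_ηw (i : Var) {x : Pt} (hx : x ∈ domain) : pd i (η X .w) x
    = pd i (pd (.inl .t) (η X .z)) x + (x.2 .w * pd i (pd (.inr .z) (η X .z)) x
      + (pd (.inr .z) (η X .z) x - a) * if i = .inr .w then 1 else 0) := by
  have sz := fun i => contDiffOn_pd (h.contDiffOn_η .z) i
  have s1 : ContDiffOn ℝ ∞ (fun x => pd (.inr .z) (η X .z) x + (-a)) domain :=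
    (sz _).add contDiffOn_const
  rw [pd_congr (fun x hx => h.ηw_eq' hS hx) i hx, pd_add (sz _) ((contDiffOn_coord _).mul s1) _ hx,
    pd_mul (contDiffOn_coord _) s1 _ hx, pd_add (sz _) contDiffOn_const _ hx, pd_const, pd_coord]
  simp only [coord]
  ring

lemma pd_dep_pd_ηz {k : Dep} (hk : k ≠ .z) (i : Var) {x : Pt} (hx : x ∈ domain) :
    pd (.inr k) (pd i (η X .z)) x = 0 := by
  refine pd_pd_eq_zero (h.contDiffOn_η _) (fun x hx => ?_) i x hx
  by_cases h1 : k = .θ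
  · subst h1
    exact h.pd_θ_ηz hS hx
  · exact h.pd_ηz h1 hk hx

lemma pd_Hθ_ηHz {x : Pt} (hx : x ∈ domain) : pd (.inr .Hθ) (η X .Hz) x = 0 := by
  rw [← (h.eqn_w_aux hS hx).1, h.pd_ηw hS _ hx, h.pd_dep_pd_ηz hS (by decide) _ hx,
    h.pd_dep_pd_ηz hS (by decide) _ hx]
  simp

/-- `η^{H^z}` depends on `t`, `s` and `H^z` only. -/
lemma pd_ηHz_eq_zero {k : Dep} (hk : k ≠ .Hz) {x : Pt} (hx : x ∈ domain) :
    pd (.inr k) (η X .Hz) x = 0 := by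
  have h0 := h.pd_Hθ_ηHz hS hx
  by_cases h1 : k = .r
  · rw [h1, (h.pd_ηHz hx).2.2.2.2.2.2.2.2.2, h0, mul_zero]
  by_cases h2 : k = .Hθ
  · rwa [h2]
  · exact h.pd_ηHz' h1 h2 hk hx

lemma pd_Hz_ηHz {x : Pt} (hx : x ∈ domain) :
    pd (.inr .Hz) (η X .Hz) x = pd (.inr .z) (η X .z) x + c - 2 * a := by
  have := (h.eqn_w_aux hS hx).2.1
  rw [h.pd_ηw hS _ hx, h.pd_dep_pd_ηz hS (by decide) _ hx,
    h.pd_dep_pd_ηz hS (by decide) _ hx] at this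
  simp only [if_true] at this
  linear_combination -this

/-- After `ηw_eq'` is inserted into `eqn_w_u`, the part odd in `w` is `w (η^z_tz + η^z_zt)`, which
vanishes only if each of the equal mixed derivatives does. -/
lemma pd_pd_ηz {x : Pt} (hx : x ∈ domain) : pd (.inr .z) (pd (.inl .t) (η X .z)) x = 0 ∧
    pd (.inl .t) (pd (.inl .t) (η X .z)) x = A * pd (.inl .s) (η X .Hz) x := by
  have hw : ∀ x ∈ domain, pd (.inr .w) (η X .z) x = 0 := fun x hx =>
    h.pd_ηz (by decide) (by decide) hx
  have hc := fun c => upd_mem' hx (k := .w) (by decide) (by decide) (by decide) c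
  have key := fun c => (h.eqn_w_u hS (hc c)).2
  simp only [h.pd_ηw hS _ (hc _), h.pd_dep_pd_ηz hS (k := .θ) (by decide) _ (hc _),
    pd_upd (contDiffOn_pd (h.contDiffOn_η .z) _) (pd_pd_eq_zero (h.contDiffOn_η .z) hw _) _ hx
      (hc _), pd_upd (h.contDiffOn_η .z) hw _ hx (hc _), upd_apply_self, upd_apply_ne, ne_eq,
    pd_upd (h.contDiffOn_η .Hz) (fun _ hx => h.pd_ηHz_eq_zero hS (k := .w) (by decide) hx) _ hx
      (hc _), reduceCtorEq, not_false_eq_true, if_false, Sum.inr.injEq] at key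
  have hcomm := pd_comm (h.contDiffOn_η .z) (.inr .z) (.inl .t) hx
  exact ⟨by linear_combination (1 / 4) * (key 1 - key (-1)) + (1 / 2) * hcomm,
    by linear_combination key 0⟩

end IsSymmetry

end

/-! ### Ohm's law, Joule heating and induction -/

noncomputable section

namespace IsSymmetry

variable {A γ : ℝ} {σ : ℝ → ℝ → ℝ} {X : Pt → Pt} (h : IsSymmetry A γ σ X) {a b c : ℝ}
  (hS : IsScaling X a b c)
include h hS

lemma eqn_v_aux {x : Pt} (hx : x ∈ domain) :
    σ (x.2 .ρ) (x.2 .p) / x.2 .ρ * (x.2 .Ez * (b + c - 2 * a - pd (.inr .Hθ) (η X .Hθ) x)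
      + x.2 .Eθ * pd (.inr .Hz) (η X .Hθ) x) = x.2 .r * pd (.inl .s) (η X .Hθ) x := by
  obtain ⟨hr, hρ, hp, hs⟩ := h.ne_zero hx
  have e := h.eqn hx {} .v
  simp only [linResidual, h.prolongSol_eq hx, FreeJet.toJet, Dt_eq, Ds_eq,
    pd_eq_of_eq_mul hS.v _ hx, pd_eq_of_eq_mul hS.r _ hx, hS.ξt x hx, hS.ξs x hx, hS.r x hx,
    hS.u x hx, hS.v x hx, Sum.inr.injEq, reduceCtorEq, if_true, if_false] at e
  refine mul_left_cancel₀ h.A_ne_zero ?_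
  linear_combination (norm := skip) x.2 .r * e
  field_simp
  ring

lemma pd_ηHθ_E {x : Pt} (hx : x ∈ domain) : pd (.inr .Hθ) (η X .Hθ) x = b + c - 2 * a ∧
    pd (.inr .Hz) (η X .Hθ) x = 0 ∧ pd (.inl .s) (η X .Hθ) x = 0 := by
  obtain ⟨hr, hρ, hp, hs⟩ := h.ne_zero hx
  have hE := fun c => upd_mem' hx (k := .Eθ) (by decide) (by decide) (by decide) c
  have hZ := fun c d => upd_mem' (hE d) (k := .Ez) (by decide) (by decide) (by decide) c
  have key := fun c d => h.eqn_v_aux hS (hZ c d)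
  simp only [pd_upd (h.contDiffOn_η .Hθ)
      (fun _ hx => h.pd_ηHθ (k := .Eθ) (by decide) (by decide) (by decide) hx) _ hx (hE _),
    pd_upd (h.contDiffOn_η .Hθ)
      (fun _ hx => h.pd_ηHθ (k := .Ez) (by decide) (by decide) (by decide) hx) _ (hE _) (hZ _ _),
    upd_apply_self, upd_apply_ne, ne_eq, reduceCtorEq, not_false_eq_true] at key
  have hc : σ (x.2 .ρ) (x.2 .p) / x.2 .ρ ≠ 0 := div_ne_zero hs hρ
  exact ⟨mul_left_cancel₀ hc (by linear_combination key 0 0 - key 1 0),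
    mul_left_cancel₀ hc (by linear_combination key 0 1 - key 0 0),
    mul_left_cancel₀ hr (by linear_combination -key 0 0)⟩

lemma ηEz_aux {x : Pt} (hx : x ∈ domain) : σ (x.2 .ρ) (x.2 .p) * η X .Ez x
    = x.2 .Ez * (σ (x.2 .ρ) (x.2 .p) * (c - 2 * a)
      - (dρ σ (x.2 .ρ) (x.2 .p) * ((c - 2 * b) * x.2 .ρ)
        + dp σ (x.2 .ρ) (x.2 .p) * ((c - 2 * a) * x.2 .p))) := by
  obtain ⟨hr, hρ, hp, hs⟩ := h.ne_zero hx
  obtain ⟨g1, g2, g3⟩ := h.pd_ηHθ_E hS hx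
  have e := h.eqn hx {} .Ez
  simp only [linResidual, h.prolongSol_eq hx, FreeJet.toJet, Ds_eq, pd_eq_of_eq_mul hS.r _ hx,
    hS.ξs x hx, hS.r x hx, hS.ρ x hx, hS.p x hx, g1, g2, g3, Sum.inr.injEq, reduceCtorEq,
    if_true, if_false] at e
  linear_combination (norm := skip) e
  field_simp
  ring

lemma ηEθ_aux {x : Pt} (hx : x ∈ domain) : σ (x.2 .ρ) (x.2 .p) * η X .Eθ x
    = x.2 .Eθ * (σ (x.2 .ρ) (x.2 .p) * (c - b - 2 * a + pd (.inr .z) (η X .z) x)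
      - (dρ σ (x.2 .ρ) (x.2 .p) * ((c - 2 * b) * x.2 .ρ)
        + dp σ (x.2 .ρ) (x.2 .p) * ((c - 2 * a) * x.2 .p)))
      - x.2 .r * x.2 .ρ * pd (.inl .s) (η X .Hz) x := by
  obtain ⟨hr, hρ, hp, hs⟩ := h.ne_zero hx
  have e := h.eqn hx {} .Eθ
  simp only [linResidual, h.prolongSol_eq hx, FreeJet.toJet, h.Ds_ηHz hx, h.pd_Hθ_ηHz hS hx,
    h.pd_Hz_ηHz hS hx, hS.ξs x hx, hS.r x hx, hS.ρ x hx, hS.p x hx] at e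
  linear_combination (norm := skip) e
  field_simp
  ring

/-- Ohm's law gives `σ η^{E^θ}` and `σ η^{E^z}`; inserted into the Joule heating terms they yield a
polynomial in the electric field. Its `(E^z)²` coefficient is the condition on `σ`. The `(E^θ)²`
coefficient then fixes `η^z_z`, and the term linear in `E^θ` gives `η^{H^z}_s = 0`. -/
lemma eqn_p_aux {x : Pt} (hx : x ∈ domain) :
    dρ σ (x.2 .ρ) (x.2 .p) * ((c - 2 * b) * x.2 .ρ)
      + dp σ (x.2 .ρ) (x.2 .p) * ((c - 2 * a) * x.2 .p) = (c - a) * σ (x.2 .ρ) (x.2 .p) ∧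
    pd (.inr .z) (η X .z) x = b ∧ pd (.inl .s) (η X .Hz) x = 0 := by
  obtain ⟨hr, hρ, hp, hs⟩ := h.ne_zero hx
  have hγ : γ - 1 ≠ 0 := sub_ne_zero.2 h.one_lt_γ.ne'
  have key : ∀ x ∈ domain, _ := fun x hx => (h.eqn_p hx).2.2
  have hE := fun c => upd_mem' hx (k := .Eθ) (by decide) (by decide) (by decide) c
  have hZ := fun c d => upd_mem' (hE d) (k := .Ez) (by decide) (by decide) (by decide) c
  have e := fun c d => key _ (hZ c d)
  have m := fun c d => h.ηEθ_aux hS (hZ c d)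
  have n := fun c d => h.ηEz_aux hS (hZ c d)
  simp only [(h.pd_s_aux (hZ _ _)).2, (h.pd_s_aux (hZ _ _)).1, pd_eq_of_eq_mul hS.u _ (hZ _ _),
    pd_eq_of_eq_mul hS.p _ (hZ _ _), hS.ξt _ (hZ _ _), hS.ρ _ (hZ _ _), hS.p _ (hZ _ _),
    pd_upd (h.contDiffOn_η .z) h.isDtConst_ηz.Eθ _ hx (hE _),
    pd_upd (h.contDiffOn_η .z) h.isDtConst_ηz.Ez _ (hE _) (hZ _ _),
    pd_upd (h.contDiffOn_η .Hz)
      (fun _ hx => h.pd_ηHz' (k := .Eθ) (by decide) (by decide) (by decide) hx) _ hx (hE _),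
    pd_upd (h.contDiffOn_η .Hz)
      (fun _ hx => h.pd_ηHz' (k := .Ez) (by decide) (by decide) (by decide) hx) _ (hE _) (hZ _ _),
    upd_apply_self, upd_apply_ne, ne_eq, reduceCtorEq, not_false_eq_true, if_true, if_false]
    at e m n
  have q1 : dρ σ (x.2 .ρ) (x.2 .p) * ((c - 2 * b) * x.2 .ρ)
      + dp σ (x.2 .ρ) (x.2 .p) * ((c - 2 * a) * x.2 .p) = (c - a) * σ (x.2 .ρ) (x.2 .p) :=
    mul_left_cancel₀ hγ (by linear_combination e 1 0 + 2 * (γ - 1) * n 1 0)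
  refine ⟨q1, mul_left_cancel₀ (mul_ne_zero hγ hs) ?_,
    mul_left_cancel₀ (mul_ne_zero (mul_ne_zero hγ hr) hρ) ?_⟩
  · linear_combination (-1 / 4) * (e 0 1 + 2 * (γ - 1) * m 0 1)
      + (-1 / 4) * (e 0 (-1) - 2 * (γ - 1) * m 0 (-1)) + (γ - 1) / 2 * q1
  · linear_combination (1 / 4) * (e 0 1 + 2 * (γ - 1) * m 0 1)
      - (1 / 4) * (e 0 (-1) - 2 * (γ - 1) * m 0 (-1))

lemma ηEz_eq {x : Pt} (hx : x ∈ domain) : η X .Ez x = -a * x.2 .Ez := by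
  refine mul_left_cancel₀ (h.ne_zero hx).2.2.2 ?_
  linear_combination h.ηEz_aux hS hx - x.2 .Ez * (h.eqn_p_aux hS hx).1

lemma ηEθ_eq {x : Pt} (hx : x ∈ domain) : η X .Eθ x = -a * x.2 .Eθ := by
  obtain ⟨e1, e2, e3⟩ := h.eqn_p_aux hS hx
  have := h.ηEθ_aux hS hx
  rw [e1, e2, e3] at this
  refine mul_left_cancel₀ (h.ne_zero hx).2.2.2 ?_
  linear_combination this

/-- The coefficient of `v_s` in the induction equation for `H^θ` is `A ρ (c + 2b - 2a)`. This term
comes from the radial field `A / r`, so `A ≠ 0` ties the scaling of `s` to the other two. -/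
lemma c_eq : c = 2 * a - 2 * b := by
  have hx : ((0, fun _ => 1) : Pt) ∈ domain := ⟨one_pos, one_pos, one_pos⟩
  generalize ((0, fun _ => 1) : Pt) = x at hx
  obtain ⟨hr, hρ, hp, hs⟩ := h.ne_zero hx
  obtain ⟨g1, g2, -⟩ := h.pd_ηHθ_E hS hx
  have e0 := h.eqn hx {} .Hθ
  have e1 := h.eqn hx { vs := 1 } .Hθ
  simp only [linResidual, h.prolongSol_eq hx, FreeJet.toJet, Dt_eq, Ds_eq,
    pd_eq_of_eq_mul hS.v _ hx, pd_eq_of_eq_mul hS.r _ hx, pd_eq_of_eq_mul hS.u _ hx,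
    pd_eq_of_eq_mul (fun _ hx => h.ηEz_eq hS hx) _ hx, hS.ξt x hx, hS.ξs x hx, hS.r x hx,
    hS.ρ x hx, g1, g2, Sum.inr.injEq, reduceCtorEq, if_true, if_false] at e0 e1
  refine mul_left_cancel₀ (mul_ne_zero h.A_ne_zero hρ) ?_
  linear_combination e1 - e0

lemma pd_ηHθ_tr {x : Pt} (hx : x ∈ domain) :
    pd (.inl .t) (η X .Hθ) x = 0 ∧ pd (.inr .r) (η X .Hθ) x = 0 := by
  have key : ∀ x ∈ domain, pd (.inl .t) (η X .Hθ) x + x.2 .u * pd (.inr .r) (η X .Hθ) x = 0 := by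
    intro x hx
    obtain ⟨g1, g2, -⟩ := h.pd_ηHθ_E hS hx
    have pH := fun {k : Dep} (h1 : k ≠ .r) (h2 : k ≠ .Hθ) (h3 : k ≠ .Hz) => h.pd_ηHθ h1 h2 h3 hx
    have e0 := h.eqn hx {} .Hθ
    simp only [linResidual, h.prolongSol_eq hx, FreeJet.toJet, Dt_eq, Ds_eq, pH,
      pd_eq_of_eq_mul hS.v _ hx, pd_eq_of_eq_mul hS.r _ hx, pd_eq_of_eq_mul hS.u _ hx,
      pd_eq_of_eq_mul (fun _ hx => h.ηEz_eq hS hx) _ hx, g1, g2, Sum.inr.injEq, reduceCtorEq,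
      if_true, if_false, ne_eq, not_false_eq_true] at e0
    linear_combination e0
  have hc := fun c => upd_mem' hx (k := .u) (by decide) (by decide) (by decide) c
  have e := fun c => key _ (hc c)
  simp only [pd_upd (h.contDiffOn_η .Hθ)
      (fun _ hx => h.pd_ηHθ (k := .u) (by decide) (by decide) (by decide) hx) _ hx (hc _),
    upd_apply_self] at e
  exact ⟨by linear_combination e 0, by linear_combination e 1 - e 0⟩

lemma ηHθ_eq {x : Pt} (hx : x ∈ domain) : η X .Hθ x = -b * x.2 .Hθ := by
  have e := (h.pd_ηHθ_aux hx).2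
  rw [(h.pd_ηHθ_tr hS hx).2, (h.pd_ηHθ_E hS hx).1] at e
  linear_combination e + x.2 .Hθ * h.c_eq hS

lemma eqn_Hz_aux {x : Pt} (hx : x ∈ domain) :
    pd (.inl .t) (η X .Hz) x = A * x.2 .ρ * pd (.inl .s) (pd (.inl .t) (η X .z)) x ∧
    η X .Hz x = -b * x.2 .Hz := by
  obtain ⟨hr, hρ, hp, hs⟩ := h.ne_zero hx
  obtain ⟨-, e2, -⟩ := h.eqn_p_aux hS hx
  have hzz : ∀ i, pd i (pd (.inr .z) (η X .z)) x = 0 := fun i => by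
    rw [pd_congr (g := fun _ => b) (fun x hx => (h.eqn_p_aux hS hx).2.1) i hx, pd_const]
  have pK := fun {k : Dep} (h1 : k ≠ .Hz) => h.pd_ηHz_eq_zero hS h1 hx
  have pZ := fun {k : Dep} (h1 : k ≠ .z) => h.pd_dep_pd_ηz hS h1 (.inl .t) hx
  have e0 := h.eqn hx {} .Hz
  have u1 := h.eqn hx { us := 1 } .Hz
  simp only [linResidual, h.prolongSol_eq hx, FreeJet.toJet, Dt_eq, Ds_eq, pK, h.pd_ηw hS _ hx,
    hzz, pZ, (h.pd_pd_ηz hS hx).1, h.pd_Hz_ηHz hS hx, e2,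
    pd_eq_of_eq_mul hS.r _ hx, pd_eq_of_eq_mul hS.u _ hx,
    pd_eq_of_eq_mul (fun _ hx => h.ηEθ_eq hS hx) _ hx, hS.ξt x hx, hS.ξs x hx, hS.r x hx,
    hS.ρ x hx, Sum.inr.injEq, reduceCtorEq, if_true, if_false, ne_eq, not_false_eq_true] at e0 u1
  refine ⟨by linear_combination e0, mul_left_cancel₀ (mul_ne_zero hr hρ) ?_⟩
  linear_combination u1 - e0 + x.2 .r * x.2 .ρ * x.2 .Hz * h.c_eq hS

/-- In the induction equation `w_s` is multiplied by `A ρ`, so an `s`-dependent Galilean boost along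
`z` would make `η^{H^z}` depend on `t`, contrary to `η^{H^z} = -b H^z`. -/
lemma pd_s_pd_t_ηz {x : Pt} (hx : x ∈ domain) : pd (.inl .s) (pd (.inl .t) (η X .z)) x = 0 := by
  have e := (h.eqn_Hz_aux hS hx).1
  rw [pd_eq_of_eq_mul (fun _ hx => (h.eqn_Hz_aux hS hx).2) _ hx] at e
  refine mul_left_cancel₀ (mul_ne_zero h.A_ne_zero (h.ne_zero hx).2.1) ?_
  simp only [reduceCtorEq, if_false] at e
  linear_combination -e

lemma exists_pd_t_ηz : ∃ κ, ∀ x ∈ domain, pd (.inl .t) (η X .z) x = κ := by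
  refine exists_eq_const (contDiffOn_pd (h.contDiffOn_η _) _) ?_
  rintro (i | k) x hx
  · cases i
    · rw [(h.pd_pd_ηz hS hx).2, (h.eqn_p_aux hS hx).2.2, mul_zero]
    · exact h.pd_s_pd_t_ηz hS hx
  · by_cases hk : k = .z
    · subst hk
      exact (h.pd_pd_ηz hS hx).1
    · exact h.pd_dep_pd_ηz hS hk _ hx

end IsSymmetry

end

/-! ### Normal form of a symmetry, and its converse -/

noncomputable section

/-- The general form of a symmetry. -/
def normalForm (a b κ t₀ s₀ : ℝ) (h₁ h₂ : ℝ → ℝ) : Pt → Pt := fun x =>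
  (fun
    | .t => a * x.1 .t + t₀
    | .s => (2 * a - 2 * b) * x.1 .s + s₀,
   fun
    | .r => b * x.2 .r
    | .θ => h₁ (x.1 .s)
    | .z => b * x.2 .z + (κ * x.1 .t + h₂ (x.1 .s))
    | .u => (b - a) * x.2 .u
    | .v => (b - a) * x.2 .v
    | .w => (b - a) * x.2 .w + κ
    | .ρ => (2 * a - 4 * b) * x.2 .ρ
    | .p => -2 * b * x.2 .p
    | .Eθ => -a * x.2 .Eθ
    | .Ez => -a * x.2 .Ez
    | .Hθ => -b * x.2 .Hθ
    | .Hz => -b * x.2 .Hz)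

/-- The infinitesimal condition on the conductivity for the scaling with weights `a`, `b`. -/
def IsScaled (σ : ℝ → ℝ → ℝ) (a b : ℝ) : Prop := ∀ ρ p : ℝ, 0 < ρ → 0 < p →
  dρ σ ρ p * ((2 * a - 4 * b) * ρ) + dp σ ρ p * (-2 * b * p) = (a - 2 * b) * σ ρ p

lemma pd_add_mul_coord {f : Pt → ℝ} (hf : ContDiffOn ℝ ∞ f domain) (m : ℝ) (i j : Var) {x : Pt}
    (hx : x ∈ domain) :
    pd j (fun x => f x + m * coord i x) x = pd j f x + m * if j = i then 1 else 0 := by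
  rw [pd_add hf (contDiffOn_const.mul (contDiffOn_coord i)) _ hx,
    pd_mul contDiffOn_const (contDiffOn_coord i) _ hx, pd_const, pd_coord]
  ring

/-- A function of the variable `s` only. -/
lemma exists_eq_comp_s {f : Pt → ℝ} (hf : ContDiffOn ℝ ∞ f domain)
    (h : ∀ i, i ≠ .inl .s → ∀ x ∈ domain, pd i f x = 0) :
    ∃ g : ℝ → ℝ, ContDiff ℝ ∞ g ∧ ∀ x ∈ domain, f x = g (x.1 .s) := by
  have hm : ∀ c : ℝ, ((fun _ => c, fun _ => 1) : Pt) ∈ domain :=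
    fun c => ⟨one_pos, one_pos, one_pos⟩
  refine ⟨fun c => f (fun _ => c, fun _ => 1), ?_, fun x hx => ?_⟩
  · exact hf.comp_contDiff (f := fun c : ℝ => ((fun _ => c, fun _ => 1) : Pt)) (by fun_prop) hm
  · refine eq_of_pd_eq_zero hf hx (hm _) fun i hi => h i ?_
    rintro rfl
    exact hi rfl

theorem IsSymmetry.exists_normalForm {A γ : ℝ} {σ : ℝ → ℝ → ℝ} {X : Pt → Pt}
    (h : IsSymmetry A γ σ X) : ∃ a b κ t₀ s₀ : ℝ, ∃ h₁ h₂ : ℝ → ℝ, ContDiff ℝ ∞ h₁ ∧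
      ContDiff ℝ ∞ h₂ ∧ IsScaled σ a b ∧
      ∀ x ∈ domain, X x = normalForm a b κ t₀ s₀ h₁ h₂ x := by
  obtain ⟨a, b, c, hS⟩ := h.exists_isScaling
  have hc := h.c_eq hS
  obtain ⟨κ, hκ⟩ := h.exists_pd_t_ηz hS
  have smooth : ∀ {f : Pt → ℝ} (hf : ContDiffOn ℝ ∞ f domain) (m : ℝ) (i : Var),
      ContDiffOn ℝ ∞ (fun x => f x + m * coord i x) domain :=
    fun hf m i => hf.add (contDiffOn_const.mul (contDiffOn_coord i))
  -- Once its linear part is subtracted, `ξ^t` has no nonzero partial derivative; likewise `ξ^s`,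
  -- while the remainder of `η^z` is a function of `s`.
  obtain ⟨t₀, ht⟩ := exists_eq_const (smooth (h.contDiffOn_ξ .t) (-a) (.inl .t)) fun j x hx => by
    rw [pd_add_mul_coord (h.contDiffOn_ξ .t) _ _ _ hx]
    rcases j with i | k
    · cases i
      · simp [hS.ξt x hx]
      · simp [h.pd_s_ξt hx]
    · simp [h.pd_dep_ξt k hx]
  obtain ⟨s₀, hs⟩ := exists_eq_const (smooth (h.contDiffOn_ξ .s) (-c) (.inl .s)) fun j x hx => by
    rw [pd_add_mul_coord (h.contDiffOn_ξ .s) _ _ _ hx]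
    rcases j with i | k
    · cases i
      · simp [h.pd_t_ξs hx]
      · simp [hS.ξs x hx]
    · simp [h.pd_dep_ξs k hx]
  obtain ⟨h₁, s₁, e₁⟩ := exists_eq_comp_s (h.contDiffOn_η .θ)
    fun i hi x hx => h.pd_ηθ_eq_zero hi hx
  obtain ⟨h₂, s₂, e₂⟩ := exists_eq_comp_s
    (smooth (smooth (h.contDiffOn_η .z) (-b) (.inr .z)) (-κ) (.inl .t)) fun j hj x hx => by
      rw [pd_add_mul_coord (smooth (h.contDiffOn_η .z) _ _) _ _ _ hx,
        pd_add_mul_coord (h.contDiffOn_η .z) _ _ _ hx]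
      rcases j with i | k
      · cases i
        · simp [hκ x hx]
        · exact absurd rfl hj
      · by_cases h1 : k = .z
        · subst h1
          simp [(h.eqn_p_aux hS hx).2.1]
        by_cases h2 : k = .θ
        · subst h2
          simp [h.pd_θ_ηz hS hx]
        · simp [h.pd_ηz h2 h1 hx, h1]
  refine ⟨a, b, κ, t₀, s₀, h₁, h₂, s₁, s₂, fun ρ p hρ hp => ?_, fun x hx => ?_⟩
  · have := (h.eqn_p_aux hS
      (x := (0, fun | .ρ => ρ | .p => p | _ => 1)) ⟨one_pos, hρ, hp⟩).1
    simp only [hc] at this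
    linear_combination this
  · have ht' := ht x hx
    have hs' := hs x hx
    have hz' := e₂ x hx
    simp only [coord] at ht' hs' hz'
    refine Prod.ext (funext fun i => ?_) (funext fun k => ?_)
    · cases i
      · change ξ X .t x = a * x.1 .t + t₀
        linear_combination ht'
      · change ξ X .s x = (2 * a - 2 * b) * x.1 .s + s₀
        linear_combination hs' + x.1 .s * hc
    · cases k
      case r => exact hS.r x hx
      case u => exact hS.u x hx
      case v => exact hS.v x hx
      case θ => exact e₁ x hx
      case Eθ => exact h.ηEθ_eq hS hx
      case Ez => exact h.ηEz_eq hS hx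
      case Hθ => exact h.ηHθ_eq hS hx
      case Hz => exact (h.eqn_Hz_aux hS hx).2
      case z =>
        change η X .z x = b * x.2 .z + (κ * x.1 .t + h₂ (x.1 .s))
        linear_combination hz'
      case w =>
        change η X .w x = (b - a) * x.2 .w + κ
        rw [h.ηw_eq' hS hx, hκ x hx, (h.eqn_p_aux hS hx).2.1]
        simp only [coord]
        ring
      case ρ =>
        change η X .ρ x = (2 * a - 4 * b) * x.2 .ρ
        rw [hS.ρ x hx, hc]
        ring
      case p =>
        change η X .p x = -2 * b * x.2 .p
        rw [hS.p x hx, hc]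
        ring

lemma contDiff_normalForm (a b κ t₀ s₀ : ℝ) {h₁ h₂ : ℝ → ℝ} (s₁ : ContDiff ℝ ∞ h₁)
    (s₂ : ContDiff ℝ ∞ h₂) : ContDiff ℝ ∞ (normalForm a b κ t₀ s₀ h₁ h₂) := by
  refine ContDiff.prodMk (contDiff_pi.2 fun i => ?_) (contDiff_pi.2 fun k => ?_)
  · cases i <;> simp only <;> fun_prop
  · cases k <;> simp only <;> fun_prop

lemma totalDeriv_coord_dep (j : Indep) (k : Dep) (m d : ℝ) (J : Jet) :
    totalDeriv j (fun x => m * x.2 k + d) J = m * J.2 k j := by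
  have h : HasFDerivAt (fun x : Pt => m * x.2 k + d)
      (m • (ContinuousLinearMap.proj k : (Dep → ℝ) →L[ℝ] ℝ).comp
        (ContinuousLinearMap.snd ℝ (Indep → ℝ) (Dep → ℝ))) J.1 :=
    ((ContinuousLinearMap.hasFDerivAt ((ContinuousLinearMap.proj k : (Dep → ℝ) →L[ℝ] ℝ).comp
        (ContinuousLinearMap.snd ℝ (Indep → ℝ) (Dep → ℝ)))).const_mul m).add_const d
  rw [totalDeriv, h.fderiv]
  simp

lemma totalDeriv_coord_indep (j i : Indep) (m d : ℝ) (J : Jet) :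
    totalDeriv j (fun x => m * x.1 i + d) J = if i = j then m else 0 := by
  have h : HasFDerivAt (fun x : Pt => m * x.1 i + d)
      (m • (ContinuousLinearMap.proj i : (Indep → ℝ) →L[ℝ] ℝ).comp
        (ContinuousLinearMap.fst ℝ (Indep → ℝ) (Dep → ℝ))) J.1 :=
    ((ContinuousLinearMap.hasFDerivAt ((ContinuousLinearMap.proj i : (Indep → ℝ) →L[ℝ] ℝ).comp
        (ContinuousLinearMap.fst ℝ (Indep → ℝ) (Dep → ℝ)))).const_mul m).add_const d
  rw [totalDeriv, h.fderiv]
  simp [Pi.single_apply]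

lemma totalDeriv_t_comp_s {g : ℝ → ℝ} (hg : ContDiff ℝ ∞ g) (J : Jet) :
    totalDeriv .t (fun x => g (x.1 .s)) J = 0 := by
  have h0 : HasFDerivAt (fun x : Pt => x.1 .s)
      ((ContinuousLinearMap.proj Indep.s : (Indep → ℝ) →L[ℝ] ℝ).comp
        (ContinuousLinearMap.fst ℝ (Indep → ℝ) (Dep → ℝ))) J.1 :=
    ContinuousLinearMap.hasFDerivAt ((ContinuousLinearMap.proj Indep.s : (Indep → ℝ) →L[ℝ] ℝ).comp
        (ContinuousLinearMap.fst ℝ (Indep → ℝ) (Dep → ℝ)))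
  have h := ((hg.differentiable (by simp) (J.1.1 .s)).hasDerivAt).comp_hasFDerivAt J.1 h0
  change fderiv ℝ (g ∘ fun x : Pt => x.1 .s) J.1 _ = 0
  rw [h.fderiv]
  simp

lemma totalDeriv_add (j : Indep) {f g : Pt → ℝ} {J : Jet} (hf : DifferentiableAt ℝ f J.1)
    (hg : DifferentiableAt ℝ g J.1) :
    totalDeriv j (fun x => f x + g x) J = totalDeriv j f J + totalDeriv j g J := by
  rw [totalDeriv, fderiv_fun_add hf hg]
  rfl

/-- The first prolongation of the general form of a symmetry, apart from the coefficients at the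
`s`-derivatives of `θ` and `z`, which the system does not contain. -/
lemma prolong_normalForm (a b κ t₀ s₀ : ℝ) {h₁ h₂ : ℝ → ℝ} (s₁ : ContDiff ℝ ∞ h₁)
    (s₂ : ContDiff ℝ ∞ h₂) (J : Jet) (k : Dep) (j : Indep) (hk : j = .t ∨ k ≠ .θ ∧ k ≠ .z) :
    (prolong (normalForm a b κ t₀ s₀ h₁ h₂) J).2 k j =
      (match k with
        | .r => b | .θ => 0 | .z => b | .u => b - a | .v => b - a | .w => b - a
        | .ρ => 2 * a - 4 * b | .p => -2 * b | .Eθ => -a | .Ez => -a | .Hθ => -b | .Hz => -b)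
        * J.2 k j + (if k = .z then κ else 0)
      - J.2 k j * (match j with | .t => a | .s => 2 * a - 2 * b) := by
  have e : ∀ m, (fun x : Pt => m * x.2 k) = fun x => m * x.2 k + 0 := fun m => by simp
  have hi : J.2 k .t * totalDeriv j (ξ (normalForm a b κ t₀ s₀ h₁ h₂) .t) J
      + J.2 k .s * totalDeriv j (ξ (normalForm a b κ t₀ s₀ h₁ h₂) .s) J
      = J.2 k j * (match j with | .t => a | .s => 2 * a - 2 * b) := by
    have h1 : ξ (normalForm a b κ t₀ s₀ h₁ h₂) .t = fun x => a * x.1 .t + t₀ := rfl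
    have h2 : ξ (normalForm a b κ t₀ s₀ h₁ h₂) .s = fun x => (2 * a - 2 * b) * x.1 .s + s₀ := rfl
    rw [h1, h2, totalDeriv_coord_indep, totalDeriv_coord_indep]
    cases j <;> simp
  rw [prolong_snd, hi]
  congr 1
  cases k
  case θ =>
    obtain rfl : j = .t := by simpa using hk
    change totalDeriv .t (fun x => h₁ (x.1 .s)) J = _
    rw [totalDeriv_t_comp_s s₁]
    simp
  case z =>
    obtain rfl : j = .t := by simpa using hk
    change totalDeriv .t (fun x => b * x.2 .z + (κ * x.1 .t + h₂ (x.1 .s))) J = _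
    have d₂ : DifferentiableAt ℝ (fun x : Pt => h₂ (x.1 .s)) J.1 := by
      have := s₂.differentiable (by simp)
      fun_prop
    have d₁ : DifferentiableAt ℝ (fun x : Pt => κ * x.1 .t) J.1 := by fun_prop
    have e2 : (fun x : Pt => κ * x.1 .t) = fun x => κ * x.1 .t + 0 := by simp
    have d₀ : DifferentiableAt ℝ (fun x : Pt => b * x.2 .z) J.1 := by fun_prop
    have d₃ : DifferentiableAt ℝ (fun x : Pt => κ * x.1 .t + h₂ (x.1 .s)) J.1 := d₁.add d₂
    rw [totalDeriv_add _ d₀ d₃, totalDeriv_add _ d₁ d₂,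
      totalDeriv_t_comp_s s₂, e, totalDeriv_coord_dep, e2, totalDeriv_coord_indep]
    simp
  case w => exact (totalDeriv_coord_dep j .w (b - a) κ J).trans (by simp)
  all_goals
    refine Eq.trans (congrArg (totalDeriv j · J) (e _)) ((totalDeriv_coord_dep j _ _ 0 J).trans ?_)
    simp

/-- Every equation is homogeneous under the two scalings, so each linearised residual is a weight
times the residual itself. The condition on `σ` is needed only where `σ` occurs: in the pressure
equation and in the two Ohm's laws. -/
theorem normalForm_mem {A γ : ℝ} {σ : ℝ → ℝ → ℝ} (hσ : IsConductivity σ) {a b : ℝ}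
    (hab : IsScaled σ a b) (κ t₀ s₀ : ℝ) {h₁ h₂ : ℝ → ℝ} (s₁ : ContDiff ℝ ∞ h₁)
    (s₂ : ContDiff ℝ ∞ h₂) : normalForm a b κ t₀ s₀ h₁ h₂ ∈ admittedAlgebra A γ σ := by
  refine ⟨(contDiff_normalForm a b κ t₀ s₀ s₁ s₂).contDiffOn, fun J hJ hs k => ?_⟩
  rw [fderiv_residual hσ k hJ]
  have P := prolong_normalForm a b κ t₀ s₀ s₁ s₂ J
  have hr := hJ.1.ne'
  have hc := hab _ _ hJ.2.1 hJ.2.2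
  have hv : (prolong (normalForm a b κ t₀ s₀ h₁ h₂) J).1 = normalForm a b κ t₀ s₀ h₁ h₂ J.1 := rfl
  have hk := hs k
  cases k <;> simp only [residual] at hk <;>
    simp only [linResidual, P, hv, normalForm, true_or, ne_eq, reduceCtorEq, not_false_eq_true,
      and_self, or_true, if_true, if_false]
  case r => linear_combination (b - a) * hk
  case z => linear_combination (b - a) * hk
  case θ =>
    linear_combination (norm := skip) -a * hk
    field_simp
    ring
  case u =>
    linear_combination (norm := skip) (b - 2 * a) * hk
    field_simp
    ring
  case v =>
    linear_combination (norm := skip) (b - 2 * a) * hk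
    field_simp
    ring
  case w =>
    linear_combination (norm := skip) (b - 2 * a) * hk
    field_simp
    ring
  case ρ => linear_combination (a - 4 * b) * hk
  case p =>
    linear_combination (-2 * b - a) * hk
      - (γ - 1) * (J.1.2 .Eθ ^ 2 + J.1.2 .Ez ^ 2) * hc
  case Hθ =>
    linear_combination (norm := skip) (-b - a) * hk
    field_simp
    ring
  case Hz =>
    linear_combination (norm := skip) (-b - a) * hk
    field_simp
    ring
  case Eθ => linear_combination (-2 * b) * hk + J.1.2 .Eθ * hc
  case Ez => linear_combination (-2 * b) * hk + J.1.2 .Ez * hc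

end

noncomputable section

/-! ### The condition on the conductivity -/

lemma IsConductivity.hasDerivAt_flow {σ : ℝ → ℝ → ℝ} (hσ : IsConductivity σ) (m n : ℝ) {ρ p : ℝ}
    (hρ : 0 < ρ) (hp : 0 < p) (c : ℝ) :
    HasDerivAt (fun c => σ (Real.exp (m * c) * ρ) (Real.exp (n * c) * p))
      (dρ σ (Real.exp (m * c) * ρ) (Real.exp (n * c) * p) * (m * (Real.exp (m * c) * ρ))
        + dp σ (Real.exp (m * c) * ρ) (Real.exp (n * c) * p) * (n * (Real.exp (n * c) * p))) c := by
  have he : ∀ m ρ : ℝ, HasDerivAt (fun c => Real.exp (m * c) * ρ)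
      (m * (Real.exp (m * c) * ρ)) c := fun m ρ => by
    have h1 : HasDerivAt (fun c : ℝ => m * c) m c := by
      simpa using (hasDerivAt_id c).const_mul m
    exact (h1.exp.mul_const ρ).congr_deriv (by ring)
  exact hσ.hasDerivAt_comp (he m ρ) (he n p) (by positivity) (by positivity)

/-- The finite form of the condition on the conductivity. -/
lemma isScaled_iff {σ : ℝ → ℝ → ℝ} (hσ : IsConductivity σ) {a b : ℝ} : IsScaled σ a b ↔
    ∀ ρ p c : ℝ, 0 < ρ → 0 < p → σ (Real.exp ((2 * a - 4 * b) * c) * ρ) (Real.exp (-2 * b * c) * p)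
      = Real.exp ((a - 2 * b) * c) * σ ρ p := by
  constructor
  · intro h ρ p c hρ hp
    -- Along a characteristic `σ` is multiplied by `e^{(a - 2b) c}`, so the compensated product has
    -- zero derivative.
    have hd : ∀ c, HasDerivAt (fun c => Real.exp (-(a - 2 * b) * c)
        * σ (Real.exp ((2 * a - 4 * b) * c) * ρ) (Real.exp (-2 * b * c) * p)) 0 c := fun c => by
      have h1 : HasDerivAt (fun c : ℝ => -(a - 2 * b) * c) (-(a - 2 * b)) c := by
        simpa using (hasDerivAt_id c).const_mul (-(a - 2 * b))
      refine (h1.exp.mul (hσ.hasDerivAt_flow (2 * a - 4 * b) (-2 * b) hρ hp c)).congr_deriv ?_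
      have := h (Real.exp ((2 * a - 4 * b) * c) * ρ) (Real.exp (-2 * b * c) * p)
        (by positivity) (by positivity)
      linear_combination Real.exp (-(a - 2 * b) * c) * this
    have h0 := is_const_of_deriv_eq_zero (fun c => (hd c).differentiableAt)
      (fun c => (hd c).deriv) c 0
    simp only [mul_zero, Real.exp_zero, one_mul] at h0
    rw [← h0, ← mul_assoc, ← Real.exp_add, ← add_mul, add_neg_cancel, zero_mul, Real.exp_zero,
      one_mul]
  · intro h ρ p hρ hp
    have h1 := hσ.hasDerivAt_flow (2 * a - 4 * b) (-2 * b) hρ hp 0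
    have h2 : HasDerivAt (fun c : ℝ => Real.exp ((a - 2 * b) * c) * σ ρ p)
        ((a - 2 * b) * σ ρ p) 0 := by
      have h3 : HasDerivAt (fun c : ℝ => (a - 2 * b) * c) (a - 2 * b) 0 := by
        simpa using (hasDerivAt_id (0 : ℝ)).const_mul (a - 2 * b)
      exact (h3.exp.mul_const _).congr_deriv (by simp)
    have h4 := h1.unique (h2.congr_of_eventuallyEq (.of_forall fun c => h ρ p c hρ hp))
    simpa using h4

/-- With `k = a - 2b`, the number `log ρ / (2k)` is the time at which the characteristic flow
carries density `1` to `ρ`. -/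
lemma exp_two_mul_log_div {k ρ : ℝ} (hk : k ≠ 0) (hρ : 0 < ρ) :
    Real.exp (2 * k * (Real.log ρ / (2 * k))) = ρ ∧ Real.exp (k * (Real.log ρ / (2 * k))) = √ρ := by
  constructor
  · rw [mul_div_cancel₀ _ (by simpa using hk), Real.exp_log hρ]
  · rw [Real.sqrt_eq_rpow, Real.rpow_def_of_pos hρ]
    congr 1
    field_simp

lemma IsScaled.eq_of_isDensityForm {σ : ℝ → ℝ → ℝ} (hσ : IsConductivity σ) {a b : ℝ}
    (h : IsScaled σ a b) (hF : IsDensityForm σ) (hs : ¬ IsSqrtForm σ) : a = 2 * b := by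
  obtain ⟨F, hF⟩ := hF
  by_contra hab
  have hk : a - 2 * b ≠ 0 := sub_ne_zero.2 hab
  refine hs ⟨F 1, fun ρ p hρ hp => ?_⟩
  obtain ⟨e1, e2⟩ := exp_two_mul_log_div hk hρ
  have := (isScaled_iff hσ).1 h 1 p (Real.log ρ / (2 * (a - 2 * b))) one_pos hp
  rw [hF _ _ (by positivity) (by positivity), hF _ _ one_pos hp, e2,
    show 2 * a - 4 * b = 2 * (a - 2 * b) by ring, e1, mul_one] at this
  rw [hF _ _ hρ hp, this, mul_comm]

lemma IsDensityForm.isScaled {σ : ℝ → ℝ → ℝ} (hσ : IsConductivity σ) (hF : IsDensityForm σ)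
    (b : ℝ) : IsScaled σ (2 * b) b := by
  obtain ⟨F, hF⟩ := hF
  refine (isScaled_iff hσ).2 fun ρ p c hρ hp => ?_
  rw [hF _ _ (by positivity) (by positivity), hF _ _ hρ hp]
  ring_nf
  simp

lemma rpow_flow {ρ p : ℝ} (hρ : 0 < ρ) (α m n : ℝ) :
    Real.exp n * p * (Real.exp m * ρ) ^ α = Real.exp (n + m * α) * (p * ρ ^ α) := by
  rw [Real.mul_rpow (Real.exp_pos _).le hρ.le, ← Real.exp_mul, Real.exp_add]
  ring

lemma sqrt_flow {ρ : ℝ} (k c : ℝ) : √(Real.exp (2 * k * c) * ρ) = Real.exp (k * c) * √ρ := by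
  rw [Real.sqrt_mul (Real.exp_pos _).le, Real.sqrt_eq_rpow, ← Real.exp_mul]
  ring_nf

lemma IsScaled.eq_of_isPowerForm {σ : ℝ → ℝ → ℝ} (hσ : IsConductivity σ) {a b α : ℝ}
    (h : IsScaled σ a b) (hF : IsPowerForm α σ) (hs : ¬ IsSqrtForm σ) : b = (a - 2 * b) * α := by
  obtain ⟨F, hF⟩ := hF
  by_contra hab
  -- This is the rate at which the invariant `y = p ρ^α` grows along the flow. If it is nonzero,
  -- some time carries `y` from `1` to any positive value, and cancelling the factor of `√ρ` makes
  -- `F` constant on positive arguments.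
  have hk : -2 * b + (2 * a - 4 * b) * α ≠ 0 := fun h0 => hab (by linear_combination -h0 / 2)
  refine hs ⟨F 1, fun ρ p hρ hp => ?_⟩
  have hy : 0 < p * ρ ^ α := mul_pos hp (Real.rpow_pos_of_pos hρ _)
  have := (isScaled_iff hσ).1 h 1 1
    (Real.log (p * ρ ^ α) / (-2 * b + (2 * a - 4 * b) * α)) one_pos one_pos
  generalize hc : Real.log (p * ρ ^ α) / (-2 * b + (2 * a - 4 * b) * α) = c at this
  have hc' : -2 * b * c + (2 * a - 4 * b) * c * α = Real.log (p * ρ ^ α) := by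
    rw [← div_mul_cancel₀ (Real.log (p * ρ ^ α)) hk, hc]
    ring
  rw [hF _ _ (by positivity) (by positivity), hF _ _ one_pos one_pos, rpow_flow one_pos, hc',
    Real.exp_log hy, show 2 * a - 4 * b = 2 * (a - 2 * b) by ring, sqrt_flow] at this
  simp only [Real.one_rpow, Real.sqrt_one, mul_one, one_mul] at this
  rw [hF _ _ hρ hp, mul_left_cancel₀ (Real.exp_pos _).ne' this, mul_comm]

lemma IsPowerForm.isScaled {σ : ℝ → ℝ → ℝ} (hσ : IsConductivity σ) {a b α : ℝ}
    (hF : IsPowerForm α σ) (hab : b = (a - 2 * b) * α) : IsScaled σ a b := by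
  obtain ⟨F, hF⟩ := hF
  refine (isScaled_iff hσ).2 fun ρ p c hρ hp => ?_
  have h0 : -2 * b * c + (2 * a - 4 * b) * c * α = 0 := by linear_combination -2 * c * hab
  rw [hF _ _ (by positivity) (by positivity), hF _ _ hρ hp, rpow_flow hρ, h0,
    show 2 * a - 4 * b = 2 * (a - 2 * b) by ring, sqrt_flow, Real.exp_zero, one_mul, mul_assoc]

lemma IsSqrtForm.isScaled {σ : ℝ → ℝ → ℝ} (hσ : IsConductivity σ) (hF : IsSqrtForm σ)
    (a b : ℝ) : IsScaled σ a b := by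
  obtain ⟨C, hC⟩ := hF
  refine (isScaled_iff hσ).2 fun ρ p c hρ hp => ?_
  rw [hC _ _ (by positivity) (by positivity), hC _ _ hρ hp,
    show 2 * a - 4 * b = 2 * (a - 2 * b) by ring, sqrt_flow]
  ring

lemma IsScaled.eq_zero {σ : ℝ → ℝ → ℝ} (hσ : IsConductivity σ) {a b : ℝ} (h : IsScaled σ a b)
    (h1 : ¬ IsDensityForm σ) (h2 : ∀ α, ¬ IsPowerForm α σ) : a = 0 ∧ b = 0 := by
  rw [isScaled_iff hσ] at h
  by_cases hk : a - 2 * b = 0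
  · by_cases hb : b = 0
    · exact ⟨by linear_combination hk + 2 * hb, hb⟩
    refine absurd ⟨fun ρ => σ ρ 1, fun ρ p hρ hp => ?_⟩ h1
    have := h ρ 1 (Real.log p / (-2 * b)) hρ one_pos
    rwa [show 2 * a - 4 * b = 2 * (a - 2 * b) by ring, hk, mul_div_cancel₀ _ (by simpa using hb),
      Real.exp_log hp, mul_zero, zero_mul, Real.exp_zero, one_mul, mul_one, one_mul] at this
  -- With `α = b / (a - 2b)` the product `p ρ^α` is constant along characteristics, each of which
  -- meets `ρ = 1`.
  · refine absurd ⟨fun y => σ 1 y, fun ρ p hρ hp => ?_⟩ (h2 (b / (a - 2 * b)))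
    obtain ⟨e1, e2⟩ := exp_two_mul_log_div hk hρ
    have := h 1 (p * ρ ^ (b / (a - 2 * b))) (Real.log ρ / (2 * (a - 2 * b))) one_pos
      (mul_pos hp (Real.rpow_pos_of_pos hρ _))
    have e3 : Real.exp (-2 * b * (Real.log ρ / (2 * (a - 2 * b)))) * (p * ρ ^ (b / (a - 2 * b)))
        = p := by
      rw [Real.rpow_def_of_pos hρ, mul_left_comm, ← Real.exp_add]
      have : -2 * b * (Real.log ρ / (2 * (a - 2 * b))) + Real.log ρ * (b / (a - 2 * b)) = 0 := by
        field_simp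
        ring
      rw [this, Real.exp_zero, mul_one]
    rwa [e2, e3, show 2 * a - 4 * b = 2 * (a - 2 * b) by ring, e1, mul_one] at this

/-! ### The admitted algebras -/

lemma zeroFields_le (A γ : ℝ) (σ : ℝ → ℝ → ℝ) : zeroFields ≤ admittedAlgebra A γ σ := by
  intro X hX
  have h0 : ∀ x ∈ domain, X x = (0 : Pt → Pt) x := hX
  refine ⟨contDiffOn_const.congr h0, fun J hJ hs k => ?_⟩
  have he : X =ᶠ[nhds J.1] 0 := Filter.eventuallyEq_of_mem (isOpen_domain.mem_nhds hJ) h0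
  have hp : prolong X J = 0 := by
    refine Prod.ext (hX _ hJ) (funext fun k => funext fun j => ?_)
    have h1 : ∀ {f : Pt → ℝ}, f =ᶠ[nhds J.1] (fun _ => 0) → totalDeriv j f J = 0 := fun hf => by
      simp [totalDeriv, hf.fderiv_eq]
    have h2 : totalDeriv j (fun x => (X x).2 k) J = 0 :=
      h1 (he.mono fun x hx => by simp [hx])
    have h3 : ∀ i, totalDeriv j (fun x => (X x).1 i) J = 0 := fun i =>
      h1 (he.mono fun x hx => by simp [hx])
    simp [prolong, h2, h3]
  rw [hp, map_zero]

lemma normalForm_eq (a b κ t₀ s₀ : ℝ) (h₁ h₂ : ℝ → ℝ) : normalForm a b κ t₀ s₀ h₁ h₂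
    = t₀ • dT + s₀ • dS + κ • galilei + rotation h₁ + translation h₂ + (a • Y₃ + b • Y₄) := by
  funext x
  refine Prod.ext (funext fun i => ?_) (funext fun k => ?_)
  · cases i <;> simp [normalForm, dT, dS, galilei, rotation, translation, Y₃, Y₄] <;> ring
  · cases k <;> simp [normalForm, dT, dS, galilei, rotation, translation, Y₃, Y₄] <;> ring

lemma mem_kernelAlgebra (κ t₀ s₀ : ℝ) {h₁ h₂ : ℝ → ℝ} (s₁ : ContDiff ℝ ∞ h₁)
    (s₂ : ContDiff ℝ ∞ h₂) :
    t₀ • dT + s₀ • dS + κ • galilei + rotation h₁ + translation h₂ ∈ kernelAlgebra := by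
  refine Submodule.mem_sup_left ?_
  refine add_mem (add_mem (add_mem (add_mem ?_ ?_) ?_) ?_) ?_
  · exact Submodule.smul_mem _ _ (Submodule.subset_span (by simp))
  · exact Submodule.smul_mem _ _ (Submodule.subset_span (by simp))
  · exact Submodule.smul_mem _ _ (Submodule.subset_span (by simp))
  · exact Submodule.subset_span (Or.inl (Or.inr ⟨h₁, s₁, rfl⟩))
  · exact Submodule.subset_span (Or.inr ⟨h₂, s₂, rfl⟩)

lemma isScaled_zero (σ : ℝ → ℝ → ℝ) : IsScaled σ 0 0 := fun ρ p _ _ => by ring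

lemma rotation_zero : rotation (fun _ => 0) = 0 := by
  funext x
  simp [rotation]

lemma translation_zero : translation (fun _ => 0) = 0 := by
  funext x
  simp [translation]

lemma kernelAlgebra_le {A γ : ℝ} {σ : ℝ → ℝ → ℝ} (hσ : IsConductivity σ) :
    kernelAlgebra ≤ admittedAlgebra A γ σ := by
  have key : ∀ (κ t₀ s₀ : ℝ) {h₁ h₂ : ℝ → ℝ} (_ : ContDiff ℝ ∞ h₁) (_ : ContDiff ℝ ∞ h₂),
      t₀ • dT + s₀ • dS + κ • galilei + rotation h₁ + translation h₂ ∈ admittedAlgebra A γ σ :=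
    fun κ t₀ s₀ _ _ s₁ s₂ => by
      simpa [normalForm_eq] using normalForm_mem hσ (isScaled_zero σ) κ t₀ s₀ s₁ s₂
  have c0 : ContDiff ℝ ∞ (fun _ : ℝ => (0 : ℝ)) := contDiff_const
  refine sup_le (Submodule.span_le.2 ?_) (zeroFields_le A γ σ)
  rintro X (((rfl | rfl | rfl) | ⟨g, hg, rfl⟩) | ⟨g, hg, rfl⟩)
  · simpa [rotation_zero, translation_zero] using key 0 1 0 c0 c0
  · simpa [rotation_zero, translation_zero] using key 0 0 1 c0 c0
  · simpa [rotation_zero, translation_zero] using key 1 0 0 c0 c0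
  · simpa [rotation_zero, translation_zero] using key 0 0 0 hg c0
  · simpa [rotation_zero, translation_zero] using key 0 0 0 c0 hg

lemma smul_add_smul_mem {A γ : ℝ} {σ : ℝ → ℝ → ℝ} (hσ : IsConductivity σ) {a b : ℝ}
    (h : IsScaled σ a b) : a • Y₃ + b • Y₄ ∈ admittedAlgebra A γ σ := by
  have c0 : ContDiff ℝ ∞ (fun _ : ℝ => (0 : ℝ)) := contDiff_const
  simpa [normalForm_eq, rotation_zero, translation_zero] using normalForm_mem hσ h 0 0 0 c0 c0

/-- A symmetry is, modulo the kernel, a combination of the scalings `Y₃` and `Y₄`. -/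
lemma exists_of_mem {A γ : ℝ} (hA : A ≠ 0) (hγ : 1 < γ) {σ : ℝ → ℝ → ℝ} (hσ : IsConductivity σ)
    {X : Pt → Pt} (hX : X ∈ admittedAlgebra A γ σ) :
    ∃ a b, IsScaled σ a b ∧ ∃ Y ∈ kernelAlgebra, X = Y + (a • Y₃ + b • Y₄) := by
  obtain ⟨a, b, κ, t₀, s₀, h₁, h₂, s₁, s₂, hs, he⟩ :=
    IsSymmetry.exists_normalForm ⟨hA, hγ, hσ, hX.1, hX.2⟩
  refine ⟨a, b, hs, X - (a • Y₃ + b • Y₄), ?_, by simp⟩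
  have hz : X - normalForm a b κ t₀ s₀ h₁ h₂ ∈ zeroFields := fun x hx => by
    simp [he x hx]
  have := add_mem (Submodule.mem_sup_right hz) (mem_kernelAlgebra κ t₀ s₀ s₁ s₂)
  rw [normalForm_eq] at this
  rwa [add_comm _ (a • Y₃ + b • Y₄), sub_add_eq_sub_sub, sub_add_cancel] at this

lemma admittedAlgebra_eq {A γ : ℝ} (hA : A ≠ 0) (hγ : 1 < γ) {σ : ℝ → ℝ → ℝ}
    (hσ : IsConductivity σ) {M : Submodule ℝ (Pt → Pt)}
    (h1 : ∀ a b, IsScaled σ a b → a • Y₃ + b • Y₄ ∈ M) (h2 : M ≤ admittedAlgebra A γ σ) :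
    admittedAlgebra A γ σ = kernelAlgebra ⊔ M := by
  refine le_antisymm (fun X hX => ?_) (sup_le (kernelAlgebra_le hσ) h2)
  obtain ⟨a, b, hs, Y, hY, rfl⟩ := exists_of_mem hA hγ hσ hX
  exact add_mem (Submodule.mem_sup_left hY) (Submodule.mem_sup_right (h1 a b hs))

/-- The value of a component of a vector field at the point with unit dependent variables. -/
def evalAt (k : Dep) : (Pt → Pt) →ₗ[ℝ] ℝ where
  toFun X := (X (0, fun _ => 1)).2 k
  map_add' _ _ := rfl
  map_smul' _ _ := rfl

/-- Serves to separate `Y₃`, `Y₄` from the kernel: on `a Y₃ + b Y₄` the components at `r` and `u`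
take the values `b` and `b - a`. -/
lemma evalAt_kernelAlgebra {k : Dep} (h1 : k ≠ .θ) (h2 : k ≠ .z) (h3 : k ≠ .w) {X : Pt → Pt}
    (hX : X ∈ kernelAlgebra) : evalAt k X = 0 := by
  have : kernelAlgebra ≤ LinearMap.ker (evalAt k) := by
    refine sup_le (Submodule.span_le.2 ?_) fun X hX => ?_
    · rintro X (((rfl | rfl | rfl) | ⟨g, hg, rfl⟩) | ⟨g, hg, rfl⟩) <;>
        simp [evalAt, dT, dS, galilei, rotation, translation, h1, h2, h3]
    · have h0 : X (0, fun _ => 1) = 0 := hX _ ⟨one_pos, one_pos, one_pos⟩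
      simp [evalAt, h0]
  exact this hX

lemma eq_zero_of_evalAt {a b : ℝ} (hr : evalAt .r (a • Y₃ + b • Y₄) = 0)
    (hu : evalAt .u (a • Y₃ + b • Y₄) = 0) : a = 0 ∧ b = 0 := by
  simp only [evalAt, LinearMap.coe_mk, AddHom.coe_mk, Pi.add_apply, Pi.smul_apply, Prod.snd_add,
    Prod.smul_snd, Y₃, Y₄, smul_eq_mul] at hr hu
  exact ⟨by linarith, by linarith⟩

/-- One conductivity of none of the special forms is enough to bound the intersection of all the
algebras by the kernel. -/
lemma isConductivity_one_add : IsConductivity fun _ p => 1 + p :=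
  ⟨by fun_prop, fun _ _ _ hp => by positivity⟩

lemma not_isDensityForm_one_add : ¬ IsDensityForm fun _ p => 1 + p := by
  rintro ⟨F, hF⟩
  have h1 := hF 1 1 one_pos one_pos
  have h2 := hF 1 2 one_pos two_pos
  linarith

lemma not_isPowerForm_one_add (α : ℝ) : ¬ IsPowerForm α fun _ p => 1 + p := by
  rintro ⟨F, hF⟩
  have h4 : √(4 : ℝ) = 2 := by
    rw [show (4 : ℝ) = 2 ^ 2 by norm_num, Real.sqrt_sq two_pos.le]
  have hq : (0 : ℝ) < 4 ^ α := Real.rpow_pos_of_pos (by norm_num) α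
  -- The points `(1, y)` and `(4, y / 4^α)` have the same `p ρ^α`, so the conductivities there would
  -- have ratio `√4 = 2`. Two values of `y` contradict this affine identity.
  have key : ∀ y : ℝ, 0 < y → 1 + y / 4 ^ α = 2 * (1 + y) := fun y hy => by
    have h1 := hF 1 y one_pos hy
    have h2 := hF 4 (y / 4 ^ α) (by norm_num) (by positivity)
    rw [div_mul_cancel₀ _ hq.ne', h4] at h2
    rw [Real.sqrt_one, Real.one_rpow, one_mul, mul_one] at h1
    linarith
  have h1 := key 1 one_pos
  have h2 := key 2 two_pos
  have h3 : (2 : ℝ) / 4 ^ α = 2 * (1 / 4 ^ α) := by ring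
  linarith

end

end CylMHD

open CylMHD in
theorem mainTheorem1 (γ : ℝ) (hγ : 1 < γ) (A : ℝ) (hA : A ≠ 0) :
    -- the kernel of the admitted Lie algebras
    (⨅ σ ∈ {σ | IsConductivity σ}, admittedAlgebra A γ σ) = kernelAlgebra ∧
    -- `Y₃`, `Y₄` are linearly independent modulo the kernel
    LinearIndependent ℝ ![Y₃, Y₄] ∧
    Disjoint kernelAlgebra (Submodule.span ℝ {Y₃, Y₄}) ∧
    -- the admitted Lie algebra of every single conductivity
    ∀ σ : ℝ → ℝ → ℝ, IsConductivity σ →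
      (IsDensityForm σ → ¬ IsSqrtForm σ →
        admittedAlgebra A γ σ
          = kernelAlgebra ⊔ Submodule.span ℝ {(2 : ℝ) • Y₃ + Y₄}) ∧
      (∀ α : ℝ, IsPowerForm α σ → ¬ IsSqrtForm σ →
        admittedAlgebra A γ σ
          = kernelAlgebra ⊔ Submodule.span ℝ {(1 + 2 * α) • Y₃ + α • Y₄}) ∧
      (IsSqrtForm σ →
        admittedAlgebra A γ σ = kernelAlgebra ⊔ Submodule.span ℝ {Y₃, Y₄}) ∧
      (¬ IsDensityForm σ → (∀ α : ℝ, ¬ IsPowerForm α σ) →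
        admittedAlgebra A γ σ = kernelAlgebra) := by
  have generic : ∀ σ : ℝ → ℝ → ℝ, IsConductivity σ → ¬ IsDensityForm σ →
      (∀ α : ℝ, ¬ IsPowerForm α σ) → admittedAlgebra A γ σ = kernelAlgebra := by
    intro σ hσ h1 h2
    have := admittedAlgebra_eq (M := ⊥) hA hγ hσ (fun a b hs => by
      obtain ⟨rfl, rfl⟩ := hs.eq_zero hσ h1 h2
      simp) bot_le
    rwa [sup_bot_eq] at this
  refine ⟨le_antisymm ?_ (le_iInf₂ fun σ hσ => kernelAlgebra_le hσ), ?_, ?_,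
    fun σ hσ => ⟨fun hF hs => ?_, fun α hF hs => ?_, fun hF => ?_, generic σ hσ⟩⟩
  · rw [← generic _ isConductivity_one_add not_isDensityForm_one_add not_isPowerForm_one_add]
    exact iInf₂_le (fun _ p => 1 + p) isConductivity_one_add
  · refine LinearIndependent.pair_iff.2 fun a b hab => ?_
    exact eq_zero_of_evalAt (by rw [hab, map_zero]) (by rw [hab, map_zero])
  · refine Submodule.disjoint_def.2 fun X hX hX' => ?_
    obtain ⟨a, b, rfl⟩ := Submodule.mem_span_pair.1 hX'
    obtain ⟨rfl, rfl⟩ := eq_zero_of_evalAt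
      (evalAt_kernelAlgebra (by decide) (by decide) (by decide) hX)
      (evalAt_kernelAlgebra (by decide) (by decide) (by decide) hX)
    simp
  · refine admittedAlgebra_eq hA hγ hσ (fun a b h => ?_) ?_
    · obtain rfl := h.eq_of_isDensityForm hσ hF hs
      exact Submodule.mem_span_singleton.2 ⟨b, by module⟩
    · rw [Submodule.span_singleton_le_iff_mem]
      simpa using smul_add_smul_mem hσ (hF.isScaled hσ 1)
  · refine admittedAlgebra_eq hA hγ hσ (fun a b h => ?_) ?_
    · have hb := h.eq_of_isPowerForm hσ hF hs
      -- Put `k = a - 2b`. The relation `b = k α` gives `a = k (1 + 2α)`.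
      refine Submodule.mem_span_singleton.2 ⟨a - 2 * b, ?_⟩
      rw [smul_add, smul_smul, smul_smul]
      congr 2
      · linear_combination -2 * hb
      · exact hb.symm
    · rw [Submodule.span_singleton_le_iff_mem]
      exact smul_add_smul_mem hσ (hF.isScaled hσ (by ring))
  · refine admittedAlgebra_eq hA hγ hσ (fun a b _ => Submodule.mem_span_pair.2 ⟨a, b, rfl⟩) ?_
    rw [Submodule.span_le]
    rintro X (rfl | rfl)
    · simpa using smul_add_smul_mem (A := A) (γ := γ) hσ (hF.isScaled hσ 1 0)
    · simpa using smul_add_smul_mem (A := A) (γ := γ) hσ (hF.isScaled hσ 0 1)
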